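/- All graphs are finite and simple. A list-assignment $L$ for a graph $G$ assigns to each vertex $v$ a finite set $L(v)\subseteq\mathbb{N}$. For $S\subseteq V(G)$, an $L$-colouring of $S$ is a function $\phi$ on $S$ with $\phi(v)\in L(v)$ for all $v\in S$ and $\phi(x)\neq\phi(y)$ whenever $x,y\in S$ are adjacent in $G$; an $L$-colouring of $G$ is an $L$-colouring of $V(G)$. Let $G$ be a planar graph (not necessarily connected), embedded in the plane so that its outer face is bounded by a cycle $C$. Let $P=p_0qp_1$ be a path with two edges contained in $C$, and let $L$ be a list-assignment for $G$ such that $L(p_0)$ and $L(p_1)$ are nonempty, $|L(p_0)|+|L(p_1)|\geq 4$, $|L(v)|\geq 3$ for every $v\in V(C)\setminus\{p_0,q,p_1\}$, and $|L(v)|\geq 5$ for every $v\in V(G)\setminus V(C)$ (no condition is imposed on $L(q)$). Let $\mathrm{End}_L(P,G)$ be the set of those $L$-colourings $\phi$ of $\{p_0,p_1\}$ that are $(P,G)$-sufficient, that is, every extension of $\phi$ to an $L$-colouring of $\{p_0,q,p_1\}$ extends to an $L$-colouring of $G$. **Theorem.** $\mathrm{End}_L(P,G)\neq\varnothing$. Furthermore,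 either $|\mathrm{End}_L(P,G)|\geq 2$, or there is a path $Q$ in $G$ of even length with endpoints $p_0$ and $p_1$ such that $V(Q)\subseteq V(C)$ and every vertex of $Q$ is adjacent to $q$. -/

import Mathlib

/-! ### Planar graphs with a prescribed outer cycle

A cellular embedding of (each component of) a graph in an oriented surface is given by a rotation
system: a cyclic ordering of the darts leaving each vertex. The facial boundary walks are the orbits
of the face permutation, and the embedding is an embedding in the sphere (equivalently, the plane)
exactly when the Euler characteristic is right. -/

/-- A rotation system: a permutation of the darts (oriented edges) of `G` whose cycles are exactly
the sets of darts with a common initial vertex. -/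
structure RotationSystem {V : Type*} (G : SimpleGraph V) where
  next : Equiv.Perm G.Dart
  sameCycle_iff : ∀ d e : G.Dart, next.SameCycle d e ↔ d.fst = e.fst

namespace RotationSystem

variable {V : Type*} {G : SimpleGraph V}

/-- The face permutation: after traversing the dart `d` from `u` to `v`, the facial walk continues
with the successor of the reversed dart (from `v` to `u`) in the cyclic ordering around `v`. -/
def facePerm (R : RotationSystem G) : Equiv.Perm G.Dart :=
  (Function.Involutive.toPerm SimpleGraph.Dart.symm SimpleGraph.Dart.symm_involutive).trans R.next

/-- The facial walks: orbits of the face permutation. -/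
def Face (R : RotationSystem G) : Type _ :=
  Quotient (Equiv.Perm.SameCycle.setoid R.facePerm)

/-- Genus zero for every connected component: `|V| - |E| + |F| = 2` summed over all components.
An isolated vertex has no darts, but is a component with one face, which is counted separately.
(As `|V| - |E| + |F| ≤ 2` for every component of every rotation system, equality
in the sum means equality for each component.) -/
def IsPlanar (R : RotationSystem G) : Prop :=
  Nat.card V + (Nat.card R.Face + Nat.card {v : V // ∀ w, ¬ G.Adj v w}) =
    Nat.card G.edgeSet + 2 * Nat.card G.ConnectedComponent

/-- The closed walk `C`, with its direction of traversal, bounds a face: its darts are exactly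
one orbit of the face permutation. -/
def IsFacial (R : RotationSystem G) {u : V} (C : G.Walk u u) : Prop :=
  ∀ d ∈ C.darts, ∀ e : G.Dart, R.facePerm.SameCycle d e ↔ e ∈ C.darts

end RotationSystem

/-- `G` can be drawn in the plane so that `C` is a cycle which bounds the outer face (any face of a
drawing on the sphere can be taken as the outer one, and components not containing `C`
can be drawn in a bounded face). `G` need not be connected. -/
def IsPlanarWithOuterCycle {V : Type*} (G : SimpleGraph V) {u : V} (C : G.Walk u u) : Prop :=
  C.IsCycle ∧ ∃ R : RotationSystem G, R.IsPlanar ∧ R.IsFacial C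

/-! ### List-colourings -/

/-- `φ` is an `L`-colouring of the graph `G`. -/
def IsListColoring {W : Type*} (G : SimpleGraph W) (L : W → Finset ℕ) (φ : W → ℕ) : Prop :=
  (∀ v, φ v ∈ L v) ∧ ∀ v w, G.Adj v w → φ v ≠ φ w

/-- `φ` is an `L`-colouring of the vertex set `S`, i.e. of the induced subgraph `G[S]`. -/
def IsListColoringOn {V : Type*} (G : SimpleGraph V) (L : V → Finset ℕ) (S : Set V)
    (φ : S → ℕ) : Prop :=
  IsListColoring (G.induce S) (fun v => L v) φ

/-- A partial `L`-colouring `φ` with domain `S` is `(H, G)`-sufficient if every extension of `φ` to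
an `L`-colouring of `S ∪ V(H)` extends to an `L`-colouring of `G`. -/
def IsSufficient {V : Type*} (G : SimpleGraph V) (L : V → Finset ℕ) (H : G.Subgraph)
    {S : Set V} (φ : S → ℕ) : Prop :=
  ∀ ψ : (S ∪ H.verts : Set V) → ℕ, IsListColoringOn G L (S ∪ H.verts) ψ →
    (∀ (v : V) (hv : v ∈ S), ψ ⟨v, Or.inl hv⟩ = φ ⟨v, hv⟩) →
    ∃ χ : V → ℕ, IsListColoring G L χ ∧ ∀ v : (S ∪ H.verts : Set V), χ v = ψ v

/-- `End_L(P, G)`: the `(P, G)`-sufficient `L`-colourings of the set of endpoints of the path `P`. -/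
def EndColorings {V : Type*} (G : SimpleGraph V) (L : V → Finset ℕ) {p p' : V}
    (P : G.Walk p p') : Set (({p, p'} : Set V) → ℕ) :=
  {φ | IsListColoringOn G L {p, p'} φ ∧ IsSufficient G L P.toSubgraph φ}

/-- `(G, C, P, L)` is a rainbow. The lists of the internal vertices of `P` are unrestricted. -/
structure IsRainbow {V : Type*} (G : SimpleGraph V) {u : V} (C : G.Walk u u) {p p' : V}
    (P : G.Walk p p') (L : V → Finset ℕ) : Prop where
  planar : IsPlanarWithOuterCycle G C
  isPath : P.IsPath
  one_le_length : 1 ≤ P.length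
  edges_subset : ∀ e ∈ P.edges, e ∈ C.edges
  nonempty_left : (L p).Nonempty
  nonempty_right : (L p').Nonempty
  three_le : ∀ v ∈ C.support, v ∉ P.support → 3 ≤ (L v).card
  five_le : ∀ v, v ∉ C.support → 5 ≤ (L v).card

/-- A rainbow is end-linked if the lists of the two endpoints of `P` have total size at least 4. -/
def IsEndLinkedRainbow {V : Type*} (G : SimpleGraph V) {u : V} (C : G.Walk u u) {p p' : V}
    (P : G.Walk p p') (L : V → Finset ℕ) : Prop :=
  IsRainbow G C P L ∧ 4 ≤ (L p).card + (L p').card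

/-! # Sufficient colourings of the ends of a two-edge path on the outer cycle

Call a colouring `a`, `c`, `b` of the path `p q r` *bad* (`Bad`) if it is proper along the path but
does not extend to the graph. A colouring `a`, `b` of the ends is sufficient if no `c` makes the
triple bad. The proof describes all bad triples, in the setting of Thomassen's theorem on
5-list-colouring with a precoloured edge on the outer cycle (`thomassen`).

*Dichotomy.* If `p` and `r` are not adjacent, then either at most one triple is bad, or there is a
fan, that is, a path from `p` to `r` of boundary vertices adjacent to `q`, and the bad triples are
restricted as for a fan: for an even number of triangles there is a set `T` of three colours such
that all bad triples have colours in `T` and `a ≠ b`; for an odd number of triangles, either `a = b`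
for all bad triples, or `a` and `b` are the same for all of them (`Dichotomy`). If `p` and `r` are
adjacent, then bad triples have `a = b`. A count of pairs of colours in lists of total size at least
four gives two sufficient colourings in all cases except that of an even fan, and there one.

*Induction* (`hub_and_dichotomy`). Pieces of the graph that are attached along a boundary edge, or lie
inside a triangle or a 4-cycle, can be removed by Thomassen's theorem. At a chord `qw` the bad
triples compose: the list of `w` has three elements, the colour of `q` and the unique bad colours
for the two sides (`Rainbow.bad_split`). Without chords, a bad triple forces a common neighbour `z` of
`p`, `q` and `r` (`Tight.exists_hub`), and then deleting `q` shows that at most one triple is bad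
(`Tight.uniqueBad`). For the existence of `z`, let `v` be the boundary neighbour of `p`. Deleting `v`
with two colours reserved for it yields an inner vertex `u` adjacent to `p`, `q`, `v`; deleting `p`
yields an inner vertex `z` adjacent to `u`, `q`, `r`; deleting `p` and `q` yields, by the dichotomy for
the path `u z r`, a boundary vertex `y` adjacent to `u` and `z`. The lists of `u`, `z` and `y` are then
determined to the extent that a colouring can be given explicitly (`Wheel.not_bad`).

*Planarity.* The induction passes to subgraphs and exposes neighbours of deleted boundary vertices.
To avoid embeddings, "`G[S]` lies in a disc with the vertices of `O` on the boundary" is expressed by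
the absence of the two Kuratowski minors in the graph `G[S]` with an additional vertex joined to `O`
(`Disc`); all topological facts used are instances of this. For the given graph it is proved along
the lines of MacLane's criterion. By Euler's formula, the faces of a planar rotation system span the
cycle space over the field with two elements (`RotationSystem.IsPlanar.range_faceMap`), so they form
an algebraic dual; coning off a face preserves its existence (`RotationSystem.IsPlanar.isDual_cone`),
as does passing to a minor (`IsDual.of_hasModel`), whereas counting edges shows that `K₅` and `K₃,₃` have
none.
-/

/-! ### Connected sets, minors and disc graphs -/

/-- `A` is nonempty and any two of its vertices are joined by a walk inside `A`. -/
def ConnSet {W : Type*} (H : SimpleGraph W) (A : Set W) : Prop :=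
  A.Nonempty ∧ ∀ x ∈ A, ∀ y ∈ A, Relation.ReflTransGen (fun a b => H.Adj a b ∧ b ∈ A) x y

/-- Some edge joins `A` to `B`. -/
def Touch {W : Type*} (H : SimpleGraph W) (A B : Set W) : Prop :=
  ∃ x ∈ A, ∃ y ∈ B, H.Adj x y

/-- The vertices that can be reached from `x` by a walk whose later vertices are in `T`. For
`x ∈ T` this is the component of `x` in `G[T]`. -/
def comp {W : Type*} (H : SimpleGraph W) (T : Set W) (x : W) : Set W :=
  {y | Relation.ReflTransGen (fun a b => H.Adj a b ∧ b ∈ T) x y}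

section Conn

variable {W : Type*} {H : SimpleGraph W}

theorem Touch.symm {A B : Set W} (h : Touch H A B) : Touch H B A := by
  obtain ⟨x, hx, y, hy, e⟩ := h
  exact ⟨y, hy, x, hx, e.symm⟩

theorem connSet_singleton (x : W) : ConnSet H {x} := by
  refine ⟨⟨x, rfl⟩, ?_⟩
  rintro a rfl b rfl
  exact .refl

theorem reach_symm {A : Set W} {x y : W} (hx : x ∈ A)
    (h : Relation.ReflTransGen (fun a b => H.Adj a b ∧ b ∈ A) x y) :
    Relation.ReflTransGen (fun a b => H.Adj a b ∧ b ∈ A) y x ∧ y ∈ A := by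
  induction h with
  | refl => exact ⟨.refl, hx⟩
  | tail _ hbc ih => exact ⟨.head ⟨hbc.1.symm, ih.2⟩ ih.1, hbc.2⟩

theorem connSet_of_root {A : Set W} {r : W} (hr : r ∈ A)
    (h : ∀ y ∈ A, Relation.ReflTransGen (fun a b => H.Adj a b ∧ b ∈ A) r y) : ConnSet H A :=
  ⟨⟨r, hr⟩, fun x hx y hy => (reach_symm hr (h x hx)).1.trans (h y hy)⟩

theorem ConnSet.mono_adj {H' : SimpleGraph W} {A : Set W} (hA : ConnSet H A)
    (h : ∀ x ∈ A, ∀ y ∈ A, H.Adj x y → H'.Adj x y) : ConnSet H' A := by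
  refine ⟨hA.1, fun x hx y hy => ?_⟩
  have := hA.2 x hx y hy
  induction this with
  | refl => exact .refl
  | tail hab hbc ih =>
    have hb := (reach_symm hx hab).2
    exact (ih hb).tail ⟨h _ hb _ hbc.2 hbc.1, hbc.2⟩

theorem reach_mono {A B : Set W} (hAB : A ⊆ B) {x y : W}
    (h : Relation.ReflTransGen (fun a b => H.Adj a b ∧ b ∈ A) x y) :
    Relation.ReflTransGen (fun a b => H.Adj a b ∧ b ∈ B) x y :=
  Relation.ReflTransGen.mono (fun _ _ h => ⟨h.1, hAB h.2⟩) _ _ h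

theorem ConnSet.union {A B : Set W} (hA : ConnSet H A) (hB : ConnSet H B) (h : Touch H A B) :
    ConnSet H (A ∪ B) := by
  obtain ⟨x, hx, y, hy, e⟩ := h
  refine connSet_of_root (r := x) (.inl hx) ?_
  rintro z (hz | hz)
  · exact reach_mono Set.subset_union_left (hA.2 x hx z hz)
  · exact .head ⟨e, .inr hy⟩ (reach_mono Set.subset_union_right (hB.2 y hy z hz))

theorem ConnSet.insert {A : Set W} (hA : ConnSet H A) {x y : W} (hy : y ∈ A) (e : H.Adj x y) :
    ConnSet H (insert x A) :=
  (connSet_singleton x).union hA ⟨x, rfl, y, hy, e⟩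

theorem connSet_pair {x y : W} (e : H.Adj x y) : ConnSet H {x, y} :=
  (connSet_singleton y).insert rfl e

theorem ConnSet.image_some {A : Set W} {K : SimpleGraph (Option W)} (hA : ConnSet H A)
    (h : ∀ x y, H.Adj x y → K.Adj (some x) (some y)) : ConnSet K (some '' A) := by
  refine ⟨hA.1.image _, ?_⟩
  rintro _ ⟨x, hx, rfl⟩ _ ⟨y, hy, rfl⟩
  exact (hA.2 x hx y hy).lift some fun a b hab => ⟨h _ _ hab.1, ⟨b, hab.2, rfl⟩⟩

variable {T : Set W} {x y z : W}

theorem mem_comp_self : x ∈ comp H T x := .refl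

theorem comp_subset (hx : x ∈ T) : comp H T x ⊆ T := fun _ hy => (reach_symm hx hy).2

theorem comp_step (hy : y ∈ comp H T x) (e : H.Adj y z) (hz : z ∈ T) : z ∈ comp H T x :=
  Relation.ReflTransGen.tail hy ⟨e, hz⟩

theorem comp_trans (hy : y ∈ comp H T x) (hz : z ∈ comp H T y) : z ∈ comp H T x :=
  Relation.ReflTransGen.trans hy hz

theorem comp_symm (hx : x ∈ T) (hy : y ∈ comp H T x) : x ∈ comp H T y := (reach_symm hx hy).1

theorem connSet_comp : ConnSet H (comp H T x) := by
  refine connSet_of_root mem_comp_self fun y hy => ?_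
  have hy' : Relation.ReflTransGen (fun a b => H.Adj a b ∧ b ∈ T) x y := hy
  clear hy
  induction hy' with
  | refl => exact .refl
  | tail hab hbc ih => exact ih.tail ⟨hbc.1, Relation.ReflTransGen.tail hab hbc⟩

theorem comp_mono {T' : Set W} (h : T ⊆ T') : comp H T x ⊆ comp H T' x := fun _ hy =>
  reach_mono h hy

/-- A connected set inside `T` that meets a component of `T` is contained in it. -/
theorem ConnSet.subset_comp {A : Set W} (hA : ConnSet H A) (hAT : A ⊆ T) (hy : y ∈ A)
    (hyx : y ∈ comp H T x) : A ⊆ comp H T x := fun z hz =>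
  comp_trans hyx (reach_mono hAT (hA.2 y hy z hz))

end Conn

/-- `H` has, inside the vertex set `T`, a model of `Γ` as a minor: disjoint connected branch sets
with an edge between any two that correspond to adjacent vertices of `Γ`. -/
def HasModel {κ W : Type*} (Γ : SimpleGraph κ) (H : SimpleGraph W) (T : Set W) : Prop :=
  ∃ A : κ → Set W, (∀ k, A k ⊆ T ∧ ConnSet H (A k)) ∧ (∀ k l, k ≠ l → Disjoint (A k) (A l)) ∧
    ∀ k l, Γ.Adj k l → Touch H (A k) (A l)

/-- The graph `G` with an additional vertex `none` adjacent to the vertices in `O`. -/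
def cone {V : Type*} (G : SimpleGraph V) (O : Set V) : SimpleGraph (Option V) where
  Adj
    | some u, some v => G.Adj u v
    | some u, none => u ∈ O
    | none, some v => v ∈ O
    | none, none => False
  symm := ⟨by rintro (_ | u) (_ | v) h <;> first | exact h | exact G.adj_symm h⟩
  loopless := ⟨by rintro (_ | u) h; exacts [h, G.irrefl h]⟩

/-- The minor-closed substitute for "`G[S]` can be drawn in a disc with all vertices of `O ∩ S` on
the boundary": joining a new vertex to `O ∩ S` creates neither of the Kuratowski minors. -/
def Disc {V : Type*} (G : SimpleGraph V) (S O : Set V) : Prop :=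
  ¬ HasModel (⊤ : SimpleGraph (Fin 5)) (cone G O) (insert none (some '' S)) ∧
  ¬ HasModel (completeBipartiteGraph (Fin 3) (Fin 3)) (cone G O) (insert none (some '' S))

section Disc

variable {V : Type*} {G : SimpleGraph V} {S O : Set V}

theorem Disc.mono {S' O' : Set V} (h : Disc G S O) (hS : S' ⊆ S) (hO : O' ⊆ O) :
    Disc G S' O' := by
  have key : ∀ {κ : Type} (Γ : SimpleGraph κ), HasModel Γ (cone G O') (insert none (some '' S')) →
      HasModel Γ (cone G O) (insert none (some '' S)) := by
    rintro κ Γ ⟨A, h1, h2, h3⟩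
    have hle : ∀ x y, (cone G O').Adj x y → (cone G O).Adj x y := by
      rintro (_ | x) (_ | y) e
      exacts [e, hO e, hO e, e]
    refine ⟨A, fun k => ⟨(h1 k).1.trans (Set.insert_subset_insert (Set.image_mono hS)),
      (h1 k).2.mono_adj fun x _ y _ => hle x y⟩, h2, fun k l e => ?_⟩
    obtain ⟨x, hx, y, hy, e⟩ := h3 k l e
    exact ⟨x, hx, y, hy, hle _ _ e⟩
  exact ⟨fun m => h.1 (key _ m), fun m => h.2 (key _ m)⟩

theorem disc_of_model_map {S' O' : Set V} (h : Disc G S O)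
    (key : ∀ {κ : Type} (Γ : SimpleGraph κ), HasModel Γ (cone G O') (insert none (some '' S')) →
      HasModel Γ (cone G O) (insert none (some '' S))) : Disc G S' O' :=
  ⟨fun m => h.1 (key _ m), fun m => h.2 (key _ m)⟩

theorem cone_adj_some {O' : Set V} {A : Set (Option V)} (hA : none ∉ A) :
    ∀ x ∈ A, ∀ y ∈ A, (cone G O).Adj x y → (cone G O').Adj x y := by
  rintro (_ | x) hx (_ | y) hy e
  exacts [e, absurd hx hA, absurd hy hA, e]

/-- Deleting a boundary vertex `v` exposes its neighbours: in the cone, contract the edge from the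
apex to `v`. -/
theorem Disc.delete (h : Disc G S O) {v : V} (hv : v ∈ S) (hvO : v ∈ O) :
    Disc G (S \ {v}) (O ∪ {x | G.Adj v x}) := by
  classical
  refine disc_of_model_map h ?_
  rintro κ Γ ⟨A, h1, h2, h3⟩
  have hvA : ∀ k, some v ∉ A k := fun k hk => by
    rcases (h1 k).1 hk with h | ⟨w, hw, h⟩
    · cases h
    · cases h; exact hw.2 rfl
  let B : κ → Set (Option V) := fun k => if none ∈ A k then insert (some v) (A k) else A k
  have hAB : ∀ k, A k ⊆ B k := fun k x hx => by
    by_cases hn : none ∈ A k <;> simp [B, hn, hx]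
  have hBmem : ∀ k x, x ∈ B k → x ∈ A k ∨ (x = some v ∧ none ∈ A k) := fun k x hx => by
    by_cases hn : none ∈ A k
    · simp only [B, if_pos hn] at hx
      exact hx.elim (fun h => .inr ⟨h, hn⟩) .inl
    · simp only [B, if_neg hn] at hx
      exact .inl hx
  have hvB : ∀ k, none ∈ A k → some v ∈ B k := fun k hn => by simp [B, hn]
  refine ⟨B, fun k => ⟨?_, ?_⟩, ?_, ?_⟩
  · intro x hx
    rcases hBmem k x hx with hx | ⟨rfl, -⟩
    · rcases (h1 k).1 hx with h | ⟨w, hw, h⟩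
      · exact .inl h
      · exact .inr ⟨w, hw.1, h⟩
    · exact .inr ⟨v, hv, rfl⟩
  · by_cases hn : none ∈ A k
    · refine connSet_of_root (r := none) (hAB k hn) fun y hy => ?_
      have hnv : Relation.ReflTransGen (fun a b => (cone G O).Adj a b ∧ b ∈ B k) none (some v) :=
        .single ⟨hvO, hvB k hn⟩
      rcases hBmem k y hy with hy | ⟨rfl, -⟩
      · have := (h1 k).2.2 none hn y hy
        clear hy
        induction this with
        | refl => exact .refl
        | @tail b c hab hbc ih =>
          obtain ⟨hbc, hc⟩ := hbc
          have ih := ih (by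
            rcases (reach_symm hn hab).2 with hb; exact hAB k hb)
          cases b with
          | none =>
            cases c with
            | none => exact absurd hbc (by exact id)
            | some c =>
              rcases hbc with hbc | hbc
              · exact .single ⟨hbc, hAB k hc⟩
              · exact hnv.tail ⟨hbc, hAB k hc⟩
          | some b =>
            cases c with
            | none => exact .refl
            | some c => exact ih.tail ⟨hbc, hAB k hc⟩
      · exact hnv
    · simp only [B, if_neg hn]
      exact (h1 k).2.mono_adj (cone_adj_some hn)
  · intro k l hkl
    rw [Set.disjoint_left]
    intro x hx hx'
    have hd := Set.disjoint_left.1 (h2 k l hkl)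
    rcases hBmem k x hx with hx | ⟨rfl, hn⟩ <;> rcases hBmem l _ hx' with hx' | ⟨h, hn'⟩
    · exact hd hx hx'
    · exact hvA k (h ▸ hx)
    · exact hvA l hx'
    · exact hd hn hn'
  · intro k l e
    obtain ⟨x, hx, y, hy, e⟩ := h3 k l e
    cases x with
    | none =>
      cases y with
      | none => exact absurd e id
      | some y =>
        rcases e with e | e
        · exact ⟨none, hAB k hx, _, hAB l hy, e⟩
        · exact ⟨some v, hvB k hx, _, hAB l hy, e⟩
    | some x =>
      cases y with
      | none =>
        rcases e with e | e
        · exact ⟨_, hAB k hx, none, hAB l hy, e⟩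
        · exact ⟨_, hAB k hx, some v, hvB l hy, G.adj_symm e⟩
      | some y => exact ⟨_, hAB k hx, _, hAB l hy, e⟩

/-- Any vertex `v` can be put at infinity: after its deletion its neighbours are on a common
face. -/
theorem Disc.link (h : Disc G S O) {v : V} (hv : v ∈ S) :
    Disc G (S \ {v}) {x | G.Adj v x} := by
  classical
  refine disc_of_model_map h ?_
  rintro κ Γ ⟨A, h1, h2, h3⟩
  let f : Option V → Option V := fun x => x.elim (some v) some
  have hf : ∀ x y, (cone G {x | G.Adj v x}).Adj x y → (cone G O).Adj (f x) (f y) := by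
    rintro (_ | x) (_ | y) e
    exacts [e.elim, e, G.adj_symm e, e]
  have hvA : ∀ k, some v ∉ A k := fun k hk => by
    rcases (h1 k).1 hk with h | ⟨w, hw, h⟩
    · cases h
    · cases h; exact hw.2 rfl
  refine ⟨fun k => f '' A k, fun k => ⟨?_, (h1 k).2.1.image _, ?_⟩, ?_, ?_⟩
  · rintro _ ⟨x, hx, rfl⟩
    cases x with
    | none => exact .inr ⟨v, hv, rfl⟩
    | some x =>
      rcases (h1 k).1 hx with h | ⟨w, hw, h⟩
      · cases h
      · cases h; exact .inr ⟨_, hw.1, rfl⟩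
  · rintro _ ⟨x, hx, rfl⟩ _ ⟨y, hy, rfl⟩
    exact ((h1 k).2.2 x hx y hy).lift f fun a b hab => ⟨hf _ _ hab.1, ⟨b, hab.2, rfl⟩⟩
  · intro k l hkl
    rw [Set.disjoint_left]
    rintro _ ⟨x, hx, rfl⟩ ⟨y, hy, hxy⟩
    have hd := Set.disjoint_left.1 (h2 k l hkl)
    cases x <;> cases y
    · exact hd hx hy
    · cases hxy; exact hvA l hy
    · cases hxy; exact hvA k hx
    · cases hxy; exact hd hx hy
  · intro k l e
    obtain ⟨x, hx, y, hy, e⟩ := h3 k l e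
    exact ⟨_, ⟨x, hx, rfl⟩, _, ⟨y, hy, rfl⟩, hf _ _ e⟩

theorem disjoint_image_some {X Y : Set V} (h : Disjoint X Y) :
    Disjoint (some '' X) (some '' Y) :=
  (Set.disjoint_image_iff (Option.some_injective V)).2 h

/-- In a disc graph no two disjoint connected sets both touch three further ones that reach the
boundary: with the apex they would form a `K₃,₃` minor. -/
theorem Disc.not_rooted_K23 (h : Disc G S O) {X₁ X₂ Y₁ Y₂ Y₃ : Set V}
    (hS : X₁ ⊆ S ∧ X₂ ⊆ S ∧ Y₁ ⊆ S ∧ Y₂ ⊆ S ∧ Y₃ ⊆ S)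
    (hX₁ : ConnSet G X₁) (hX₂ : ConnSet G X₂) (hY₁ : ConnSet G Y₁) (hY₂ : ConnSet G Y₂)
    (hY₃ : ConnSet G Y₃)
    (hd : [X₁, X₂, Y₁, Y₂, Y₃].Pairwise Disjoint)
    (t₁ : Touch G X₁ Y₁ ∧ Touch G X₁ Y₂ ∧ Touch G X₁ Y₃)
    (t₂ : Touch G X₂ Y₁ ∧ Touch G X₂ Y₂ ∧ Touch G X₂ Y₃)
    (o₁ : (Y₁ ∩ O).Nonempty) (o₂ : (Y₂ ∩ O).Nonempty) (o₃ : (Y₃ ∩ O).Nonempty) : False := by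
  simp only [List.pairwise_cons, List.mem_cons, List.not_mem_nil, or_false, forall_eq_or_imp,
    forall_eq, List.Pairwise.nil, and_true, implies_true, IsEmpty.forall_iff] at hd
  obtain ⟨⟨d12, e11, e12, e13⟩, ⟨e21, e22, e23⟩, ⟨f12, f13⟩, f23⟩ := hd
  have hn : ∀ X : Set V, Disjoint {none} (some '' X) := fun X => by simp
  have hc : ∀ X, ConnSet G X → ConnSet (cone G O) (some '' X) := fun X hX =>
    hX.image_some fun _ _ e => e
  have hs : ∀ X, X ⊆ S → some '' X ⊆ insert none (some '' S) := fun X hX =>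
    (Set.image_mono hX).trans (Set.subset_insert _ _)
  have ht : ∀ X Y, Touch G X Y → Touch (cone G O) (some '' X) (some '' Y) := by
    rintro X Y ⟨x, hx, y, hy, e⟩
    exact ⟨_, ⟨x, hx, rfl⟩, _, ⟨y, hy, rfl⟩, e⟩
  have ho : ∀ Y : Set V, (Y ∩ O).Nonempty → Touch (cone G O) {none} (some '' Y) := by
    rintro Y ⟨y, hy, hyO⟩
    exact ⟨none, rfl, _, ⟨y, hy, rfl⟩, hyO⟩
  refine h.2 ⟨Sum.elim ![{none}, some '' X₁, some '' X₂] ![some '' Y₁, some '' Y₂, some '' Y₃],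
    ?_, ?_, ?_⟩
  · rintro (k | k) <;> fin_cases k <;> simp only [Sum.elim_inl, Sum.elim_inr]
    exacts [⟨by simp, connSet_singleton _⟩, ⟨hs _ hS.1, hc _ hX₁⟩, ⟨hs _ hS.2.1, hc _ hX₂⟩,
      ⟨hs _ hS.2.2.1, hc _ hY₁⟩, ⟨hs _ hS.2.2.2.1, hc _ hY₂⟩, ⟨hs _ hS.2.2.2.2, hc _ hY₃⟩]
  · have i := @disjoint_image_some V
    rintro (k | k) (l | l) hkl <;> fin_cases k <;> fin_cases l <;>
      first | exact absurd rfl hkl | exact hn _ | exact (hn _).symm | skip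
    exacts [i d12, i d12.symm, i e11, i e12, i e13, i e21, i e22, i e23, i e11.symm, i e21.symm,
      i e12.symm, i e22.symm, i e13.symm, i e23.symm, i f12, i f13, i f12.symm, i f23, i f13.symm,
      i f23.symm]
  · have key : ∀ k l : Fin 3, Touch (cone G O) (![{none}, some '' X₁, some '' X₂] k)
        (![some '' Y₁, some '' Y₂, some '' Y₃] l) := by
      intro k l
      fin_cases k <;> fin_cases l
      exacts [ho _ o₁, ho _ o₂, ho _ o₃, ht _ _ t₁.1, ht _ _ t₁.2.1, ht _ _ t₁.2.2,
        ht _ _ t₂.1, ht _ _ t₂.2.1, ht _ _ t₂.2.2]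
    rintro (k | k) (l | l) e
    · simp at e
    · exact key k l
    · exact (key l k).symm
    · simp at e

/-- In a disc graph there are no four disjoint, pairwise touching, connected sets that reach the
boundary: with the apex they would form a `K₅` minor. -/
theorem Disc.not_rooted_K4 (h : Disc G S O) {X₁ X₂ X₃ X₄ : Set V}
    (hS : X₁ ⊆ S ∧ X₂ ⊆ S ∧ X₃ ⊆ S ∧ X₄ ⊆ S)
    (hX₁ : ConnSet G X₁) (hX₂ : ConnSet G X₂) (hX₃ : ConnSet G X₃) (hX₄ : ConnSet G X₄)
    (hd : [X₁, X₂, X₃, X₄].Pairwise Disjoint)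
    (t : [X₁, X₂, X₃, X₄].Pairwise (Touch G))
    (ho : (X₁ ∩ O).Nonempty ∧ (X₂ ∩ O).Nonempty ∧ (X₃ ∩ O).Nonempty ∧ (X₄ ∩ O).Nonempty) :
    False := by
  simp only [List.pairwise_cons, List.mem_cons, List.not_mem_nil, or_false, forall_eq_or_imp,
    forall_eq, List.Pairwise.nil, and_true, implies_true,
    IsEmpty.forall_iff] at hd t
  obtain ⟨⟨d12, d13, d14⟩, ⟨d23, d24⟩, d34⟩ := hd
  obtain ⟨⟨t12, t13, t14⟩, ⟨t23, t24⟩, t34⟩ := t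
  have hn : ∀ X : Set V, Disjoint {none} (some '' X) := fun X => by simp
  have hc : ∀ X, ConnSet G X → ConnSet (cone G O) (some '' X) := fun X hX =>
    hX.image_some fun _ _ e => e
  have hs : ∀ X, X ⊆ S → some '' X ⊆ insert none (some '' S) := fun X hX =>
    (Set.image_mono hX).trans (Set.subset_insert _ _)
  have ht : ∀ {X Y}, Touch G X Y → Touch (cone G O) (some '' X) (some '' Y) := by
    rintro X Y ⟨x, hx, y, hy, e⟩
    exact ⟨_, ⟨x, hx, rfl⟩, _, ⟨y, hy, rfl⟩, e⟩
  have ho' : ∀ {Y : Set V}, (Y ∩ O).Nonempty → Touch (cone G O) {none} (some '' Y) := by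
    rintro Y ⟨y, hy, hyO⟩
    exact ⟨none, rfl, _, ⟨y, hy, rfl⟩, hyO⟩
  refine h.1 ⟨![{none}, some '' X₁, some '' X₂, some '' X₃, some '' X₄], ?_, ?_, ?_⟩
  · intro k
    fin_cases k
    exacts [⟨by simp, connSet_singleton _⟩, ⟨hs _ hS.1, hc _ hX₁⟩, ⟨hs _ hS.2.1, hc _ hX₂⟩,
      ⟨hs _ hS.2.2.1, hc _ hX₃⟩, ⟨hs _ hS.2.2.2, hc _ hX₄⟩]
  · have i := @disjoint_image_some V
    intro k l hkl
    fin_cases k <;> fin_cases l <;>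
      first | exact absurd rfl hkl | exact hn _ | exact (hn _).symm | skip
    exacts [i d12, i d13, i d14, i d12.symm, i d23, i d24, i d13.symm, i d23.symm, i d34,
      i d14.symm, i d24.symm, i d34.symm]
  · intro k l hkl
    fin_cases k <;> fin_cases l <;> first | exact absurd rfl hkl | skip
    exacts [ho' ho.1, ho' ho.2.1, ho' ho.2.2.1, ho' ho.2.2.2,
      (ho' ho.1).symm, ht t12, ht t13, ht t14, (ho' ho.2.1).symm, ht t12.symm, ht t23, ht t24,
      (ho' ho.2.2.1).symm, ht t13.symm, ht t23.symm, ht t34,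
      (ho' ho.2.2.2).symm, ht t14.symm, ht t24.symm, ht t34.symm]

end Disc

/-! ### Separation by two adjacent vertices -/

section Separation

variable {V : Type*} {G : SimpleGraph V} {S O : Set V}

theorem comp_eq_of_mem {T : Set V} {x y : V} (hx : x ∈ T) (hy : y ∈ comp G T x) :
    comp G T y = comp G T x :=
  Set.Subset.antisymm (fun _ hz => comp_trans hy hz) fun _ hz => comp_trans (comp_symm hx hy) hz

/-- If `w` is reachable from `x` through `T`, it is so directly or through one component of `T`. -/
theorem exists_link {T : Set V} {x w : V} (hxw : x ≠ w) (hwT' : w ∉ T)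
    (h : w ∈ comp G (T ∪ {x, w}) x) :
    ∃ D ⊆ T, ConnSet G (insert x D) ∧ Touch G (insert x D) {w} ∧
      (D = ∅ ∨ ∃ z ∈ T, D = comp G T z ∧ Touch G D {x} ∧ Touch G D {w}) := by
  by_contra hcon
  have key : ∀ y ∈ comp G (T ∪ {x, w}) x,
      y = x ∨ (y ∈ T ∧ Touch G (comp G T y) {x}) := by
    intro y hy
    have hy' : Relation.ReflTransGen (fun a b => G.Adj a b ∧ b ∈ T ∪ {x, w}) x y := hy
    clear hy
    induction hy' with
    | refl => exact .inl rfl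
    | @tail b c _ hbc ih =>
      obtain ⟨e, hc⟩ := hbc
      by_cases hcx : c = x
      · exact .inl hcx
      by_cases hcw : c = w
      · subst hcw
        exfalso
        apply hcon
        rcases ih with rfl | ⟨hbT, ht⟩
        · exact ⟨∅, Set.empty_subset _, by simpa using connSet_singleton b,
            ⟨b, by simp, c, rfl, e⟩, .inl rfl⟩
        · obtain ⟨a, ha, _, rfl, e'⟩ := ht
          exact ⟨comp G T b, comp_subset hbT, connSet_comp.insert ha e'.symm,
            ⟨b, .inr mem_comp_self, c, rfl, e⟩,
            .inr ⟨b, hbT, rfl, ⟨a, ha, _, rfl, e'⟩, ⟨b, mem_comp_self, c, rfl, e⟩⟩⟩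
      have hcT : c ∈ T := by
        rcases hc with h | h | h
        exacts [h, absurd h hcx, absurd h hcw]
      rcases ih with rfl | ⟨hbT, ht⟩
      · exact .inr ⟨hcT, c, mem_comp_self, b, rfl, e.symm⟩
      · refine .inr ⟨hcT, ?_⟩
        rw [comp_eq_of_mem hbT (comp_step mem_comp_self e hcT)]
        exact ht
  rcases key w h with h | ⟨hwT, -⟩
  · exact hxw h.symm
  · exact hwT' hwT

/-- Three boundary neighbours `x`, `y`, `z` of a boundary vertex `v` are in order around `v`: not
all three pairs can be linked in `G[S] - v` while avoiding the third vertex. -/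
theorem Disc.exists_separator (h : Disc G S O) {v x y z : V} (hv : v ∈ S ∩ O) (hx : x ∈ S ∩ O)
    (hy : y ∈ S ∩ O) (hz : z ∈ S ∩ O) (ex : G.Adj v x) (ey : G.Adj v y) (ez : G.Adj v z)
    (hxy : x ≠ y) (hyz : y ≠ z) (hzx : z ≠ x) :
    y ∉ comp G (S \ {v, z}) x ∨ z ∉ comp G (S \ {v, x}) y ∨ x ∉ comp G (S \ {v, y}) z := by
  by_contra hcon
  simp only [not_or, not_not] at hcon
  obtain ⟨h1, h2, h3⟩ := hcon
  have hvx := ex.ne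
  have hvy := ey.ne
  have hvz := ez.ne
  obtain ⟨T, hT⟩ : ∃ T : Set V, T = S \ {v, x, y, z} := ⟨_, rfl⟩
  have hTS : T ⊆ S := hT ▸ Set.sdiff_subset
  have hvT : v ∉ T := by simp [hT]
  have hxT : x ∉ T := by simp [hT]
  have hyT : y ∉ T := by simp [hT]
  have hzT : z ∉ T := by simp [hT]
  have e1 : S \ {v, z} ⊆ T ∪ {x, y} := by
    intro a ha; simp [hT] at ha ⊢; clear * - ha; tauto
  have e2 : S \ {v, x} ⊆ T ∪ {y, z} := by
    intro a ha; simp [hT] at ha ⊢; clear * - ha; tauto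
  have e3 : S \ {v, y} ⊆ T ∪ {z, x} := by
    intro a ha; simp [hT] at ha ⊢; clear * - ha; tauto
  obtain ⟨D₁, s1, c1, t1, k1⟩ := exists_link hxy hyT (comp_mono e1 h1)
  obtain ⟨D₂, s2, c2, t2, k2⟩ := exists_link hyz hzT (comp_mono e2 h2)
  obtain ⟨D₃, s3, c3, t3, k3⟩ := exists_link hzx hxT (comp_mono e3 h3)
  -- A component touching all three vertices, together with `v` and the apex, is a `K₃,₃` minor.
  have hno : ∀ a ∈ T, Touch G (comp G T a) {x} → Touch G (comp G T a) {y} →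
      Touch G (comp G T a) {z} → False := by
    intro a ha tx ty tz
    have hsub := comp_subset (H := G) ha
    refine h.not_rooted_K23 (X₁ := {v}) (X₂ := comp G T a) (Y₁ := {x}) (Y₂ := {y}) (Y₃ := {z})
      ⟨by simpa using hv.1, hsub.trans hTS, by simpa using hx.1, by simpa using hy.1,
        by simpa using hz.1⟩ (connSet_singleton _) connSet_comp (connSet_singleton _)
      (connSet_singleton _) (connSet_singleton _) ?_
      ⟨⟨v, rfl, x, rfl, ex⟩, ⟨v, rfl, y, rfl, ey⟩, ⟨v, rfl, z, rfl, ez⟩⟩ ⟨tx, ty, tz⟩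
      ⟨x, rfl, hx.2⟩ ⟨y, rfl, hy.2⟩ ⟨z, rfl, hz.2⟩
    have m1 : v ∉ comp G T a := fun m => hvT (hsub m)
    have m2 : x ∉ comp G T a := fun m => hxT (hsub m)
    have m3 : y ∉ comp G T a := fun m => hyT (hsub m)
    have m4 : z ∉ comp G T a := fun m => hzT (hsub m)
    simp [m1, m2, m3, m4, hvx, hvy, hvz, hxy, hyz, hzx.symm]
  have hdis : ∀ {A B : Set V} {a b c : V}, x ∈ ({a, b, c} : Set V) → y ∈ ({a, b, c} : Set V) → z ∈ ({a, b, c} : Set V) →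
      (A = ∅ ∨ ∃ u ∈ T, A = comp G T u ∧ Touch G A {a} ∧ Touch G A {b}) →
      (B = ∅ ∨ ∃ u ∈ T, B = comp G T u ∧ Touch G B {b} ∧ Touch G B {c}) → Disjoint A B := by
    intro A B a b c ha hb hc hA hB
    rcases hA with rfl | ⟨u, hu, rfl, ta, tb⟩
    · simp
    rcases hB with rfl | ⟨u', hu', rfl, tb', tc⟩
    · simp
    rw [Set.disjoint_left]
    intro s hs hs'
    have : comp G T u = comp G T u' :=
      (comp_eq_of_mem hu hs).symm.trans (comp_eq_of_mem hu' hs')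
    rw [← this] at tc
    have all : ∀ w ∈ ({a, b, c} : Set V), Touch G (comp G T u) {w} := by
      rintro w (rfl | rfl | rfl) <;> assumption
    exact hno u hu (all x ha) (all y hb) (all z hc)
  have d12 : Disjoint D₁ D₂ := hdis (a := x) (b := y) (c := z) (by simp) (by simp) (by simp) k1 k2
  have d23 : Disjoint D₂ D₃ := hdis (a := y) (b := z) (c := x) (by simp) (by simp) (by simp) k2 k3
  have d31 : Disjoint D₃ D₁ := hdis (a := z) (b := x) (c := y) (by simp) (by simp) (by simp) k3 k1
  have n : ∀ {D : Set V}, D ⊆ T → v ∉ D ∧ x ∉ D ∧ y ∉ D ∧ z ∉ D := fun hD =>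
    ⟨fun m => hvT (hD m), fun m => hxT (hD m), fun m => hyT (hD m), fun m => hzT (hD m)⟩
  obtain ⟨n10, n12, n13⟩ := n s1
  obtain ⟨n20, n21, n22, n23⟩ := n s2
  obtain ⟨n30, n31, n32, n33⟩ := n s3
  have tm : ∀ {A : Set V} {a b : V} {B : Set V}, Touch G (insert a A) {b} →
      Touch G (insert a A) (insert b B) := by
    rintro A a b B ⟨s, hs, _, rfl, e⟩
    exact ⟨s, hs, _, .inl rfl, e⟩
  refine h.not_rooted_K4 (X₁ := {v}) (X₂ := insert x D₁) (X₃ := insert y D₂) (X₄ := insert z D₃)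
    ⟨by simpa using hv.1, Set.insert_subset hx.1 (s1.trans hTS),
      Set.insert_subset hy.1 (s2.trans hTS), Set.insert_subset hz.1 (s3.trans hTS)⟩
    (connSet_singleton _) c1 c2 c3 ?_ ?_
    ⟨⟨v, rfl, hv.2⟩, ⟨x, .inl rfl, hx.2⟩, ⟨y, .inl rfl, hy.2⟩, ⟨z, .inl rfl, hz.2⟩⟩
  · simp [n10, n13, n20, n21, n23, n30, n31, n32, hvx, hvy, hvz, hxy,
      hyz, hzx.symm, d12, d23, d31.symm]
  · simp only [List.pairwise_cons, List.mem_cons, List.not_mem_nil, or_false, forall_eq_or_imp,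
      forall_eq, List.Pairwise.nil, and_true, implies_true, IsEmpty.forall_iff]
    exact ⟨⟨⟨v, rfl, x, .inl rfl, ex⟩, ⟨v, rfl, y, .inl rfl, ey⟩, ⟨v, rfl, z, .inl rfl, ez⟩⟩,
      ⟨tm t1, (tm t3).symm⟩, tm t2⟩

end Separation

/-! ### Colourings of vertex sets and Thomassen's theorem -/

/-- `φ` is a proper colouring of `G[S]` which uses the lists outside the precoloured set `X`. -/
structure IsColOn {V : Type*} (G : SimpleGraph V) (S X : Set V) (L : V → Finset ℕ) (φ : V → ℕ) :
    Prop where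
  proper : ∀ x ∈ S, ∀ y ∈ S, G.Adj x y → φ x ≠ φ y
  mem : ∀ v ∈ S, v ∉ X → φ v ∈ L v

/-- Thomassen's list sizes outside the precoloured set `X`: three colours for the boundary vertices
and five for the others. -/
def ListsOK {V : Type*} (S X O : Set V) (L : V → Finset ℕ) : Prop :=
  ∀ v ∈ S, v ∉ X → (v ∈ O → 3 ≤ (L v).card) ∧ (v ∉ O → 5 ≤ (L v).card)

open Classical in
/-- The lists with the colours in `R` removed from the vertices of `N` outside `O`. -/
noncomputable def dropList {V : Type*} (O N : Set V) (R : Finset ℕ) (L : V → Finset ℕ) (x : V) :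
    Finset ℕ :=
  if x ∉ O ∧ x ∈ N then L x \ R else L x

section Colouring

variable {V : Type*} {G : SimpleGraph V} {S O X : Set V} {L : V → Finset ℕ}

theorem dropList_subset {N : Set V} {R : Finset ℕ} (x : V) : dropList O N R L x ⊆ L x := by
  unfold dropList
  split_ifs
  exacts [Finset.sdiff_subset, subset_rfl]

theorem dropList_of_mem {N : Set V} {R : Finset ℕ} {x : V} (h : x ∈ O) :
    dropList O N R L x = L x := if_neg fun h' => h'.1 h

theorem dropList_of_notMem {N : Set V} {R : Finset ℕ} {x : V} (h : x ∉ O) (hN : x ∈ N) :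
    dropList O N R L x = L x \ R := if_pos ⟨h, hN⟩

theorem notMem_of_mem_dropList {N : Set V} {R : Finset ℕ} {x : V} {κ : ℕ}
    (h : κ ∈ dropList O N R L x) (hO : x ∉ O) (hN : x ∈ N) : κ ∉ R := by
  rw [dropList_of_notMem hO hN] at h
  exact (Finset.mem_sdiff.1 h).2

/-- Removing two colours from the lists of newly exposed vertices leaves them three. -/
theorem ListsOK.drop {S' X' N : Set V} {R : Finset ℕ} (h : ListsOK S X O L) (hR : R.card ≤ 2)
    (hS : S' ⊆ S) (hX : ∀ x ∈ S', x ∉ X' → x ∉ X) :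
    ListsOK S' X' (O ∪ N) (dropList O N R L) := by
  intro x hx hxX
  obtain ⟨h3, h5⟩ := h x (hS hx) (hX x hx hxX)
  by_cases hO : x ∈ O
  · rw [dropList_of_mem hO]
    exact ⟨fun _ => h3 hO, fun hn => absurd (.inl hO) hn⟩
  by_cases hN : x ∈ N
  · rw [dropList_of_notMem hO hN]
    refine ⟨fun _ => ?_, fun hn => absurd (.inr hN) hn⟩
    have := h5 hO
    have := Finset.le_card_sdiff R (L x)
    omega
  · rw [dropList, if_neg fun h => hN h.2]
    exact ⟨fun h => (h.elim hO hN).elim, fun _ => h5 hO⟩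

theorem IsColOn.mono_lists {L' : V → Finset ℕ} {φ : V → ℕ} (h : IsColOn G S X L φ) {S' X' : Set V}
    (hS : S' ⊆ S) (hX : ∀ x ∈ S', x ∉ X' → x ∉ X)
    (hL : ∀ x ∈ S', x ∉ X' → φ x ∈ L x → φ x ∈ L' x) : IsColOn G S' X' L' φ :=
  ⟨fun x hx y hy => h.proper x (hS hx) y (hS hy), fun v hv hvX =>
    hL v hv hvX (h.mem v (hS hv) (hX v hv hvX))⟩

open Classical in
/-- Giving a colour to one more vertex. -/
theorem IsColOn.update {φ : V → ℕ} {v : V} {κ : ℕ} {X' : Set V}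
    (h : IsColOn G (S \ {v}) X L φ) (hX : ∀ x ∈ S, x ∉ X' → x ≠ v → x ∉ X)
    (hκ : v ∉ X' → κ ∈ L v) (hN : ∀ x ∈ S, G.Adj v x → φ x ≠ κ) :
    IsColOn G S X' L (Function.update φ v κ) := by
  refine ⟨fun x hx y hy e => ?_, fun x hx hxX => ?_⟩
  · by_cases hxv : x = v
    · subst hxv
      rw [Function.update_self, Function.update_of_ne e.ne']
      exact (hN y hy e).symm
    · by_cases hyv : y = v
      · subst hyv
        rw [Function.update_self, Function.update_of_ne hxv]
        exact hN x hx e.symm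
      · rw [Function.update_of_ne hxv, Function.update_of_ne hyv]
        exact h.proper x ⟨hx, hxv⟩ y ⟨hy, hyv⟩ e
  · by_cases hxv : x = v
    · subst hxv
      rw [Function.update_self]
      exact hκ hxX
    · rw [Function.update_of_ne hxv]
      exact h.mem x ⟨hx, hxv⟩ (hX x hx hxX hxv)

open Classical in
/-- Colourings of two vertex sets which agree on the overlap can be combined if no edge joins the
two differences. -/
theorem IsColOn.glue {S₁ S₂ X₁ X₂ : Set V} {φ₁ φ₂ : V → ℕ} (h₁ : IsColOn G S₁ X₁ L φ₁)
    (h₂ : IsColOn G S₂ X₂ L φ₂) (hS : S ⊆ S₁ ∪ S₂) (hagree : ∀ v ∈ S₁, v ∈ S₂ → φ₁ v = φ₂ v)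
    (hedge : ∀ x ∈ S₁, ∀ y ∈ S₂, G.Adj x y → x ∈ S₂ ∨ y ∈ S₁)
    (hX₁ : ∀ v ∈ S₁, v ∉ X → v ∉ X₁) (hX₂ : ∀ v ∈ S₂, v ∉ S₁ → v ∉ X → v ∉ X₂) :
    ∃ φ, IsColOn G S X L φ ∧ (∀ v ∈ S₁, φ v = φ₁ v) ∧ ∀ v ∈ S₂, φ v = φ₂ v := by
  have e1 : ∀ v ∈ S₁, (fun v => if v ∈ S₁ then φ₁ v else φ₂ v) v = φ₁ v := fun v hv => if_pos hv
  have e2 : ∀ v ∈ S₂, (fun v => if v ∈ S₁ then φ₁ v else φ₂ v) v = φ₂ v := fun v hv => by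
    by_cases h : v ∈ S₁
    · simp only [h, if_true]; exact hagree v h hv
    · simp only [h, if_false]
  generalize (fun v => if v ∈ S₁ then φ₁ v else φ₂ v) = φ at e1 e2
  have mixed : ∀ x ∈ S₁, ∀ y ∈ S₂, G.Adj x y → φ x ≠ φ y := fun x hx y hy e => by
    rcases hedge x hx y hy e with hx' | hy'
    · rw [e2 x hx', e2 y hy]; exact h₂.proper x hx' y hy e
    · rw [e1 x hx, e1 y hy']; exact h₁.proper x hx y hy' e
  refine ⟨φ, ⟨fun x hx y hy e => ?_, fun v hv hvX => ?_⟩, e1, e2⟩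
  · rcases hS hx with hx | hx <;> rcases hS hy with hy | hy
    · rw [e1 x hx, e1 y hy]; exact h₁.proper x hx y hy e
    · exact mixed x hx y hy e
    · exact (mixed y hy x hx e.symm).symm
    · rw [e2 x hx, e2 y hy]; exact h₂.proper x hx y hy e
  · by_cases h1 : v ∈ S₁
    · rw [e1 v h1]; exact h₁.mem v h1 (hX₁ v h1 hvX)
    · have hv2 := (hS hv).resolve_left h1
      rw [e2 v hv2]; exact h₂.mem v hv2 (hX₂ v hv2 h1 hvX)

/-- A colouring of `S \ K` and one of `K ∪ B` agreeing on `B`, where `B` contains all outer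
neighbours of `K`. -/
theorem IsColOn.glue_attach {K B : Set V} {φ χ : V → ℕ} (h : IsColOn G (S \ K) X L φ)
    (h' : IsColOn G (K ∪ B) B L χ) (hBS : B ⊆ S \ K) (hB : ∀ v ∈ B, χ v = φ v)
    (hK : ∀ x ∈ K, ∀ y ∈ S, G.Adj x y → y ∈ K ∨ y ∈ B) :
    ∃ φ', IsColOn G S X L φ' ∧ ∀ v ∈ S \ K, φ' v = φ v := by
  obtain ⟨φ', h1, h2, -⟩ := h.glue h' (S := S) (X := X) (fun x hx => by
      by_cases hk : x ∈ K
      exacts [.inr (.inl hk), .inl ⟨hx, hk⟩])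
    (fun v hv hv' => by
      rcases hv' with hv' | hv'
      exacts [absurd hv' hv.2, (hB v hv').symm])
    (fun x hx y hy e => by
      rcases hy with hy | hy
      · rcases hK y hy x hx.1 e.symm with h | h
        exacts [.inl (.inl h), .inl (.inr h)]
      · exact .inr (hBS hy))
    (fun v _ h => h) (fun v hv hv1 _ hvB => hv1 (hBS hvB))
  exact ⟨φ', h1, h2⟩

theorem exists_mem_ne_of_two_le {A : Finset ℕ} (h : 2 ≤ A.card) (a : ℕ) : ∃ b ∈ A, b ≠ a :=
  Finset.exists_mem_ne (by omega) a

/-- Thomassen's theorem for disc graphs, with a precoloured edge, vertex or nothing. -/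
theorem thomassen [Finite V] (S : Set V) : ∀ (O : Set V) (L : V → Finset ℕ), Disc G S O →
    (∀ x ∈ S ∩ O, ∀ y ∈ S ∩ O, G.Adj x y → ∀ a c : ℕ, a ≠ c → ListsOK S {x, y} O L →
      ∃ φ, IsColOn G S {x, y} L φ ∧ φ x = a ∧ φ y = c) ∧
    (∀ y ∈ S ∩ O, ∀ c : ℕ, ListsOK S {y} O L → ∃ φ, IsColOn G S {y} L φ ∧ φ y = c) ∧
    (ListsOK S ∅ O L → ∃ φ, IsColOn G S ∅ L φ) := by
  classical
  induction S using WellFoundedLT.induction with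
  | ind S IH =>
  intro O L hD
  have hlt : ∀ {v}, v ∈ S → S \ {v} < S := fun hv => Set.sdiff_singleton_ssubset.2 hv
  -- A precoloured edge.
  have T2 : ∀ x ∈ S ∩ O, ∀ y ∈ S ∩ O, G.Adj x y → ∀ a c : ℕ, a ≠ c → ListsOK S {x, y} O L →
      ∃ φ, IsColOn G S {x, y} L φ ∧ φ x = a ∧ φ y = c := by
    intro x hx y hy e a c hac hL
    by_cases hN : ∃ v ∈ S ∩ O, G.Adj x v ∧ v ≠ y
    · obtain ⟨v, hv, exv, hvy⟩ := hN
      have hvx := exv.ne'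
      by_cases h2 : ∃ w, ∀ z ∈ S ∩ O, G.Adj v z → z = x ∨ z = w
      · -- Two colours of `v` are kept free for it: only `w` can take one of them.
        obtain ⟨w, hw⟩ := h2
        have h3 := (hL v hv.1 (by simp [hvx, hvy])).1 hv.2
        obtain ⟨R, hRL, hR⟩ := Finset.exists_subset_card_eq (s := (L v).erase a) (n := 2) (by
          have := Finset.pred_card_le_card_erase (s := L v) (a := a)
          omega)
        obtain ⟨φ, hφ, hφx, hφy⟩ := (IH (S \ {v}) (hlt hv.1) (O ∪ {z | G.Adj v z})
          (dropList O {z | G.Adj v z} R L) (hD.delete hv.1 hv.2)).1 x ⟨⟨hx.1, hvx.symm⟩, .inl hx.2⟩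
          y ⟨⟨hy.1, hvy.symm⟩, .inl hy.2⟩ e a c hac
          (hL.drop hR.le Set.sdiff_subset fun _ _ h => h)
        obtain ⟨κ, hκR, hκ⟩ := exists_mem_ne_of_two_le hR.ge (φ w)
        refine ⟨Function.update φ v κ, IsColOn.update (hφ.mono_lists subset_rfl (fun _ _ h => h)
          fun z _ _ hz => dropList_subset z hz) (fun _ _ h _ => h)
          (fun _ => Finset.mem_of_mem_erase (hRL hκR)) ?_, ?_, ?_⟩
        · intro z hz evz hzκ
          by_cases hzO : z ∈ O
          · rcases hw z ⟨hz, hzO⟩ evz with rfl | rfl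
            · rw [hφx] at hzκ
              exact Finset.ne_of_mem_erase (hRL hκR) hzκ.symm
            · exact hκ hzκ.symm
          · have hzX : z ∉ ({x, y} : Set V) := by
              rintro (rfl | rfl)
              exacts [hzO hx.2, hzO hy.2]
            have := hφ.mem z ⟨hz, evz.ne'⟩ hzX
            rw [hzκ] at this
            exact notMem_of_mem_dropList this hzO evz hκR
        · rw [Function.update_of_ne hvx.symm, hφx]
        · rw [Function.update_of_ne hvy.symm, hφy]
      · -- Otherwise `v` is an end of a separating chord `vz`.
        have hsep : ∃ z ∈ S ∩ O, G.Adj v z ∧ ∃ k ∈ S \ {v, z},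
            x ∉ comp G (S \ {v, z}) k ∧ y ∉ comp G (S \ {v, z}) k := by
          push Not at h2
          obtain ⟨w, hw, evw, hwx, -⟩ := h2 x
          obtain ⟨w', hw', evw', hwx', hww'⟩ := h2 w
          have hyx : ∀ z k, k ∈ S \ {v, z} → z ≠ x → x ∉ comp G (S \ {v, z}) k →
              y ∉ comp G (S \ {v, z}) k := fun z k hk hzx hxk hyk =>
            hxk (comp_step hyk e.symm ⟨hx.1, by simp [hvx.symm, hzx.symm]⟩)
          rcases hD.exists_separator hv hx hw hw' exv.symm evw evw' hwx.symm hww'.symm hwx' with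
            h | h | h
          · have hwT : w ∈ S \ {v, w'} := ⟨hw.1, by simp [evw.ne', hww'.symm]⟩
            have := fun hxk => h (comp_symm hwT hxk)
            exact ⟨w', hw', evw', w, hwT, this, hyx _ _ hwT hwx' this⟩
          · have hwT : w ∈ S \ {v, x} := ⟨hw.1, by simp [evw.ne', hwx]⟩
            have hwT' : w' ∈ S \ {v, x} := ⟨hw'.1, by simp [evw'.ne', hwx']⟩
            have hxn : ∀ k ∈ S \ {v, x}, x ∉ comp G (S \ {v, x}) k := fun k hk hxk =>
              (comp_subset hk hxk).2 (by simp)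
            by_cases hyw : y ∈ comp G (S \ {v, x}) w
            · refine ⟨x, hx, exv.symm, w', hwT', hxn _ hwT', fun hyw' => h ?_⟩
              exact comp_trans hyw (comp_symm hwT' hyw')
            · exact ⟨x, hx, exv.symm, w, hwT, hxn _ hwT, hyw⟩
          · have hwT' : w' ∈ S \ {v, w} := ⟨hw'.1, by simp [evw'.ne', hww']⟩
            exact ⟨w, hw, evw, w', hwT', h, hyx _ _ hwT' hwx h⟩
        obtain ⟨z, hz, evz, k, hk, hxK, hyK⟩ := hsep
        set K := comp G (S \ {v, z}) k with hKdef
        have hKS := comp_subset (H := G) hk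
        have hkK : k ∈ K := mem_comp_self
        have hvK : v ∉ K := fun h => (hKS h).2 (by simp)
        have hzK : z ∉ K := fun h => (hKS h).2 (by simp)
        have hlt1 : S \ K < S := Set.sdiff_ssubset_left_iff.2 ⟨k, hk.1, hkK⟩
        have hsub2 : K ∪ {v, z} ⊆ S := by
          rintro s (hs | rfl | rfl)
          exacts [(hKS hs).1, hv.1, hz.1]
        have hlt2 : K ∪ {v, z} < S := by
          refine (Set.ssubset_iff_of_subset hsub2).2 ?_
          by_cases hzx : z = x
          · exact ⟨y, hy.1, by simp [hyK, hvy.symm, hzx, e.ne']⟩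
          · exact ⟨x, hx.1, by simp [hxK, hvx.symm, Ne.symm hzx]⟩
        obtain ⟨φ, hφ, hφx, hφy⟩ := (IH _ hlt1 O L (hD.mono Set.sdiff_subset subset_rfl)).1
          x ⟨⟨hx.1, hxK⟩, hx.2⟩ y ⟨⟨hy.1, hyK⟩, hy.2⟩ e a c hac fun s hs => hL s hs.1
        obtain ⟨χ, hχ, hχv, hχz⟩ := (IH _ hlt2 O L (hD.mono hsub2 subset_rfl)).1
          v ⟨by simp, hv.2⟩ z ⟨by simp, hz.2⟩ evz (φ v) (φ z)
          (hφ.proper v ⟨hv.1, hvK⟩ z ⟨hz.1, hzK⟩ evz) fun s hs hsX => by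
            refine hL s (hsub2 hs) ?_
            have hsK := hs.resolve_right hsX
            rintro (rfl | rfl)
            exacts [hxK hsK, hyK hsK]
        obtain ⟨φ', h1, h2⟩ := hφ.glue_attach hχ (S := S) (K := K) (B := {v, z})
          (by rintro s (rfl | rfl); exacts [⟨hv.1, hvK⟩, ⟨hz.1, hzK⟩])
          (by rintro s (rfl | rfl); exacts [hχv, hχz])
          (fun s hs t ht est => by
            by_cases htB : t ∈ ({v, z} : Set V)
            · exact .inr htB
            · exact .inl (comp_step hs est ⟨ht, htB⟩))
        exact ⟨φ', h1, (h2 x ⟨hx.1, hxK⟩).trans hφx, (h2 y ⟨hy.1, hyK⟩).trans hφy⟩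
    · push Not at hN
      obtain ⟨φ, hφ, hφy⟩ := (IH (S \ {x}) (hlt hx.1) (O ∪ {z | G.Adj x z})
        (dropList O {z | G.Adj x z} {a} L) (hD.delete hx.1 hx.2)).2.1 y
        ⟨⟨hy.1, e.ne'⟩, .inl hy.2⟩ c (hL.drop (by simp) Set.sdiff_subset fun s hs hsy hsX => by
          rcases hsX with h | h
          exacts [hs.2 h, hsy h])
      refine ⟨Function.update φ x a, IsColOn.update (hφ.mono_lists subset_rfl (fun _ _ h => h)
          fun z _ _ hz => dropList_subset z hz) (fun s _ hs _ hsy => hs (.inr hsy))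
          (fun h => absurd (.inl rfl) h) ?_, by simp, by
          rw [Function.update_of_ne e.ne', hφy]⟩
      intro z hz exz hza
      by_cases hzO : z ∈ O
      · rw [hN z ⟨hz, hzO⟩ exz, hφy] at hza
        exact hac hza.symm
      · have := hφ.mem z ⟨hz, exz.ne'⟩ (by rintro rfl; exact hzO hy.2)
        rw [hza] at this
        exact notMem_of_mem_dropList this hzO exz (by simp)
  -- A precoloured vertex.
  have T1 : ∀ y ∈ S ∩ O, ∀ c : ℕ, ListsOK S {y} O L → ∃ φ, IsColOn G S {y} L φ ∧ φ y = c := by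
    intro y hy c hL
    by_cases hN : ∃ z ∈ S ∩ O, G.Adj y z
    · obtain ⟨z, hz, e⟩ := hN
      have h3 := (hL z hz.1 (by simpa using e.ne')).1 hz.2
      obtain ⟨κ, hκ, hκc⟩ := exists_mem_ne_of_two_le (by omega : 2 ≤ (L z).card) c
      obtain ⟨φ, hφ, hφy, hφz⟩ := T2 y hy z hz e c κ hκc.symm fun s hs hsX =>
        hL s hs fun h => hsX (.inl h)
      refine ⟨φ, ⟨hφ.proper, fun v hv hvy => ?_⟩, hφy⟩
      by_cases hvz : v = z
      · rw [hvz, hφz]; exact hκ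
      · exact hφ.mem v hv (by rintro (h | h); exacts [hvy h, hvz h])
    · push Not at hN
      obtain ⟨φ, hφ⟩ := (IH (S \ {y}) (hlt hy.1) (O ∪ {z | G.Adj y z})
        (dropList O {z | G.Adj y z} {c} L) (hD.delete hy.1 hy.2)).2.2
        (hL.drop (by simp) Set.sdiff_subset fun s hs _ => hs.2)
      refine ⟨Function.update φ y c, IsColOn.update (hφ.mono_lists subset_rfl (fun _ _ h => h)
          fun z _ _ hz => dropList_subset z hz) (fun s _ _ _ => by simp)
          (fun h => absurd rfl h) ?_, by simp⟩
      intro z hz eyz hzc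
      have := hφ.mem z ⟨hz, eyz.ne'⟩ (by simp)
      rw [hzc] at this
      exact notMem_of_mem_dropList this (fun h => hN z ⟨hz, h⟩ eyz) eyz (by simp)
  refine ⟨T2, T1, fun hL => ?_⟩
  rcases S.eq_empty_or_nonempty with rfl | ⟨s, hs⟩
  · exact ⟨fun _ => 0, by simp, by simp⟩
  have hne : ∀ z ∈ S, (L z).Nonempty := fun z hz => by
    rw [← Finset.card_pos]
    by_cases h : z ∈ O
    · have := (hL z hz (by simp)).1 h; omega
    · have := (hL z hz (by simp)).2 h; omega
  by_cases hO : ∃ z ∈ S, z ∈ O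
  · obtain ⟨z, hz, hzO⟩ := hO
    obtain ⟨κ, hκ⟩ := hne z hz
    obtain ⟨φ, hφ, hφz⟩ := T1 z ⟨hz, hzO⟩ κ fun s hs _ => hL s hs (by simp)
    refine ⟨φ, hφ.proper, fun v hv _ => ?_⟩
    by_cases hvz : v = z
    · rw [hvz, hφz]; exact hκ
    · exact hφ.mem v hv hvz
  · push Not at hO
    obtain ⟨κ, hκ⟩ := hne s hs
    obtain ⟨φ, hφ⟩ := (IH (S \ {s}) (hlt hs) {z | G.Adj s z}
      (dropList O {z | G.Adj s z} {κ} L) (hD.link hs)).2.2 (fun v hv hvX => by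
        have := (hL.drop (X' := ∅) (N := {z | G.Adj s z}) (R := {κ}) (by simp)
          (Set.sdiff_subset (t := {s})) fun _ _ h => h) v hv hvX
        exact ⟨fun h => this.1 (.inr h), fun h => this.2 fun h' => h'.elim (hO v hv.1) h⟩)
    refine ⟨Function.update φ s κ, IsColOn.update (hφ.mono_lists subset_rfl (fun _ _ h => h)
          fun z _ _ hz => dropList_subset z hz) (fun _ _ _ _ => by simp) (fun _ => hκ) ?_⟩
    intro z hz e hzκ
    have := hφ.mem z ⟨hz, e.ne'⟩ (by simp)
    rw [hzκ] at this
    exact notMem_of_mem_dropList this (hO z hz) e (by simp)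

end Colouring

/-! ### Two-edge paths on the boundary -/

/-- A disc graph with a path `p q r` of boundary vertices; outside this path the lists have the
sizes of Thomassen's theorem. -/
structure Rainbow {V : Type*} (G : SimpleGraph V) (S O : Set V) (L : V → Finset ℕ) (p q r : V) :
    Prop where
  disc : Disc G S O
  hp : p ∈ S ∩ O
  hq : q ∈ S ∩ O
  hr : r ∈ S ∩ O
  epq : G.Adj p q
  eqr : G.Adj q r
  hpr : p ≠ r
  lists : ListsOK S {p, q, r} O L

/-- The colours `a`, `c`, `b` of `p`, `q`, `r` are proper along the path but cannot be extended. -/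
def Bad {V : Type*} (G : SimpleGraph V) (S : Set V) (L : V → Finset ℕ) (p q r : V) (a c b : ℕ) :
    Prop :=
  a ≠ c ∧ c ≠ b ∧ ¬ ∃ φ, IsColOn G S {p, q, r} L φ ∧ φ p = a ∧ φ q = c ∧ φ r = b

/-- No nonempty set of vertices off the path can be deleted with a guarantee that every colouring of
the rest extends to it. -/
def Irred {V : Type*} (G : SimpleGraph V) (S : Set V) (L : V → Finset ℕ) (p q r : V) : Prop :=
  ∀ K ⊆ S, K.Nonempty → p ∉ K → q ∉ K → r ∉ K →
    ¬ ∀ φ, IsColOn G (S \ K) {p, q, r} L φ →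
      ∃ φ', IsColOn G S {p, q, r} L φ' ∧ ∀ v ∈ S \ K, φ' v = φ v

section Rainbow

variable {V : Type*} {G : SimpleGraph V} {S O : Set V} {L : V → Finset ℕ}
  {p q r : V} {a b c : ℕ}

theorem Rainbow.symm (h : Rainbow G S O L p q r) : Rainbow G S O L r q p where
  disc := h.disc
  hp := h.hr
  hq := h.hq
  hr := h.hp
  epq := h.eqr.symm
  eqr := h.epq.symm
  hpr := h.hpr.symm
  lists := by
    have : ({r, q, p} : Set V) = {p, q, r} := by ext; simp; grind
    rw [this]; exact h.lists

theorem Bad.symm (h : Bad G S L p q r a c b) : Bad G S L r q p b c a := by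
  have : ({r, q, p} : Set V) = {p, q, r} := by ext; simp; grind
  refine ⟨h.2.1.symm, h.1.symm, ?_⟩
  rw [this]
  rintro ⟨φ, h1, h2, h3, h4⟩
  exact h.2.2 ⟨φ, h1, h4, h3, h2⟩

theorem Rainbow.mono (h : Rainbow G S O L p q r) {S' : Set V} (hS : S' ⊆ S) (hp : p ∈ S')
    (hq : q ∈ S') (hr : r ∈ S') : Rainbow G S' O L p q r where
  disc := h.disc.mono hS subset_rfl
  hp := ⟨hp, h.hp.2⟩
  hq := ⟨hq, h.hq.2⟩
  hr := ⟨hr, h.hr.2⟩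
  epq := h.epq
  eqr := h.eqr
  hpr := h.hpr
  lists := fun v hv => h.lists v (hS hv)

theorem Rainbow.listsOK_of_disjoint (h : Rainbow G S O L p q r) {K B : Set V}
    (hKS : K ⊆ S) (hKO : ∀ s ∈ K, s ∉ O) (hp : p ∉ K) (hq : q ∉ K) (hr : r ∉ K) :
    ListsOK (K ∪ B) B ∅ L := by
  intro s hs hsB
  have hsK := hs.resolve_right hsB
  refine ⟨fun h => h.elim, fun _ => (h.lists s (hKS hsK) ?_).2 (hKO s hsK)⟩
  rintro (rfl | rfl | rfl)
  exacts [hp hsK, hq hsK, hr hsK]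

theorem Irred.attach (hI : Irred G S L p q r) {K B : Set V} (hKS : K ⊆ S) (hK : K.Nonempty)
    (hp : p ∉ K) (hq : q ∉ K) (hr : r ∉ K) (hBS : B ⊆ S \ K)
    (hN : ∀ x ∈ K, ∀ y ∈ S, G.Adj x y → y ∈ K ∨ y ∈ B)
    (hext : ∀ ψ : V → ℕ, (∀ x ∈ B, ∀ y ∈ B, G.Adj x y → ψ x ≠ ψ y) →
      ∃ χ, IsColOn G (K ∪ B) B L χ ∧ ∀ v ∈ B, χ v = ψ v) : False := by
  refine hI K hKS hK hp hq hr fun φ hφ => ?_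
  obtain ⟨χ, h1, h2⟩ := hext φ fun x hx y hy e => hφ.proper x (hBS hx) y (hBS hy) e
  exact hφ.glue_attach h1 hBS h2 hN

section Finite

variable [Finite V]

theorem thomassen_edge (hD : Disc G S O) {x y : V} (hx : x ∈ S ∩ O) (hy : y ∈ S ∩ O)
    (e : G.Adj x y) (hac : a ≠ c) (hL : ListsOK S {x, y} O L) :
    ∃ φ, IsColOn G S {x, y} L φ ∧ φ x = a ∧ φ y = c :=
  (thomassen S O L hD).1 x hx y hy e a c hac hL

open Classical in
/-- If `p` and `q` have been coloured, then at most one colour of `r` is bad: otherwise Thomassen's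
theorem applies with a list consisting of two bad colours and the colour of `q`. -/
theorem Rainbow.bad_right_unique (h : Rainbow G S O L p q r) {b' : ℕ}
    (h1 : Bad G S L p q r a c b) (h2 : Bad G S L p q r a c b') : b = b' := by
  by_contra hne
  have hrq := h.eqr.ne'
  have hrp := h.hpr.symm
  obtain ⟨φ, hφ, hφp, hφq⟩ := thomassen_edge h.disc h.hp h.hq h.epq h1.1
    (L := Function.update L r {b, b', c}) (fun v hv hvX => by
      by_cases hvr : v = r
      · subst hvr
        rw [Function.update_self]
        have : ({b, b', c} : Finset ℕ).card = 3 :=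
          Finset.card_eq_three.2 ⟨b, b', c, hne, h1.2.1.symm, h2.2.1.symm, rfl⟩
        exact ⟨fun _ => this.ge, fun hn => absurd h.hr.2 hn⟩
      · rw [Function.update_of_ne hvr]
        exact h.lists v hv (by simpa [hvr] using hvX))
  have hr := hφ.mem r h.hr.1 (by simp [hrq, hrp])
  have hqr := hφ.proper q h.hq.1 r h.hr.1 h.eqr
  have hφ' : IsColOn G S {p, q, r} L φ := hφ.mono_lists subset_rfl
    (fun x _ hx hx' => hx (by rcases hx' with rfl | rfl <;> simp)) (fun x _ hx hxL => by
      rwa [Function.update_of_ne (fun hxr => hx (by simp [hxr]))] at hxL)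
  rw [Function.update_self] at hr
  simp only [Finset.mem_insert, Finset.mem_singleton] at hr
  rcases hr with hr | hr | hr
  · exact h1.2.2 ⟨φ, hφ', hφp, hφq, hr⟩
  · exact h2.2.2 ⟨φ, hφ', hφp, hφq, hr⟩
  · exact hqr (hφq.trans hr.symm)

theorem Rainbow.bad_left_unique (h : Rainbow G S O L p q r) {a' : ℕ}
    (h1 : Bad G S L p q r a c b) (h2 : Bad G S L p q r a' c b) : a = a' :=
  h.symm.bad_right_unique h1.symm h2.symm

/-- If `p` and `r` are adjacent, only improper colourings of the path are bad. -/
theorem Rainbow.eq_of_bad_of_adj (h : Rainbow G S O L p q r) (e : G.Adj p r)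
    (h1 : Bad G S L p q r a c b) : a = b := by
  by_contra hab
  refine hab (h.bad_right_unique (b := a) (c := c) (a := a) ⟨h1.1, h1.1.symm, ?_⟩ h1)
  rintro ⟨φ, hφ, h2, -, h4⟩
  exact hφ.proper p h.hp.1 r h.hr.1 e (h2.trans h4.symm)

/-- Nothing is attached along an edge of boundary vertices. -/
theorem Rainbow.no_attached_edge (h : Rainbow G S O L p q r) (hI : Irred G S L p q r) {K : Set V}
    (hKS : K ⊆ S) (hK : K.Nonempty) (hp : p ∉ K) (hq : q ∉ K) (hr : r ∉ K) {x y : V}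
    (hx : x ∈ S ∩ O) (hy : y ∈ S ∩ O) (e : G.Adj x y) (hxK : x ∉ K) (hyK : y ∉ K)
    (hN : ∀ s ∈ K, ∀ t ∈ S, G.Adj s t → t ∈ K ∨ t = x ∨ t = y) : False := by
  refine hI.attach hKS hK hp hq hr (B := {x, y}) ?_ hN fun ψ hψ => ?_
  · rintro s (rfl | rfl)
    exacts [⟨hx.1, hxK⟩, ⟨hy.1, hyK⟩]
  have hsub : K ∪ {x, y} ⊆ S := by
    rintro s (hs | rfl | rfl)
    exacts [hKS hs, hx.1, hy.1]
  obtain ⟨χ, hχ, h1, h2⟩ := thomassen_edge (h.disc.mono hsub subset_rfl) (x := x) (y := y)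
    ⟨by simp, hx.2⟩ ⟨by simp, hy.2⟩ e (hψ x (by simp) y (by simp) e) (L := L) fun s hs hsX =>
      h.lists s (hsub hs) (by
        have hsK := hs.resolve_right hsX
        rintro (rfl | rfl | rfl)
        exacts [hp hsK, hq hsK, hr hsK])
  exact ⟨χ, hχ, by rintro s (rfl | rfl); exacts [h1, h2]⟩

open Classical in
/-- Nothing is inside a triangle. -/
theorem Rainbow.no_attached_triangle (h : Rainbow G S O L p q r) (hI : Irred G S L p q r)
    {K : Set V} (hKS : K ⊆ S) (hK : K.Nonempty) (hKO : ∀ s ∈ K, s ∉ O) (hp : p ∉ K) (hq : q ∉ K)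
    (hr : r ∉ K) {x y z : V} (hx : x ∈ S \ K) (hy : y ∈ S \ K) (hz : z ∈ S \ K) (exy : G.Adj x y)
    (eyz : G.Adj y z) (ezx : G.Adj z x)
    (hN : ∀ s ∈ K, ∀ t ∈ S, G.Adj s t → t ∈ K ∨ t = x ∨ t = y ∨ t = z) : False := by
  refine hI.attach hKS hK hp hq hr (B := {x, y, z}) ?_ hN fun ψ hψ => ?_
  · rintro s (rfl | rfl | rfl) <;> assumption
  have hsub : K ∪ {x, y, z} ⊆ S := by
    rintro s (hs | rfl | rfl | rfl)
    exacts [hKS hs, hx.1, hy.1, hz.1]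
  have hL := h.listsOK_of_disjoint (B := {x, y, z}) hKS hKO hp hq hr
  obtain ⟨χ, hχ, h1, h2⟩ := thomassen_edge
    ((h.disc.mono hsub subset_rfl).link (v := x) (by simp)) (x := y) (y := z)
    ⟨⟨by simp, by simpa using exy.ne'⟩, exy⟩ ⟨⟨by simp, by simpa using ezx.ne⟩, ezx.symm⟩ eyz
    (hψ y (by simp) z (by simp) eyz) (L := dropList ∅ {t | G.Adj x t} {ψ x} L) (by
      have := hL.drop (S' := (K ∪ {x, y, z}) \ {x}) (X' := {y, z}) (N := {t | G.Adj x t})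
        (R := {ψ x}) (by simp) Set.sdiff_subset (by
          rintro s hs hs' (h | h)
          exacts [hs.2 h, hs' h])
      rwa [Set.empty_union] at this)
  refine ⟨Function.update χ x (ψ x), IsColOn.update (hχ.mono_lists subset_rfl (fun _ _ h => h)
    fun z _ _ hz => dropList_subset z hz) (fun s _ hs _ h => hs (.inr h))
    (fun h => absurd (.inl rfl) h) ?_, ?_⟩
  · intro s hs exs hsx
    by_cases hsB : s ∈ ({y, z} : Set V)
    · rcases hsB with rfl | rfl
      · exact hψ x (by simp) s (by simp) exs (by rw [← hsx, h1])
      · exact hψ x (by simp) s (by simp) exs (by rw [← hsx, h2])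
    · have := hχ.mem s ⟨hs, exs.ne'⟩ hsB
      rw [hsx] at this
      exact notMem_of_mem_dropList this (Set.notMem_empty _) exs (by simp)
  · rintro s (rfl | rfl | rfl)
    · simp
    · rw [Function.update_of_ne exy.ne', h1]
    · rw [Function.update_of_ne ezx.ne, h2]

open Classical in
/-- Nothing is inside a 4-cycle. -/
theorem Rainbow.no_attached_square (h : Rainbow G S O L p q r) (hI : Irred G S L p q r)
    {K : Set V} (hKS : K ⊆ S) (hK : K.Nonempty) (hKO : ∀ s ∈ K, s ∉ O) (hp : p ∉ K) (hq : q ∉ K)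
    (hr : r ∉ K) {x y z w : V} (hx : x ∈ S \ K) (hy : y ∈ S \ K) (hz : z ∈ S \ K) (hw : w ∈ S \ K)
    (exy : G.Adj x y) (eyz : G.Adj y z) (ezw : G.Adj z w) (ewx : G.Adj w x) (hxz : x ≠ z)
    (hyw : y ≠ w)
    (hN : ∀ s ∈ K, ∀ t ∈ S, G.Adj s t → t ∈ K ∨ t = x ∨ t = y ∨ t = z ∨ t = w) : False := by
  refine hI.attach hKS hK hp hq hr (B := {x, y, z, w}) ?_ hN fun ψ hψ => ?_
  · rintro s (rfl | rfl | rfl | rfl) <;> assumption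
  have hsub : K ∪ {x, y, z, w} ⊆ S := by
    rintro s (hs | rfl | rfl | rfl | rfl)
    exacts [hKS hs, hx.1, hy.1, hz.1, hw.1]
  have hL := h.listsOK_of_disjoint (B := {x, y, z, w}) hKS hKO hp hq hr
  have hD := (h.disc.mono hsub subset_rfl).link (v := x) (by simp)
  have hD' := hD.delete (v := y) ⟨by simp, by simpa using exy.ne'⟩ exy
  obtain ⟨χ, hχ, h1, h2⟩ := thomassen_edge hD' (x := z) (y := w)
    ⟨⟨⟨by simp, by simpa using hxz.symm⟩, by simpa using eyz.ne'⟩, .inr eyz⟩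
    ⟨⟨⟨by simp, by simpa using ewx.ne⟩, by simpa using hyw.symm⟩, .inl ewx.symm⟩ ezw
    (hψ z (by simp) w (by simp) ezw)
    (L := dropList ∅ ({t | G.Adj x t} ∪ {t | G.Adj y t}) {ψ x, ψ y} L) (by
      have := hL.drop (S' := ((K ∪ {x, y, z, w}) \ {x}) \ {y}) (X' := {z, w})
        (N := {t | G.Adj x t} ∪ {t | G.Adj y t})
        (R := {ψ x, ψ y}) Finset.card_le_two (Set.sdiff_subset.trans Set.sdiff_subset) (by
          rintro s hs hs' (h | h | h)
          exacts [hs.1.2 h, hs.2 h, hs' h])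
      rwa [Set.empty_union] at this)
  have hχB : ∀ s ∈ ({z, w} : Set V), χ s = ψ s := by
    rintro s (rfl | rfl)
    exacts [h1, h2]
  have step : ∀ t ∈ ({x, y} : Set V), ∀ s ∈ ((K ∪ {x, y, z, w}) \ {x}) \ {y}, G.Adj t s →
      χ s ≠ ψ t := by
    intro t ht s hs ets hst
    by_cases hsB : s ∈ ({z, w} : Set V)
    · rw [hχB s hsB] at hst
      exact hψ s (.inr (.inr hsB)) t (by rcases ht with rfl | rfl <;> simp) ets.symm hst
    · have := hχ.mem s hs hsB
      rw [hst] at this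
      refine notMem_of_mem_dropList this (Set.notMem_empty _) ?_ ?_
      · rcases ht with rfl | rfl
        exacts [.inl ets, .inr ets]
      · rcases ht with rfl | rfl <;> simp
  have c1 : IsColOn G ((K ∪ {x, y, z, w}) \ {x}) {y, z, w} L (Function.update χ y (ψ y)) :=
    IsColOn.update (hχ.mono_lists subset_rfl (fun _ _ h => h)
      fun z _ _ hz => dropList_subset z hz) (fun s _ hs _ h => hs (.inr h))
      (fun h => absurd (.inl rfl) h) fun s hs e => step y (by simp) s ⟨hs, e.ne'⟩ e
  refine ⟨Function.update (Function.update χ y (ψ y)) x (ψ x), IsColOn.update c1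
    (fun s _ hs _ h => hs (.inr h)) (fun h => absurd (.inl rfl) h) ?_, ?_⟩
  · intro s hs exs
    by_cases hsy : s = y
    · subst hsy
      rw [Function.update_self]
      exact hψ s (by simp) x (by simp) exs.symm
    · rw [Function.update_of_ne hsy]
      exact step x (by simp) s ⟨⟨hs, exs.ne'⟩, hsy⟩ exs
  · rintro s (rfl | rfl | rfl | rfl)
    · simp
    · rw [Function.update_of_ne exy.ne', Function.update_self]
    · rw [Function.update_of_ne hxz.symm, Function.update_of_ne eyz.ne', h1]
    · rw [Function.update_of_ne ewx.ne, Function.update_of_ne hyw.symm, h2]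

end Finite

end Rainbow

/-! ### Cutting along a chord at the middle vertex -/

section Chord

variable {V : Type*} {G : SimpleGraph V} {S O : Set V} {L : V → Finset ℕ}
  {p q r : V} {a b c : ℕ}

theorem Rainbow.chord_left (h : Rainbow G S O L p q r) {w : V} (hw : w ∈ S ∩ O) (e : G.Adj q w)
    (hpw : p ≠ w) (hpK : p ∉ comp G (S \ {q, w}) r) (hwr : w ≠ r) :
    Rainbow G (S \ comp G (S \ {q, w}) r) O L p q w where
  disc := h.disc.mono Set.sdiff_subset subset_rfl
  hp := ⟨⟨h.hp.1, hpK⟩, h.hp.2⟩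
  hq := ⟨⟨h.hq.1, fun hq => (comp_subset (T := S \ {q, w}) ⟨h.hr.1, by simp [h.eqr.ne', hwr.symm]⟩ hq).2
    (by simp)⟩,
    h.hq.2⟩
  hr := ⟨⟨hw.1, fun hq => (comp_subset (T := S \ {q, w}) ⟨h.hr.1, by simp [h.eqr.ne', hwr.symm]⟩ hq).2
    (by simp)⟩,
    hw.2⟩
  epq := h.epq
  eqr := e
  hpr := hpw
  lists := fun v hv hvX => h.lists v hv.1 (by
    rintro (rfl | rfl | rfl)
    exacts [hvX (by simp), hvX (by simp), hv.2 mem_comp_self])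

theorem Rainbow.chord_right (h : Rainbow G S O L p q r) {w : V} (hw : w ∈ S ∩ O) (e : G.Adj q w)
    (hpK : p ∉ comp G (S \ {q, w}) r) (hpw : p ≠ w) (hwr : w ≠ r) :
    Rainbow G (comp G (S \ {q, w}) r ∪ {q, w}) O L w q r := by
  have hKS := comp_subset (H := G) (x := r) (T := S \ {q, w})
    ⟨h.hr.1, by simp [h.eqr.ne', hwr.symm]⟩
  have hsub : comp G (S \ {q, w}) r ∪ {q, w} ⊆ S := by
    rintro s (hs | rfl | rfl)
    exacts [(hKS hs).1, h.hq.1, hw.1]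
  exact
  { disc := h.disc.mono hsub subset_rfl
    hp := ⟨by simp, hw.2⟩
    hq := ⟨by simp, h.hq.2⟩
    hr := ⟨.inl mem_comp_self, h.hr.2⟩
    epq := e.symm
    eqr := h.eqr
    hpr := hwr
    lists := fun v hv hvX => h.lists v (hsub hv) (by
      rintro (rfl | rfl | rfl)
      · rcases hv with hv | hv | hv
        exacts [hpK hv, h.epq.ne hv, hpw hv]
      · exact hvX (by simp)
      · exact hvX (by simp)) }

/-- A bad colouring splits along a chord `qw`: the list of `w` consists of the colour `c` of `q`,
the colour which is bad on the left and the one which is bad on the right. -/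
theorem Rainbow.bad_split [Finite V] (h : Rainbow G S O L p q r) {w : V} (hw : w ∈ S ∩ O)
    (e : G.Adj q w) (hpw : p ≠ w) (hpK : p ∉ comp G (S \ {q, w}) r) (hwr : w ≠ r)
    (hbad : Bad G S L p q r a c b) :
    ∃ d f, c ≠ d ∧ c ≠ f ∧ d ≠ f ∧ L w = {c, d, f} ∧
      Bad G (S \ comp G (S \ {q, w}) r) L p q w a c d ∧
      Bad G (comp G (S \ {q, w}) r ∪ {q, w}) L w q r f c b := by
  have h0 := h.chord_left hw e hpw hpK hwr
  have h1 := h.chord_right hw e hpK hpw hwr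
  set K := comp G (S \ {q, w}) r
  have hwX : w ∉ ({p, q, r} : Set V) := by simp [hpw.symm, e.ne', hwr]
  have key : ∀ η ∈ L w, η ≠ c → Bad G (S \ K) L p q w a c η ∨ Bad G (K ∪ {q, w}) L w q r η c b := by
    intro η hη hηc
    by_contra hcon
    push Not at hcon
    obtain ⟨n0, n1⟩ := hcon
    simp only [Bad, hbad.1, hηc, hηc.symm, hbad.2.1, ne_eq, not_false_eq_true, true_and,
      not_not] at n0 n1
    obtain ⟨φ, hφ, hφp, hφq, hφw⟩ := n0
    obtain ⟨χ, hχ, hχw, hχq, hχr⟩ := n1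
    have hφ' : IsColOn G (S \ K) {p, q} L φ := ⟨hφ.proper, fun v hv hvX => by
      by_cases hvw : v = w
      · rw [hvw, hφw]; exact hη
      · exact hφ.mem v hv (by rintro (h | h | h); exacts [hvX (.inl h), hvX (.inr h), hvw h])⟩
    obtain ⟨ψ, hψ, e0, e1⟩ := hφ'.glue hχ (S := S) (X := {p, q, r}) (L := L)
      (fun x hx => by by_cases hk : x ∈ K; exacts [.inr (.inl hk), .inl ⟨hx, hk⟩])
      (fun v hv hv' => by
        rcases hv' with hv' | rfl | rfl
        exacts [absurd hv' hv.2, hφq.trans hχq.symm, hφw.trans hχw.symm])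
      (fun x hx y hy exy => by
        rcases hy with hy | rfl | rfl
        · by_cases hxB : x ∈ ({q, w} : Set V)
          · exact .inl (.inr hxB)
          · exact absurd (comp_step hy exy.symm ⟨hx.1, hxB⟩) hx.2
        · exact .inr h0.hq.1
        · exact .inr h0.hr.1)
      (fun v hv hvX hv' => by
        rcases hv' with h | h
        exacts [hvX (.inl h), hvX (.inr (.inl h))])
      (fun v hv hv0 hvX hv' => by
        rcases hv' with h | h | h
        · exact hv0 (h ▸ h0.hr.1)
        · exact hvX (by simp [h])
        · exact hvX (.inr (.inr h)))
    exact hbad.2.2 ⟨ψ, hψ, (e0 p h0.hp.1).trans hφp, (e0 q h0.hq.1).trans hφq,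
      (e1 r h1.hr.1).trans hχr⟩
  have h3 := (h.lists w hw.1 hwX).1 hw.2
  have u0 : ∀ {x y}, Bad G (S \ K) L p q w a c x → Bad G (S \ K) L p q w a c y → x = y :=
    fun hx hy => h0.bad_right_unique hx hy
  have u1 : ∀ {x y}, Bad G (K ∪ {q, w}) L w q r x c b → Bad G (K ∪ {q, w}) L w q r y c b → x = y :=
    fun hx hy => h1.bad_left_unique hx hy
  obtain ⟨x, hx, y, hy, hxy⟩ := Finset.one_lt_card.1 (by
    have := Finset.pred_card_le_card_erase (s := L w) (a := c)
    omega : 1 < ((L w).erase c).card)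
  rw [Finset.mem_erase] at hx hy
  have fin : ∀ d f, d ∈ L w → f ∈ L w → c ≠ d → c ≠ f → d ≠ f →
      Bad G (S \ K) L p q w a c d → Bad G (K ∪ {q, w}) L w q r f c b →
      ∃ d f, c ≠ d ∧ c ≠ f ∧ d ≠ f ∧ L w = {c, d, f} ∧ Bad G (S \ K) L p q w a c d ∧
        Bad G (K ∪ {q, w}) L w q r f c b := by
    intro d f hd hf hcd hcf hdf b0 b1
    refine ⟨d, f, hcd, hcf, hdf, Finset.eq_of_subset_of_card_le (fun η hη => ?_) ?_, b0, b1⟩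
    · by_cases hηc : η = c
      · simp [hηc]
      · rcases key η hη hηc with h | h
        · simp [u0 h b0]
        · simp [u1 h b1]
    · rw [Finset.card_eq_three.2 ⟨c, d, f, hcd, hcf, hdf, rfl⟩]
      exact h3
  rcases key x hx.2 hx.1 with hx' | hx' <;> rcases key y hy.2 hy.1 with hy' | hy'
  · exact absurd (u0 hx' hy') hxy
  · exact fin x y hx.2 hy.2 hx.1.symm hy.1.symm hxy hx' hy'
  · exact fin y x hy.2 hx.2 hy.1.symm hx.1.symm hxy.symm hy' hx'
  · exact absurd (u1 hx' hy') hxy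

end Chord

/-! ### The boundary near an end of the path -/

/-- A rainbow in which nothing can be reduced: no attached pieces, no chord at the middle vertex, no
edge between the ends of the path. -/
structure Tight {V : Type*} (G : SimpleGraph V) (S O : Set V) (L : V → Finset ℕ) (p q r : V) : Prop
    extends Rainbow G S O L p q r where
  irred : Irred G S L p q r
  npr : ¬ G.Adj p r
  nchord : ∀ u ∈ S ∩ O, G.Adj q u → u = p ∨ u = r

section Tight

variable {V : Type*} {G : SimpleGraph V} {S O : Set V} {L : V → Finset ℕ}
  {p q r : V} {a b c : ℕ}

variable [Finite V]

theorem Rainbow.comp_meets_path (h : Rainbow G S O L p q r) (hI : Irred G S L p q r) {x y k : V}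
    (hx : x ∈ S ∩ O) (hy : y ∈ S ∩ O) (e : G.Adj x y) (hk : k ∈ S \ {x, y})
    (hp : p ∉ comp G (S \ {x, y}) k) (hq : q ∉ comp G (S \ {x, y}) k)
    (hr : r ∉ comp G (S \ {x, y}) k) : False := by
  have hKS := comp_subset (H := G) hk
  refine h.no_attached_edge hI (fun s hs => (hKS hs).1) ⟨k, mem_comp_self⟩ hp hq hr hx hy e
    (fun h => (hKS h).2 (by simp)) (fun h => (hKS h).2 (by simp)) fun s hs t ht est => ?_
  by_cases htB : t ∈ ({x, y} : Set V)
  · exact .inr htB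
  · exact .inl (comp_step hs est ⟨ht, htB⟩)

/-- If some colouring is bad, then `p` has a boundary neighbour besides `q`. -/
theorem Tight.exists_nbr (h : Tight G S O L p q r) (hbad : Bad G S L p q r a c b) :
    ∃ v ∈ S ∩ O, G.Adj p v ∧ v ≠ q := by
  classical
  by_contra hcon
  push Not at hcon
  obtain ⟨φ, hφ, hφq, hφr⟩ := thomassen_edge (h.disc.delete h.hp.1 h.hp.2) (x := q) (y := r)
    ⟨⟨h.hq.1, h.epq.ne'⟩, .inl h.hq.2⟩ ⟨⟨h.hr.1, h.hpr.symm⟩, .inl h.hr.2⟩ h.eqr hbad.2.1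
    (L := dropList O {z | G.Adj p z} {a} L)
    (h.lists.drop (by simp) Set.sdiff_subset fun s hs hs' hs'' => by
      rcases hs'' with h | h
      exacts [hs.2 h, hs' h])
  refine hbad.2.2 ⟨Function.update φ p a, IsColOn.update (hφ.mono_lists subset_rfl
    (fun _ _ h => h) fun z _ _ hz => dropList_subset z hz) (fun s _ hs _ hs' => hs (.inr hs'))
    (fun h => absurd (.inl rfl) h) ?_, by simp, ?_, ?_⟩
  · intro s hs eps hsa
    by_cases hsO : s ∈ O
    · rw [hcon s ⟨hs, hsO⟩ eps, hφq] at hsa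
      exact hbad.1 hsa.symm
    · have := hφ.mem s ⟨hs, eps.ne'⟩ (by
        rintro (rfl | rfl)
        exacts [hsO h.hq.2, hsO h.hr.2])
      rw [hsa] at this
      exact notMem_of_mem_dropList this hsO eps (by simp)
  · rw [Function.update_of_ne h.epq.ne', hφq]
  · rw [Function.update_of_ne h.hpr.symm, hφr]

/-- The boundary neighbour `v` of `p` has at most one further boundary neighbour. -/
theorem Tight.exists_second_nbr (h : Tight G S O L p q r) {v : V} (hv : v ∈ S ∩ O)
    (epv : G.Adj p v) (hvq : v ≠ q) : ∃ w, ∀ z ∈ S ∩ O, G.Adj v z → z = p ∨ z = w := by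
  by_contra hcon
  push Not at hcon
  obtain ⟨w, hw, evw, hwp, -⟩ := hcon p
  obtain ⟨w', hw', evw', hwp', hww'⟩ := hcon w
  have hrv : r ≠ v := by rintro rfl; exact h.npr epv
  have nvq : ∀ z, G.Adj v z → z ≠ q := by
    rintro z e rfl
    rcases h.nchord v hv e.symm with h | h
    exacts [epv.ne' h, hrv h.symm]
  have hwq := nvq w evw
  have hwq' := nvq w' evw'
  have vn : ∀ x k, k ∈ S \ {v, x} → v ∉ comp G (S \ {v, x}) k := fun x k hk hp =>
    (comp_subset hk hp).2 (by simp)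
  have rn : ∀ x k, x ≠ q → q ∉ comp G (S \ {v, x}) k → r ∉ comp G (S \ {v, x}) k :=
    fun x k hxq hq hr => hq (comp_step hr h.eqr.symm ⟨h.hq.1, by simp [hvq.symm, hxq.symm]⟩)
  have qn : ∀ x k, x ≠ p → p ∉ comp G (S \ {v, x}) k → q ∉ comp G (S \ {v, x}) k :=
    fun x k hxq hq hr => hq (comp_step hr h.epq.symm ⟨h.hp.1, by simp [epv.ne, hxq.symm]⟩)
  rcases h.disc.exists_separator hv h.hp hw hw' epv.symm evw evw' hwp.symm hww'.symm hwp' with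
    h1 | h1 | h1
  · have hk : w ∈ S \ {v, w'} := ⟨hw.1, by simp [evw.ne', hww'.symm]⟩
    have hp := fun hp => h1 (comp_symm hk hp)
    have hq := qn _ _ hwp' hp
    exact h.comp_meets_path h.irred hv hw' evw' hk hp hq (rn _ _ hwq' hq)
  · have hk : w ∈ S \ {v, p} := ⟨hw.1, by simp [evw.ne', hwp]⟩
    have hk' : w' ∈ S \ {v, p} := ⟨hw'.1, by simp [evw'.ne', hwp']⟩
    have pn : ∀ k, k ∈ S \ {v, p} → p ∉ comp G (S \ {v, p}) k := fun k hk hp =>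
      (comp_subset hk hp).2 (by simp)
    by_cases hq : q ∈ comp G (S \ {v, p}) w
    · have hq' : q ∉ comp G (S \ {v, p}) w' := fun hq' => h1 (comp_trans hq (comp_symm hk' hq'))
      exact h.comp_meets_path h.irred hv h.hp epv.symm hk' (pn _ hk') hq'
        (rn _ _ h.epq.ne hq')
    · exact h.comp_meets_path h.irred hv h.hp epv.symm hk (pn _ hk) hq (rn _ _ h.epq.ne hq)
  · have hk : w' ∈ S \ {v, w} := ⟨hw'.1, by simp [evw'.ne', hww']⟩
    have hq := qn _ _ hwp h1
    exact h.comp_meets_path h.irred hv hw evw hk h1 hq (rn _ _ hwq hq)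

/-- If the boundary neighbour `v` of `p` and the vertex `q` have a common neighbour `u` inside, then
the 4-cycle `q p v u` has nothing inside: `p` has no neighbours besides `q`, `u`, `v`. -/
theorem Tight.nbrs_of_common_nbr (h : Tight G S O L p q r) {u v : V} (hv : v ∈ S ∩ O)
    (epv : G.Adj p v) (hvq : v ≠ q) (hu : u ∈ S) (huO : u ∉ O) (equ : G.Adj q u)
    (evu : G.Adj v u) : ∀ m ∈ S, G.Adj p m → m = q ∨ m = u ∨ m = v := by
  intro m hm epm
  by_contra hcon
  push Not at hcon
  have hpu : p ≠ u := by rintro rfl; exact huO h.hp.2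
  have hqu := equ.ne
  have hvu := evu.ne
  have hpq := h.epq.ne
  have hpv := epv.ne
  have hru : r ≠ u := by rintro rfl; exact huO h.hr.2
  have hrv : r ≠ v := by rintro rfl; exact h.npr epv
  obtain ⟨T, hT⟩ : ∃ T : Set V, T = S \ {p, q, u, v} := ⟨_, rfl⟩
  have hmT : m ∈ T := by simp [hT, hm, hcon, epm.ne']
  have hrT : r ∈ T := by simp [hT, h.hr.1, h.hpr.symm, h.eqr.ne', hru, hrv]
  have hTS : T ⊆ S := hT ▸ Set.sdiff_subset
  obtain ⟨M, hM⟩ : ∃ M : Set V, M = comp G T m := ⟨_, rfl⟩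
  have hMT : M ⊆ T := hM ▸ comp_subset hmT
  have hMc : ConnSet G M := hM ▸ connSet_comp
  have hmM : m ∈ M := hM ▸ mem_comp_self
  have hMS := hMT.trans hTS
  have hstep : ∀ s ∈ M, ∀ t ∈ S, G.Adj s t → t ∈ M ∨ t = p ∨ t = q ∨ t = u ∨ t = v := by
    intro s hs t ht e
    by_cases htT : t ∈ T
    · exact .inl (by rw [hM] at hs ⊢; exact comp_step hs e htT)
    · right
      by_contra hn
      exact htT (by simpa [hT, ht] using hn)
  have hpM : p ∉ M := fun h => by have := hMT h; simp [hT] at this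
  have hqM : q ∉ M := fun h => by have := hMT h; simp [hT] at this
  have huM : u ∉ M := fun h => by have := hMT h; simp [hT] at this
  have hvM : v ∉ M := fun h => by have := hMT h; simp [hT] at this
  have tpM : Touch G {p} M := ⟨p, rfl, m, hmM, epm⟩
  -- The component `M` does not contain `r`.
  have hrM : r ∉ M := by
    intro hrM
    have hK : Touch G M {v, u} := by
      by_contra hno
      refine h.no_attached_edge h.irred (K := S \ (M ∪ {p, q})) Set.sdiff_subset
        ⟨v, hv.1, by simp [hvM, hpv.symm, hvq]⟩ (by simp) (by simp) (by simp [hrM]) h.hp h.hq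
        h.epq (by simp) (by simp) ?_
      intro s hs t ht e
      by_contra hcon
      push Not at hcon
      have htM : t ∈ M := by
        by_contra htM
        exact hcon.1 ⟨ht, by simp [htM, hcon.2]⟩
      have hs2 : s ≠ p ∧ s ≠ q ∧ s ∉ M := by simpa [not_or] using hs.2
      rcases hstep t htM s hs.1 e.symm with h | h | h | h | h
      · exact hs2.2.2 h
      · exact hs2.1 h
      · exact hs2.2.1 h
      · exact hno ⟨t, htM, s, .inr h, e.symm⟩
      · exact hno ⟨t, htM, s, .inl h, e.symm⟩
    refine h.disc.not_rooted_K4 (X₁ := {q}) (X₂ := {p}) (X₃ := M) (X₄ := {v, u})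
      ⟨by simpa using h.hq.1, by simpa using h.hp.1, hMS,
        by rintro s (rfl | rfl); exacts [hv.1, hu]⟩ (connSet_singleton _) (connSet_singleton _)
      hMc (connSet_pair evu) ?_ ?_
      ⟨⟨q, rfl, h.hq.2⟩, ⟨p, rfl, h.hp.2⟩, ⟨r, hrM, h.hr.2⟩, ⟨v, by simp, hv.2⟩⟩
    · simp [hpM, hqM, hvM, huM, hpq.symm, hvq.symm, hqu, hpu, hpv, Set.disjoint_insert_right]
    · simp only [List.pairwise_cons, List.mem_cons, List.not_mem_nil, or_false, forall_eq_or_imp,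
        forall_eq, List.Pairwise.nil, and_true, implies_true, IsEmpty.forall_iff]
      exact ⟨⟨⟨q, rfl, p, rfl, h.epq.symm⟩, ⟨q, rfl, r, hrM, h.eqr⟩, ⟨q, rfl, u, by simp, equ⟩⟩,
        ⟨tpM, ⟨p, rfl, v, by simp, epv⟩⟩, hK⟩
  -- It has no boundary vertices, so it lies inside the 4-cycle.
  have hMO : ∀ x ∈ M, x ∉ O := by
    intro x hxM hxO
    have tuM : ¬ Touch G {u} M := fun t => by
      refine h.disc.not_rooted_K23 (X₁ := {p}) (X₂ := {u}) (Y₁ := {q}) (Y₂ := {v}) (Y₃ := M)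
        ⟨by simpa using h.hp.1, by simpa using hu, by simpa using h.hq.1, by simpa using hv.1, hMS⟩
        (connSet_singleton _) (connSet_singleton _) (connSet_singleton _) (connSet_singleton _) hMc
        ?_ ⟨⟨p, rfl, q, rfl, h.epq⟩, ⟨p, rfl, v, rfl, epv⟩, tpM⟩
        ⟨⟨u, rfl, q, rfl, equ.symm⟩, ⟨u, rfl, v, rfl, evu.symm⟩, t⟩ ⟨q, rfl, h.hq.2⟩
        ⟨v, rfl, hv.2⟩ ⟨x, hxM, hxO⟩
      simp [hpM, hqM, hvM, huM, hpq, hvq.symm, hqu.symm, hpu, hpv, hvu.symm]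
    have hstep' : ∀ s ∈ M, ∀ t ∈ S, G.Adj s t → t ∈ M ∨ t = p ∨ t = q ∨ t = v := by
      intro s hs t ht e
      rcases hstep s hs t ht e with h | h | h | h | h
      · exact .inl h
      · exact .inr (.inl h)
      · exact .inr (.inr (.inl h))
      · exact absurd ⟨t, h, s, hs, e.symm⟩ tuM
      · exact .inr (.inr (.inr h))
    by_cases tqM : Touch G {q} M
    · by_cases tvM : Touch G {v, u} M
      · refine h.disc.not_rooted_K4 (X₁ := {q}) (X₂ := {p}) (X₃ := M) (X₄ := {v, u})
          ⟨by simpa using h.hq.1, by simpa using h.hp.1, hMS,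
            by rintro s (rfl | rfl); exacts [hv.1, hu]⟩ (connSet_singleton _)
          (connSet_singleton _) hMc (connSet_pair evu) ?_ ?_
          ⟨⟨q, rfl, h.hq.2⟩, ⟨p, rfl, h.hp.2⟩, ⟨x, hxM, hxO⟩, ⟨v, by simp, hv.2⟩⟩
        · simp [hpM, hqM, hvM, huM, hpq.symm, hvq.symm, hqu, hpu, hpv, Set.disjoint_insert_right]
        · simp only [List.pairwise_cons, List.mem_cons, List.not_mem_nil, or_false,
            forall_eq_or_imp, forall_eq, List.Pairwise.nil, and_true, implies_true,
            IsEmpty.forall_iff]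
          exact ⟨⟨⟨q, rfl, p, rfl, h.epq.symm⟩, tqM, ⟨q, rfl, u, by simp, equ⟩⟩,
            ⟨tpM, ⟨p, rfl, v, by simp, epv⟩⟩, tvM.symm⟩
      · refine h.no_attached_edge h.irred hMS ⟨m, hmM⟩ hpM hqM hrM h.hp h.hq h.epq hpM hqM ?_
        intro s hs t ht e
        rcases hstep' s hs t ht e with h | h | h | h
        · exact .inl h
        · exact .inr (.inl h)
        · exact .inr (.inr h)
        · exact absurd ⟨t, .inl h, s, hs, e.symm⟩ tvM
    · refine h.no_attached_edge h.irred hMS ⟨m, hmM⟩ hpM hqM hrM h.hp hv epv hpM hvM ?_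
      intro s hs t ht e
      rcases hstep' s hs t ht e with h | h | h | h
      · exact .inl h
      · exact .inr (.inl h)
      · exact absurd ⟨t, h, s, hs, e.symm⟩ tqM
      · exact .inr (.inr h)
  refine h.no_attached_square h.irred hMS ⟨m, hmM⟩ hMO hpM hqM hrM (x := q) (y := p) (z := v)
    (w := u) ⟨h.hq.1, hqM⟩ ⟨h.hp.1, hpM⟩ ⟨hv.1, hvM⟩ ⟨hu, huM⟩ h.epq.symm epv evu equ.symm
    hvq.symm hpu ?_
  intro s hs t ht e
  rcases hstep s hs t ht e with h | h | h | h | h <;> simp [h]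

/-- In this situation, if some colouring is bad, then `p` is adjacent to `u`: otherwise `p` and `v` can
be deleted, reserving two colours for `v`, and Thomassen's theorem applies to the edge `qr`. -/
theorem Tight.adj_of_common_nbr (h : Tight G S O L p q r) (hbad : Bad G S L p q r a c b) {u v : V}
    (hv : v ∈ S ∩ O) (epv : G.Adj p v) (hvq : v ≠ q) (hu : u ∈ S) (huO : u ∉ O) (equ : G.Adj q u)
    (evu : G.Adj v u) : G.Adj p u := by
  classical
  by_contra hcon
  obtain ⟨w, hw⟩ := h.exists_second_nbr hv epv hvq
  have hN := h.nbrs_of_common_nbr hv epv hvq hu huO equ evu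
  have hvr : v ≠ r := by rintro rfl; exact h.npr epv
  have hvX : v ∉ ({p, q, r} : Set V) := by simp [epv.ne', hvq, hvr]
  have h3 := (h.lists v hv.1 hvX).1 hv.2
  obtain ⟨R, hRL, hR⟩ := Finset.exists_subset_card_eq (s := (L v).erase a) (n := 2) (by
    have := Finset.pred_card_le_card_erase (s := L v) (a := a)
    omega)
  obtain ⟨φ, hφ, hφq, hφr⟩ := thomassen_edge
    ((h.disc.delete hv.1 hv.2).mono (S' := (S \ {v}) \ {p}) Set.sdiff_subset subset_rfl)
    (x := q) (y := r)
    ⟨⟨⟨h.hq.1, hvq.symm⟩, h.epq.ne'⟩, .inl h.hq.2⟩ ⟨⟨⟨h.hr.1, hvr.symm⟩, h.hpr.symm⟩, .inl h.hr.2⟩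
    h.eqr hbad.2.1 (L := dropList O {z | G.Adj v z} R L)
    (h.lists.drop hR.le (Set.sdiff_subset.trans Set.sdiff_subset)
      fun s hs hs' hs'' => by
        rcases hs'' with h | h
        exacts [hs.2 h, hs' h])
  have hqv : ¬ G.Adj q v := fun e => by
    rcases h.nchord v hv e with h | h
    exacts [epv.ne' h, hvr h]
  have c1 : IsColOn G (S \ {v}) {p, q, r} L (Function.update φ p a) :=
    IsColOn.update (hφ.mono_lists subset_rfl (fun _ _ h => h)
      fun z _ _ hz => dropList_subset z hz) (fun s _ hs _ hs' => hs (.inr hs'))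
      (fun h => absurd (.inl rfl) h) fun s hs eps => by
        rcases hN s hs.1 eps with rfl | rfl | rfl
        · rw [hφq]; exact hbad.1.symm
        · exact absurd eps hcon
        · exact absurd rfl hs.2
  obtain ⟨κ, hκR, hκ⟩ := exists_mem_ne_of_two_le hR.ge (φ w)
  have hκL := Finset.mem_of_mem_erase (hRL hκR)
  have hκa := Finset.ne_of_mem_erase (hRL hκR)
  refine hbad.2.2 ⟨Function.update (Function.update φ p a) v κ, IsColOn.update c1
    (fun _ _ h _ => h) (fun _ => hκL) ?_, ?_, ?_, ?_⟩
  · intro s hs evs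
    by_cases hsp : s = p
    · subst hsp
      rw [Function.update_self]
      exact hκa.symm
    rw [Function.update_of_ne hsp]
    by_cases hsO : s ∈ O
    · rcases hw s ⟨hs, hsO⟩ evs with h | h
      · exact absurd h hsp
      · rw [h]; exact hκ.symm
    · intro hsκ
      have := hφ.mem s ⟨⟨hs, evs.ne'⟩, hsp⟩ (by
        rintro (rfl | rfl)
        exacts [hsO h.hq.2, hsO h.hr.2])
      rw [hsκ] at this
      exact notMem_of_mem_dropList this hsO evs hκR
  · rw [Function.update_of_ne epv.ne, Function.update_self]
  · rw [Function.update_of_ne hvq.symm, Function.update_of_ne h.epq.ne', hφq]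
  · rw [Function.update_of_ne hvr.symm, Function.update_of_ne h.hpr.symm, hφr]

end Tight

/-! ### A common neighbour of the path -/

/-- Some edge or vertex cuts off the path: an edge joining its ends, a boundary chord at `q`, or a
common neighbour of its three vertices inside. -/
def Hub {V : Type*} (G : SimpleGraph V) (S O : Set V) (p q r : V) : Prop :=
  G.Adj p r ∨ (∃ u ∈ S ∩ O, G.Adj q u ∧ u ≠ p ∧ u ≠ r) ∨
    ∃ h ∈ S, h ∉ O ∧ G.Adj h p ∧ G.Adj h q ∧ G.Adj h r

/-- A tight rainbow whose vertex `p` has just three neighbours: `q`, a boundary vertex `v` and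
an inner vertex `u` adjacent to both. -/
structure Corner {V : Type*} (G : SimpleGraph V) (S O : Set V) (L : V → Finset ℕ)
    (p q r u v : V) : Prop extends Tight G S O L p q r where
  hv : v ∈ S ∩ O
  epv : G.Adj p v
  hvq : v ≠ q
  hu : u ∈ S
  huO : u ∉ O
  equ : G.Adj q u
  evu : G.Adj v u
  epu : G.Adj p u
  nbrs : ∀ m ∈ S, G.Adj p m → m = q ∨ m = u ∨ m = v

/-- A corner together with an inner vertex `z` adjacent to `u`, `q` and `r`. -/
structure Kite {V : Type*} (G : SimpleGraph V) (S O : Set V) (L : V → Finset ℕ)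
    (p q r u v z : V) : Prop extends Corner G S O L p q r u v where
  hz : z ∈ S
  hzO : z ∉ O
  ezu : G.Adj z u
  eqz : G.Adj q z
  ezr : G.Adj z r
  nur : ¬ G.Adj u r

section Hub

variable {V : Type*} {G : SimpleGraph V} {S O : Set V} {L : V → Finset ℕ}
  {p q r u v z : V} {a b c : ℕ}

theorem ListsOK.mono {S' X X' O' : Set V} (h : ListsOK S X O L) (hS : S' ⊆ S)
    (hX : ∀ x ∈ S', x ∉ X' → x ∉ X) (hO : O ⊆ O') : ListsOK S' X' O' L := by
  intro x hx hxX
  obtain ⟨h3, h5⟩ := h x (hS hx) (hX x hx hxX)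
  refine ⟨fun _ => ?_, fun hn => h5 fun h => hn (hO h)⟩
  by_cases hxO : x ∈ O
  · exact h3 hxO
  · exact le_trans (by norm_num) (h5 hxO)

open Classical in
theorem ListsOK.update {X : Set V} (h : ListsOK S X O L) (hv : v ∈ O) {A : Finset ℕ}
    (hA : 3 ≤ A.card) : ListsOK S X O (Function.update L v A) := by
  intro x hx hxX
  by_cases hxv : x = v
  · subst hxv
    rw [Function.update_self]
    exact ⟨fun _ => hA, fun hn => absurd hv hn⟩
  · rw [Function.update_of_ne hxv]
    exact h x hx hxX

theorem Tight.ne_of_nbr (h : Tight G S O L p q r) (epv : G.Adj p v) : v ≠ r := by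
  rintro rfl
  exact h.npr epv

theorem Tight.not_adj_of_nbr (h : Tight G S O L p q r) (hv : v ∈ S ∩ O) (epv : G.Adj p v) :
    ¬ G.Adj q v := fun e => by
  rcases h.nchord v hv e with h' | h'
  exacts [epv.ne' h', h.ne_of_nbr epv h']

theorem Corner.pu (h : Corner G S O L p q r u v) : p ≠ u := h.epu.ne
theorem Corner.ru (h : Corner G S O L p q r u v) : r ≠ u := by
  rintro rfl; exact h.huO h.hr.2
theorem Corner.rv (h : Corner G S O L p q r u v) : r ≠ v := (h.ne_of_nbr h.epv).symm

theorem Corner.toRainbow_delete (h : Corner G S O L p q r u v) {L' : V → Finset ℕ}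
    (hL : ListsOK S {p, q, r} O L') : Rainbow G (S \ {p}) (insert u O) L' u q r where
  disc := (h.disc.delete h.hp.1 h.hp.2).mono subset_rfl (by
    rintro x (rfl | hx)
    exacts [.inr h.epu, .inl hx])
  hp := ⟨⟨h.hu, h.pu.symm⟩, .inl rfl⟩
  hq := ⟨⟨h.hq.1, h.epq.ne'⟩, .inr h.hq.2⟩
  hr := ⟨⟨h.hr.1, h.hpr.symm⟩, .inr h.hr.2⟩
  epq := h.equ.symm
  eqr := h.eqr
  hpr := h.ru.symm
  lists := hL.mono Set.sdiff_subset (by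
    rintro x hx hxX (h | h | h)
    exacts [hx.2 h, hxX (by simp [h]), hxX (by simp [h])]) (Set.subset_insert _ _)

theorem Kite.toRainbow_delete (h : Kite G S O L p q r u v z) {L' : V → Finset ℕ}
    (hL : ListsOK S {p, q, r} O L') :
    Rainbow G ((S \ {p}) \ {q}) (insert z (insert u O)) L' u z r where
  disc := ((h.disc.delete h.hp.1 h.hp.2).delete (v := q) ⟨h.hq.1, h.epq.ne'⟩ (.inl h.hq.2)).mono
    subset_rfl (by
    rintro x (rfl | rfl | hx)
    exacts [.inr h.eqz, .inl (.inr h.epu), .inl (.inl hx)])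
  hp := ⟨⟨⟨h.hu, h.pu.symm⟩, h.equ.ne'⟩, by simp⟩
  hq := ⟨⟨⟨h.hz, by rintro rfl; exact h.hzO h.hp.2⟩, h.eqz.ne'⟩, by simp⟩
  hr := ⟨⟨⟨h.hr.1, h.hpr.symm⟩, h.eqr.ne'⟩, by simp [h.hr.2]⟩
  epq := h.ezu.symm
  eqr := h.ezr
  hpr := h.ru.symm
  lists := hL.mono (Set.sdiff_subset.trans Set.sdiff_subset) (by
    rintro x hx hxX (h | h | h)
    exacts [hx.1.2 h, hx.2 h, hxX (by simp [h])])
    ((Set.subset_insert _ _).trans (Set.subset_insert _ _))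

open Classical in
/-- A bad colouring of the path gives bad colourings `e`, `c`, `b` of `u`, `q`, `r` after the
deletion of `p`, if `v` keeps two colours besides `e`. -/
theorem Corner.bad_delete (h : Corner G S O L p q r u v) (hbad : Bad G S L p q r a c b)
    {R : Finset ℕ} (hRL : R ⊆ (L v).erase a) {e : ℕ} (he : e ∈ L u) (hea : e ≠ a) (hec : e ≠ c) :
    Bad G (S \ {p}) (Function.update L v (insert e R)) u q r e c b := by
  refine ⟨hec, hbad.2.1, ?_⟩
  rintro ⟨φ, hφ, hu, hq, hr⟩
  have hvR : φ v ∈ R := by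
    have := hφ.mem v ⟨h.hv.1, h.epv.ne'⟩ (by simp [h.evu.ne, h.hvq, h.rv.symm])
    rw [Function.update_self, Finset.mem_insert] at this
    refine this.resolve_left fun h' => ?_
    exact hφ.proper v ⟨h.hv.1, h.epv.ne'⟩ u ⟨h.hu, h.pu.symm⟩ h.evu (h'.trans hu.symm)
  have c1 : IsColOn G (S \ {p}) {q, r} L φ := ⟨hφ.proper, fun x hx hxX => by
    by_cases hxv : x = v
    · rw [hxv]; exact Finset.mem_of_mem_erase (hRL hvR)
    by_cases hxu : x = u
    · rw [hxu, hu]; exact he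
    have := hφ.mem x hx (by
      rintro (h | h)
      exacts [hxu h, hxX h])
    rwa [Function.update_of_ne hxv] at this⟩
  refine hbad.2.2 ⟨Function.update φ p a, IsColOn.update c1 (fun s _ hs _ hs' => hs (.inr hs'))
    (fun h => absurd (.inl rfl) h) ?_, by simp, ?_, ?_⟩
  · intro s hs eps
    rcases h.nbrs s hs eps with rfl | rfl | rfl
    · rw [hq]; exact hbad.1.symm
    · rw [hu]; exact hea
    · exact Finset.ne_of_mem_erase (hRL hvR)
  · rw [Function.update_of_ne h.epq.ne', hq]
  · rw [Function.update_of_ne h.hpr.symm, hr]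

variable [Finite V]

/-- Deleting the boundary neighbour of `p` while reserving two colours for it. -/
theorem Tight.bad_delete_nbr (h : Tight G S O L p q r) (hbad : Bad G S L p q r a c b)
    (hv : v ∈ S ∩ O) (epv : G.Adj p v) (hvq : v ≠ q) {R : Finset ℕ} (hRL : R ⊆ (L v).erase a)
    (hR : R.card = 2) :
    Rainbow G (S \ {v}) (O ∪ {x | G.Adj v x}) (dropList O {x | G.Adj v x} R L) p q r ∧
      Bad G (S \ {v}) (dropList O {x | G.Adj v x} R L) p q r a c b := by
  classical
  obtain ⟨w, hw⟩ := h.exists_second_nbr hv epv hvq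
  have hvr := h.ne_of_nbr epv
  refine ⟨⟨h.disc.delete hv.1 hv.2, ⟨⟨h.hp.1, epv.ne⟩, .inl h.hp.2⟩,
    ⟨⟨h.hq.1, hvq.symm⟩, .inl h.hq.2⟩, ⟨⟨h.hr.1, hvr.symm⟩, .inl h.hr.2⟩, h.epq, h.eqr, h.hpr,
    h.lists.drop hR.le Set.sdiff_subset fun _ _ hs => hs⟩, hbad.1, hbad.2.1, ?_⟩
  rintro ⟨φ, hφ, hp, hq, hr⟩
  obtain ⟨κ, hκR, hκ⟩ := exists_mem_ne_of_two_le hR.ge (φ w)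
  have hκL := Finset.mem_of_mem_erase (hRL hκR)
  have hκa := Finset.ne_of_mem_erase (hRL hκR)
  refine hbad.2.2 ⟨Function.update φ v κ, IsColOn.update (hφ.mono_lists subset_rfl
      (fun _ _ h => h) fun z _ _ hz => dropList_subset z hz)
    (fun _ _ h _ => h) (fun _ => hκL) ?_, ?_, ?_, ?_⟩
  · intro s hs evs
    by_cases hsO : s ∈ O
    · rcases hw s ⟨hs, hsO⟩ evs with rfl | rfl
      · rw [hp]; exact hκa.symm
      · exact hκ.symm
    · intro hsκ
      have := hφ.mem s ⟨hs, evs.ne'⟩ (by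
        rintro (rfl | rfl | rfl)
        exacts [hsO h.hp.2, hsO h.hq.2, hsO h.hr.2])
      rw [hsκ] at this
      exact notMem_of_mem_dropList this hsO evs hκR
  · rw [Function.update_of_ne epv.ne, hp]
  · rw [Function.update_of_ne hvq.symm, hq]
  · rw [Function.update_of_ne hvr.symm, hr]

/-- The vertex `q` of a kite has no further neighbours: the component `M` of one would lie inside
the 4-cycle `q u z r` or be attached along the edge `qr`. -/
theorem Kite.nbrs_mid (h : Kite G S O L p q r u v z) :
    ∀ m ∈ S, G.Adj q m → m = p ∨ m = u ∨ m = z ∨ m = r := by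
  intro m hm eqm
  by_contra hcon
  push Not at hcon
  have hpu := h.pu
  have hru := h.ru
  have hqu := h.equ.ne
  have hpq := h.epq.ne
  have hpr := h.hpr
  have hqr := h.eqr.ne
  have hqz := h.eqz.ne
  have hzu := h.ezu.ne
  have hzr := h.ezr.ne
  have hpz : p ≠ z := by rintro rfl; exact h.hzO h.hp.2
  have hmv : m ≠ v := by rintro rfl; exact h.not_adj_of_nbr h.hv h.epv eqm
  obtain ⟨T, hT⟩ : ∃ T : Set V, T = S \ {p, q, u, z, r} := ⟨_, rfl⟩
  have hmT : m ∈ T := by simp [hT, hm, hcon, eqm.ne']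
  obtain ⟨M, hM⟩ : ∃ M : Set V, M = comp G T m := ⟨_, rfl⟩
  have hMT : M ⊆ T := hM ▸ comp_subset hmT
  have hMc : ConnSet G M := hM ▸ connSet_comp
  have hmM : m ∈ M := hM ▸ mem_comp_self
  have hMS : M ⊆ S := hMT.trans (hT ▸ Set.sdiff_subset)
  have hstep : ∀ s ∈ M, ∀ t ∈ S, G.Adj s t →
      t ∈ M ∨ t = p ∨ t = q ∨ t = u ∨ t = z ∨ t = r := by
    intro s hs t ht e
    by_cases htT : t ∈ T
    · exact .inl (by rw [hM] at hs ⊢; exact comp_step hs e htT)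
    · right
      by_contra hn
      exact htT (by simpa [hT, ht] using hn)
  have hpM : p ∉ M := fun h => by have := hMT h; simp [hT] at this
  have hqM : q ∉ M := fun h => by have := hMT h; simp [hT] at this
  have huM : u ∉ M := fun h => by have := hMT h; simp [hT] at this
  have hzM : z ∉ M := fun h => by have := hMT h; simp [hT] at this
  have hrM : r ∉ M := fun h => by have := hMT h; simp [hT] at this
  have tqM : Touch G {q} M := ⟨q, rfl, m, hmM, eqm⟩
  have pM : v ∉ M → ∀ s ∈ M, ¬ G.Adj s p := by
    intro hv s hs e
    rcases h.nbrs s (hMS hs) e.symm with rfl | rfl | rfl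
    exacts [hqM hs, huM hs, hv hs]
  by_cases hMO : ∀ x ∈ M, x ∉ O
  · refine h.no_attached_square h.irred hMS ⟨m, hmM⟩ hMO hpM hqM hrM (x := q) (y := u) (z := z)
      (w := r) ⟨h.hq.1, hqM⟩ ⟨h.hu, huM⟩ ⟨h.hz, hzM⟩ ⟨h.hr.1, hrM⟩ h.equ h.ezu.symm h.ezr
      h.eqr.symm hqz hru.symm fun s hs t ht e => ?_
    rcases hstep s hs t ht e with h' | h' | h'
    · exact .inl h'
    · exact absurd (h' ▸ e) (pM (fun hv => hMO v hv h.hv.2) s hs)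
    · exact .inr h'
  push Not at hMO
  obtain ⟨x, hxM, hxO⟩ := hMO
  have tuM : ¬ Touch G {u} M := fun t => by
    refine h.disc.not_rooted_K23 (X₁ := {q}) (X₂ := {u}) (Y₁ := M) (Y₂ := {p}) (Y₃ := {z, r})
      ⟨by simpa using h.hq.1, by simpa using h.hu, hMS, by simpa using h.hp.1,
        by rintro s (rfl | rfl); exacts [h.hz, h.hr.1]⟩
      (connSet_singleton _) (connSet_singleton _) hMc (connSet_singleton _) (connSet_pair h.ezr)
      ?_ ⟨tqM, ⟨q, rfl, p, rfl, h.epq.symm⟩, ⟨q, rfl, r, by simp, h.eqr⟩⟩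
      ⟨t, ⟨u, rfl, p, rfl, h.epu.symm⟩, ⟨u, rfl, z, by simp, h.ezu.symm⟩⟩ ⟨x, hxM, hxO⟩
      ⟨p, rfl, h.hp.2⟩ ⟨r, by simp, h.hr.2⟩
    simp [hpM, hqM, huM, hzM, hrM, hpu.symm, hru.symm, hqu, hpq.symm, hpr, hqr, hqz,
      hzu.symm, hpz, Set.disjoint_insert_right]
  have hvM : v ∉ M := fun hv => tuM ⟨u, rfl, v, hv, h.evu.symm⟩
  have tzM : ¬ Touch G {z} M := fun t => by
    refine h.disc.not_rooted_K23 (X₁ := {q}) (X₂ := {z}) (Y₁ := M) (Y₂ := {r}) (Y₃ := {u, p})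
      ⟨by simpa using h.hq.1, by simpa using h.hz, hMS, by simpa using h.hr.1,
        by rintro s (rfl | rfl); exacts [h.hu, h.hp.1]⟩
      (connSet_singleton _) (connSet_singleton _) hMc (connSet_singleton _)
      (connSet_pair h.epu.symm)
      ?_ ⟨tqM, ⟨q, rfl, r, rfl, h.eqr⟩, ⟨q, rfl, p, by simp, h.epq.symm⟩⟩
      ⟨t, ⟨z, rfl, r, rfl, h.ezr⟩, ⟨z, rfl, u, by simp, h.ezu⟩⟩ ⟨x, hxM, hxO⟩
      ⟨r, rfl, h.hr.2⟩ ⟨p, by simp, h.hp.2⟩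
    simp [hpM, hqM, huM, hzM, hrM, hru, hqu, hpq.symm, hpr.symm, hqr, hqz, hzr,
      hzu, hpz.symm, Set.disjoint_insert_right]
  refine h.no_attached_edge h.irred hMS ⟨m, hmM⟩ hpM hqM hrM h.hq h.hr h.eqr hqM hrM
    fun s hs t ht e => ?_
  rcases hstep s hs t ht e with h' | h' | h' | h' | h' | h'
  · exact .inl h'
  · exact absurd (h' ▸ e) (pM hvM s hs)
  · exact .inr (.inl h')
  · exact absurd ⟨t, h', s, hs, e.symm⟩ tuM
  · exact absurd ⟨t, h', s, hs, e.symm⟩ tzM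
  · exact .inr (.inr h')

open Classical in
/-- Deleting `p` and `q` of a kite: all but three colours of `z` give bad colourings. -/
theorem Kite.bad_delete_two (h : Kite G S O L p q r u v z) (hbad : Bad G S L p q r a c b)
    {R : Finset ℕ} (hRL : R ⊆ (L v).erase a) {e : ℕ} (he : e ∈ L u) (hea : e ≠ a) (hec : e ≠ c)
    {σ : ℕ} (hσ : σ ∈ L z) (hσe : σ ≠ e) (hσc : σ ≠ c) (hσb : σ ≠ b) :
    Bad G ((S \ {p}) \ {q}) (Function.update L v (insert e R)) u z r e σ b := by
  refine ⟨hσe.symm, hσb, ?_⟩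
  rintro ⟨φ, hφ, hu, hz, hr⟩
  have hzv : z ≠ v := by rintro rfl; exact h.hzO h.hv.2
  refine (h.bad_delete hbad hRL he hea hec).2.2 ⟨Function.update φ q c, IsColOn.update (X := {u, r})
    ⟨hφ.proper, fun x hx hxX => ?_⟩ (fun s _ hs _ hs' => hs ?_) (fun h => absurd (by simp) h) ?_,
    ?_, by simp, ?_⟩
  · by_cases hxz : x = z
    · rw [hxz, hz, Function.update_of_ne hzv]; exact hσ
    · exact hφ.mem x hx (by
        rintro (h | h | h)
        exacts [hxX (.inl h), hxz h, hxX (.inr h)])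
  · rcases hs' with h | h
    exacts [.inl h, .inr (.inr h)]
  · intro s hs eqs
    rcases h.nbrs_mid s hs.1 eqs with rfl | rfl | rfl | rfl
    · exact absurd rfl hs.2
    · rw [hu]; exact hec
    · rw [hz]; exact hσc
    · rw [hr]; exact hbad.2.1.symm
  · rw [Function.update_of_ne h.equ.ne', hu]
  · rw [Function.update_of_ne h.eqr.ne', hr]

/-- A bad colouring does not extend from `p`, `q`, `r` to any colouring of the other vertices. -/
theorem Kite.not_extend (h : Kite G S O L p q r u v z) (hbad : Bad G S L p q r a c b)
    {φ : V → ℕ} (hφ : IsColOn G ((S \ {p}) \ {q}) {r} L φ) (hr : φ r = b) (hua : φ u ≠ a)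
    (huc : φ u ≠ c) (hva : φ v ≠ a) (hzc : φ z ≠ c) : False := by
  classical
  have c1 : IsColOn G (S \ {p}) {q, r} L (Function.update φ q c) :=
    IsColOn.update hφ (fun s _ hs _ hs' => hs (.inr hs')) (fun h => absurd (.inl rfl) h) (by
    intro s hs eqs
    rcases h.nbrs_mid s hs.1 eqs with rfl | rfl | rfl | rfl
    · exact absurd rfl hs.2
    · exact huc
    · exact hzc
    · rw [hr]; exact hbad.2.1.symm)
  refine hbad.2.2 ⟨Function.update (Function.update φ q c) p a, IsColOn.update c1
    (fun s _ hs _ hs' => hs (.inr hs')) (fun h => absurd (.inl rfl) h) ?_, by simp, ?_, ?_⟩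
  · intro s hs eps
    rcases h.nbrs s hs eps with rfl | rfl | rfl
    · rw [Function.update_self]; exact hbad.1.symm
    · rw [Function.update_of_ne h.equ.ne']; exact hua
    · rw [Function.update_of_ne h.hvq]; exact hva
  · rw [Function.update_of_ne h.epq.ne', Function.update_self]
  · rw [Function.update_of_ne h.hpr.symm, Function.update_of_ne h.eqr.ne', hr]

end Hub

/-! ### The types of the set of bad colourings -/

/-- At most one colouring of the path is bad. -/
def UniqueBad {V : Type*} (G : SimpleGraph V) (S : Set V) (L : V → Finset ℕ) (p q r : V) : Prop :=
  ∃ a₀ c₀ b₀, ∀ a c b, Bad G S L p q r a c b → a = a₀ ∧ c = c₀ ∧ b = b₀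

/-- The bad colourings of a fan with an even number of triangles. -/
def EvenType {V : Type*} (G : SimpleGraph V) (S : Set V) (L : V → Finset ℕ) (p q r : V) : Prop :=
  ∃ T : Finset ℕ, T.card = 3 ∧ ∀ a c b, Bad G S L p q r a c b → a ∈ T ∧ c ∈ T ∧ b ∈ T ∧ a ≠ b

/-- The bad colourings of a fan with an odd number of triangles. -/
def OddType {V : Type*} (G : SimpleGraph V) (S : Set V) (L : V → Finset ℕ) (p q r : V) : Prop :=
  (∃ T : Finset ℕ, T.card = 3 ∧ ∀ a c b, Bad G S L p q r a c b → a = b ∧ a ∈ T ∧ c ∈ T) ∨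
    ∃ a₀ b₀ c₁ c₂, a₀ ≠ b₀ ∧ ∀ a c b, Bad G S L p q r a c b → a = a₀ ∧ b = b₀ ∧ (c = c₁ ∨ c = c₂)

/-- A path of boundary vertices all adjacent to `q`. -/
def IsFan {V : Type*} {G : SimpleGraph V} (S O : Set V) (q : V) {p r : V} (Q : G.Walk p r) : Prop :=
  Q.IsPath ∧ ∀ x ∈ Q.support, x ∈ S ∩ O ∧ G.Adj q x

/-- Either at most one colouring is bad, or there is a fan and the bad colourings are restricted
according to the parity of its length. -/
def Dichotomy {V : Type*} (G : SimpleGraph V) (S O : Set V) (L : V → Finset ℕ) (p q r : V) : Prop :=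
  UniqueBad G S L p q r ∨ ∃ Q : G.Walk p r, IsFan S O q Q ∧
    ((Even Q.length ∧ EvenType G S L p q r) ∨ (Odd Q.length ∧ OddType G S L p q r))

section Types

variable {V : Type*} {G : SimpleGraph V} {S O : Set V} {L : V → Finset ℕ}
  {p q r u v z : V} {a b c : ℕ}

theorem mem_comp_of_walk {T : Set V} {x y : V} (Q : G.Walk x y) (h : ∀ s ∈ Q.support, s ∈ T) :
    x ∈ comp G T y := by
  induction Q with
  | nil => exact mem_comp_self
  | cons e Q ih =>
    exact comp_step (ih fun s hs => h s (by simp [hs])) e.symm (h _ (by simp))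

theorem Rainbow.fan_split (h : Rainbow G S O L p q r) (npr : ¬ G.Adj p r) {Q : G.Walk p r}
    (hQ : IsFan S O q Q) : ∃ y ∈ S ∩ O, G.Adj q y ∧ G.Adj p y ∧ y ≠ r ∧
      p ∉ comp G (S \ {q, y}) r ∧ ∃ x ∈ comp G (S \ {q, y}) r, G.Adj y x := by
  obtain ⟨hp, hs⟩ := hQ
  cases Q with
  | nil => exact absurd rfl h.hpr
  | @cons _ y _ epy Q =>
    cases Q with
    | nil => exact absurd epy npr
    | @cons _ x _ eyx Q =>
      rw [SimpleGraph.Walk.cons_isPath_iff, SimpleGraph.Walk.cons_isPath_iff] at hp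
      obtain ⟨⟨-, hyQ⟩, hpQ⟩ := hp
      simp only [SimpleGraph.Walk.support_cons, List.mem_cons, not_or] at hpQ hs
      obtain ⟨hy, eqy⟩ := hs y (by simp)
      have hyr : y ≠ r := by rintro rfl; exact npr epy
      have hxT : ∀ T : Set V, (∀ s ∈ Q.support, s ∈ T) → x ∈ comp G T r := fun T hT =>
        mem_comp_of_walk Q hT
      have hT : ∀ s ∈ Q.support, s ∈ S \ {q, y} := fun s hsQ =>
        ⟨(hs s (by simp [hsQ])).1.1, by
          rintro (rfl | rfl)
          exacts [G.irrefl (hs s (by simp [hsQ])).2, hyQ hsQ]⟩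
      refine ⟨y, hy, eqy, epy, hyr, ?_, x, hxT _ hT, eyx⟩
      intro hpK
      rcases h.disc.exists_separator h.hq h.hp hy h.hr h.epq.symm eqy h.eqr epy.ne hyr
        h.hpr.symm with h1 | h1 | h1
      · exact h1 (comp_step mem_comp_self epy ⟨hy.1, by simp [eqy.ne', hyr]⟩)
      · refine h1 (comp_symm (T := S \ {q, p}) ⟨h.hr.1, by simp [h.eqr.ne', h.hpr.symm]⟩ ?_)
        refine comp_step (hxT _ fun s hsQ => ⟨(hT s hsQ).1, ?_⟩) eyx.symm
          ⟨hy.1, by simp [eqy.ne', epy.ne']⟩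
        rintro (rfl | rfl)
        exacts [(hT s hsQ).2 (by simp), hpQ.2 hsQ]
      · exact h1 hpK

end Types

section Kite

variable {V : Type*} {G : SimpleGraph V} {S O : Set V} {L : V → Finset ℕ}
  {p q r u v z : V} {a b c : ℕ}

variable [Finite V]

open Classical in
/-- A kite with a bad colouring has a further triangle `u`, `z`, `y` whose edge `zy` separates `u`
from `r`, by induction applied to the rainbow without `p` and `q`. -/
theorem Kite.exists_third (h : Kite G S O L p q r u v z) (hbad : Bad G S L p q r a c b)
    (IH : ∀ S' < S, ∀ (O' : Set V) (L' : V → Finset ℕ) (p' q' r' : V),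
      Rainbow G S' O' L' p' q' r' → ¬ G.Adj p' r' → Dichotomy G S' O' L' p' q' r')
    {R : Finset ℕ} (hRL : R ⊆ (L v).erase a) (hR : R.card = 2) {e : ℕ} (he : e ∈ L u)
    (hea : e ≠ a) (hec : e ≠ c) (heR : e ∉ R) :
    ∃ y ∈ S ∩ O, G.Adj z y ∧ G.Adj u y ∧ y ≠ r ∧ y ≠ q ∧ y ≠ p ∧
      u ∉ comp G (((S \ {p}) \ {q}) \ {z, y}) r ∧
      ∃ x ∈ comp G (((S \ {p}) \ {q}) \ {z, y}) r, G.Adj y x := by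
  have hL : ListsOK S {p, q, r} O (Function.update L v (insert e R)) :=
    h.lists.update h.hv.2 (by rw [Finset.card_insert_of_notMem heR, hR])
  have hRb := h.toRainbow_delete hL
  have hzX : z ∉ ({p, q, r} : Set V) := by
    rintro (h' | h' | h')
    exacts [h.hzO (h' ▸ h.hp.2), h.hzO (h' ▸ h.hq.2), h.hzO (h' ▸ h.hr.2)]
  have h5 := (h.lists z h.hz hzX).2 h.hzO
  obtain ⟨σ₁, hσ₁, σ₂, hσ₂, hσ⟩ := Finset.one_lt_card.1 (by
    have h1 := Finset.le_card_sdiff {e, c, b} (L z)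
    have h2 := Finset.card_le_three (a := e) (b := c) (c := b)
    omega : 1 < (L z \ {e, c, b}).card)
  simp only [Finset.mem_sdiff, Finset.mem_insert, Finset.mem_singleton, not_or] at hσ₁ hσ₂
  have b1 := h.bad_delete_two hbad hRL he hea hec hσ₁.1 hσ₁.2.1 hσ₁.2.2.1 hσ₁.2.2.2
  have b2 := h.bad_delete_two hbad hRL he hea hec hσ₂.1 hσ₂.2.1 hσ₂.2.2.1 hσ₂.2.2.2
  have hlt : (S \ {p}) \ {q} < S := by
    refine lt_of_le_of_lt Set.sdiff_subset (Set.sdiff_singleton_ssubset.2 h.hp.1)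
  have hnu : ¬ G.Adj u r := fun e => h.nur e
  rcases IH _ hlt _ _ _ _ _ hRb hnu with ⟨a₀, c₀, b₀, hU⟩ | ⟨Q, hQ, -⟩
  · exact absurd ((hU _ _ _ b1).2.1.trans (hU _ _ _ b2).2.1.symm) hσ
  · obtain ⟨y, hy, ezy, euy, hyr, hK, hx⟩ := hRb.fan_split hnu hQ
    have hyO : y ∈ O := by
      rcases hy.2 with rfl | rfl | hyO
      exacts [absurd rfl ezy.ne, absurd rfl euy.ne, hyO]
    exact ⟨y, ⟨hy.1.1.1, hyO⟩, ezy, euy, hyr, hy.1.2, hy.1.1.2, hK, hx⟩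

end Kite

/-! ### Two further triangles at a kite -/

/-- A kite together with a boundary vertex `y` adjacent to `u` and `z`, such that the edge `zy`
separates `u` from `r`. -/
structure Wheel {V : Type*} (G : SimpleGraph V) (S O : Set V) (L : V → Finset ℕ)
    (p q r u v z y : V) : Prop extends Kite G S O L p q r u v z where
  hy : y ∈ S ∩ O
  ezy : G.Adj z y
  euy : G.Adj u y
  hyr : y ≠ r
  hyq : y ≠ q
  hyp : y ≠ p
  huK : u ∉ comp G (((S \ {p}) \ {q}) \ {z, y}) r
  hyK : ∃ x ∈ comp G (((S \ {p}) \ {q}) \ {z, y}) r, G.Adj y x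

section Wheel

variable {V : Type*} {G : SimpleGraph V} {S O : Set V} {L : V → Finset ℕ}
  {p q r u v z y : V} {a b c : ℕ}

theorem Bad.congr {L' : V → Finset ℕ} (h : Bad G S L p q r a c b)
    (hL : ∀ x ∈ S, x ∉ ({p, q, r} : Set V) → L' x = L x) : Bad G S L' p q r a c b := by
  refine ⟨h.1, h.2.1, ?_⟩
  rintro ⟨φ, hφ, h'⟩
  exact h.2.2 ⟨φ, hφ.mono_lists subset_rfl (fun _ _ h => h) fun x hx hxX hm => hL x hx hxX ▸ hm, h'⟩

/-- The part of the wheel on the side of `u`, without `z` and with `p`. -/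
def wheelLeft (G : SimpleGraph V) (S : Set V) (p q r z y : V) : Set V :=
  insert p ((((S \ {p}) \ {q}) \ comp G (((S \ {p}) \ {q}) \ {z, y}) r) \ {z})

/-- The part of the wheel beyond the edge `zy`. -/
def wheelRight (G : SimpleGraph V) (S : Set V) (p q r z y : V) : Set V :=
  comp G (((S \ {p}) \ {q}) \ {z, y}) r ∪ {z, y}

theorem Wheel.hzr (h : Wheel G S O L p q r u v z y) : r ∈ ((S \ {p}) \ {q}) \ {z, y} :=
  ⟨⟨⟨h.hr.1, h.hpr.symm⟩, h.eqr.ne'⟩, by simp [h.ezr.ne', h.hyr.symm]⟩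

theorem Wheel.comp_sub (h : Wheel G S O L p q r u v z y) :
    comp G (((S \ {p}) \ {q}) \ {z, y}) r ⊆ ((S \ {p}) \ {q}) \ {z, y} := comp_subset h.hzr

theorem Wheel.hzp (h : Wheel G S O L p q r u v z y) : z ≠ p := by
  rintro rfl; exact h.hzO h.hp.2

theorem Wheel.hzv (h : Wheel G S O L p q r u v z y) : z ≠ v := by
  rintro rfl; exact h.hzO h.hv.2

theorem Wheel.hvK (h : Wheel G S O L p q r u v z y) :
    v ∉ comp G (((S \ {p}) \ {q}) \ {z, y}) r := fun hv =>
  h.huK (comp_step hv h.evu ⟨⟨⟨h.hu, h.pu.symm⟩, h.equ.ne'⟩, by simp [h.ezu.ne', h.euy.ne]⟩)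

theorem Wheel.rainbow_left (h : Wheel G S O L p q r u v z y) :
    Rainbow G (wheelLeft G S p q r z y) (O ∪ {x | G.Adj q x}) L p u y where
  disc := (h.disc.delete h.hq.1 h.hq.2).mono (by
    rintro x (rfl | hx)
    exacts [⟨h.hp.1, h.epq.ne⟩, ⟨hx.1.1.1.1, hx.1.1.2⟩]) subset_rfl
  hp := ⟨.inl rfl, .inl h.hp.2⟩
  hq := ⟨.inr ⟨⟨⟨⟨h.hu, h.pu.symm⟩, h.equ.ne'⟩, h.huK⟩, h.ezu.ne'⟩, .inr h.equ⟩
  hr := ⟨.inr ⟨⟨⟨⟨h.hy.1, h.hyp⟩, h.hyq⟩, fun hy => (h.comp_sub hy).2 (by simp)⟩, h.ezy.ne'⟩,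
    .inl h.hy.2⟩
  epq := h.epu
  eqr := h.euy
  hpr := h.hyp.symm
  lists := h.lists.mono (by
      rintro x (rfl | hx)
      exacts [h.hp.1, hx.1.1.1.1])
    (by
      rintro x (rfl | hx) hxX (h' | h' | h')
      · exact hxX (by simp)
      · exact h.epq.ne h'
      · exact h.hpr h'
      · exact hxX (by rw [h']; simp)
      · exact hx.1.1.2 h'
      · rw [h'] at hx
        exact hx.1.2 mem_comp_self)
    Set.subset_union_left

theorem Wheel.rainbow_right (h : Wheel G S O L p q r u v z y) :
    Rainbow G (wheelRight G S p q r z y) (insert z (insert u O)) L y z r :=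
  (h.toRainbow_delete h.lists).chord_right (w := y) ⟨⟨⟨h.hy.1, h.hyp⟩, h.hyq⟩, by simp [h.hy.2]⟩
    h.ezy h.huK h.euy.ne h.hyr

variable [Finite V]

open Classical in
/-- Bad colourings of a kite split along `zy`. The left part contains the triangle `u`, `z`, `y`. -/
theorem Wheel.split (h : Wheel G S O L p q r u v z y) (hbad : Bad G S L p q r a c b)
    {R : Finset ℕ} (hRL : R ⊆ (L v).erase a) (hR : R.card = 2) {e : ℕ} (he : e ∈ L u)
    (hea : e ≠ a) (hec : e ≠ c) (heR : e ∉ R) {σ : ℕ} (hσ : σ ∈ L z) (hσe : σ ≠ e) (hσc : σ ≠ c)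
    (hσb : σ ≠ b) : ∃ f, σ ≠ f ∧ e ≠ f ∧ Function.update L v (insert e R) y = {σ, e, f} ∧
      Bad G (wheelRight G S p q r z y) L y z r f σ b := by
  have hb := h.bad_delete_two hbad hRL he hea hec hσ hσe hσc hσb
  have hL : ListsOK S {p, q, r} O (Function.update L v (insert e R)) :=
    h.lists.update h.hv.2 (by rw [Finset.card_insert_of_notMem heR, hR])
  have hRb := h.toRainbow_delete hL
  have hy : y ∈ ((S \ {p}) \ {q}) ∩ insert z (insert u O) :=
    ⟨⟨⟨h.hy.1, h.hyp⟩, h.hyq⟩, by simp [h.hy.2]⟩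
  obtain ⟨d, f, hd, hf, hdf, hLy, hb0, hb1⟩ := hRb.bad_split hy h.ezy h.euy.ne h.huK h.hyr hb
  have hed := (hRb.chord_left hy h.ezy h.euy.ne h.huK h.hyr).eq_of_bad_of_adj h.euy hb0
  subst hed
  refine ⟨f, hf, hdf, hLy, hb1.congr fun x hx hxX => ?_⟩
  rw [Function.update_of_ne]
  rintro rfl
  rcases hx with hx | rfl | rfl
  · exact h.hvK hx
  · exact hxX (by simp)
  · exact hxX (by simp)

/-- On the left side, `z` is adjacent to `u` and `y` only. -/
theorem Wheel.nbrs_left (h : Wheel G S O L p q r u v z y) :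
    ∀ m ∈ ((S \ {p}) \ {q}) \ comp G (((S \ {p}) \ {q}) \ {z, y}) r, G.Adj z m →
      m = u ∨ m = y := by
  intro m hm ezm
  by_contra hcon
  push Not at hcon
  obtain ⟨K, hK⟩ : ∃ K : Set V, K = comp G (((S \ {p}) \ {q}) \ {z, y}) r := ⟨_, rfl⟩
  have hKsub : K ⊆ ((S \ {p}) \ {q}) \ {z, y} := hK ▸ h.comp_sub
  have hKstep : ∀ s ∈ K, ∀ t ∈ ((S \ {p}) \ {q}) \ {z, y}, G.Adj s t → t ∈ K := by
    intro s hs t ht e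
    rw [hK] at hs ⊢
    exact comp_step hs e ht
  have huK : u ∉ K := hK ▸ h.huK
  have hrK : r ∈ K := hK ▸ mem_comp_self
  have hKc : ConnSet G K := hK ▸ connSet_comp
  rw [← hK] at hm
  have hyK : ∃ x ∈ K, G.Adj y x := hK ▸ h.hyK
  have hzq := h.eqz.ne'
  have hzp := h.hzp
  have hzu := h.ezu.ne
  have hzy := h.ezy.ne
  have hpu := h.pu
  have hqu := h.equ.ne
  have hpq := h.epq.ne
  have hyq := h.hyq
  have hyp := h.hyp
  have huy := h.euy.ne
  obtain ⟨T, hT⟩ : ∃ T : Set V, T = ((S \ {p}) \ {q}) \ {u, z, y} := ⟨_, rfl⟩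
  have hmT : m ∈ T := hT ▸ ⟨hm.1, by simp [hcon, ezm.ne']⟩
  obtain ⟨M, hM⟩ : ∃ M : Set V, M = comp G T m := ⟨_, rfl⟩
  have hMT : M ⊆ T := hM ▸ comp_subset hmT
  have hMc : ConnSet G M := hM ▸ connSet_comp
  have hmM : m ∈ M := hM ▸ mem_comp_self
  have hMS : M ⊆ S := hMT.trans (hT ▸ fun x hx => hx.1.1.1)
  have hpM : p ∉ M := fun h => by have := hMT h; simp [hT] at this
  have hqM : q ∉ M := fun h => by have := hMT h; simp [hT] at this
  have huM : u ∉ M := fun h => by have := hMT h; simp [hT] at this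
  have hzM : z ∉ M := fun h => by have := hMT h; simp [hT] at this
  have hyM : y ∉ M := fun h => by have := hMT h; simp [hT] at this
  have hMK : Disjoint M K := by
    rw [Set.disjoint_left]
    intro s hsM hsK
    have hsub : M ⊆ ((S \ {p}) \ {q}) \ {z, y} := hMT.trans (by
      rw [hT]
      exact fun x hx => ⟨hx.1, fun hx' => hx.2 (.inr hx')⟩)
    rw [hK] at hsK
    exact hm.2 (hK ▸ hMc.subset_comp hsub hsM hsK hmM)
  have hrM : r ∉ M := fun h => Set.disjoint_left.1 hMK h hrK
  by_cases hMO : ∀ x ∈ M, x ∉ O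
  · refine h.no_attached_triangle h.irred hMS ⟨m, hmM⟩ hMO hpM hqM hrM (x := u) (y := z)
      (z := y) ⟨h.hu, huM⟩ ⟨h.hz, hzM⟩ ⟨h.hy.1, hyM⟩ h.ezu.symm h.ezy h.euy.symm
      fun s hs t ht e => ?_
    by_cases htT : t ∈ T
    · exact .inl (by rw [hM] at hs ⊢; exact comp_step hs e htT)
    by_cases htp : t = p
    · rcases h.nbrs s (hMS hs) (htp ▸ e.symm) with rfl | rfl | rfl
      exacts [absurd hs hqM, absurd hs huM, absurd h.hv.2 (hMO _ hs)]
    by_cases htq : t = q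
    · rcases h.nbrs_mid s (hMS hs) (htq ▸ e.symm) with rfl | rfl | rfl | rfl
      exacts [absurd hs hpM, absurd hs huM, absurd hs hzM, absurd hs hrM]
    · right
      by_contra hn
      exact htT (by simpa [hT, ht, htp, htq] using hn)
  · push Not at hMO
    obtain ⟨x, hxM, hxO⟩ := hMO
    have hyK' : y ∉ K := fun h => (hKsub h).2 (by simp)
    have hzK : z ∉ K := fun h => (hKsub h).2 (by simp)
    have hpK : p ∉ K := fun h => (hKsub h).1.1.2 rfl
    have hqK : q ∉ K := fun h => (hKsub h).1.2 rfl
    obtain ⟨x', hx', eyx⟩ := hyK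
    refine h.disc.not_rooted_K4 (X₁ := insert z M) (X₂ := {q}) (X₃ := {u, p}) (X₄ := insert y K)
      ⟨Set.insert_subset h.hz hMS, by simpa using h.hq.1,
        by rintro s (rfl | rfl); exacts [h.hu, h.hp.1],
        Set.insert_subset h.hy.1 fun s hs => (hKsub hs).1.1.1⟩
      (hMc.insert hmM ezm) (connSet_singleton _) (connSet_pair h.epu.symm) (hKc.insert hx' eyx)
      ?_ ?_ ⟨⟨x, .inr hxM, hxO⟩, ⟨q, rfl, h.hq.2⟩, ⟨p, by simp, h.hp.2⟩, ⟨y, .inl rfl, h.hy.2⟩⟩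
    · simp [hpM, hqM, huM, hyM, hqK, huK, hpK, hMK, hzK, hzq, hzu, hzp, hzy, hqu,
        hpq.symm, huy, hyp.symm, hyq.symm, Set.disjoint_insert_right]
    · simp only [List.pairwise_cons, List.mem_cons, List.not_mem_nil, or_false, forall_eq_or_imp,
        forall_eq, List.Pairwise.nil, and_true, implies_true, IsEmpty.forall_iff]
      exact ⟨⟨⟨z, .inl rfl, q, rfl, h.eqz.symm⟩, ⟨z, .inl rfl, u, by simp, h.ezu⟩,
        ⟨z, .inl rfl, y, .inl rfl, h.ezy⟩⟩, ⟨⟨q, rfl, p, by simp, h.epq.symm⟩,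
        ⟨q, rfl, r, .inr hrK, h.eqr⟩⟩, ⟨u, by simp, y, .inl rfl, h.euy⟩⟩

/-- A colouring of the left part and one of the right part combine to one of everything. -/
theorem Wheel.combine (h : Wheel G S O L p q r u v z y) (hbad : Bad G S L p q r a c b)
    {t θ η : ℕ} (ht : t ∈ L u) (htc : t ≠ c) (hta : t ≠ a) (hθ : θ ∈ L z) (hθc : θ ≠ c)
    (hθb : θ ≠ b) (hθt : θ ≠ t) (hη : η ∈ L y) (hηt : η ≠ t) (hηθ : η ≠ θ)
    (h0 : ¬ Bad G (wheelLeft G S p q r z y) L p u y a t η)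
    (h1 : ¬ Bad G (wheelRight G S p q r z y) L y z r η θ b) : False := by
  classical
  simp only [Bad, hta.symm, hηt.symm, hηθ, hθb, ne_eq, not_false_eq_true, true_and, not_not]
    at h0 h1
  obtain ⟨ψ, hψ, hψp, hψu, hψy⟩ := h0
  obtain ⟨χ, hχ, hχy, hχz, hχr⟩ := h1
  obtain ⟨K, hK⟩ : ∃ K : Set V, K = comp G (((S \ {p}) \ {q}) \ {z, y}) r := ⟨_, rfl⟩
  have hKsub : K ⊆ ((S \ {p}) \ {q}) \ {z, y} := hK ▸ h.comp_sub
  unfold wheelLeft at hψ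
  unfold wheelRight at hχ
  have hzl := h.nbrs_left
  have hvK := h.hvK
  have huK := h.huK
  have hKstep : ∀ s ∈ K, ∀ t ∈ ((S \ {p}) \ {q}) \ {z, y}, G.Adj s t → t ∈ K := by
    intro s hs t ht e
    rw [hK] at hs ⊢
    exact comp_step hs e ht
  rw [← hK] at hψ hχ hzl hvK huK
  have hrK : r ∈ K := hK ▸ mem_comp_self
  have hyK : y ∉ K := fun h => (hKsub h).2 (by simp)
  have hzK : z ∉ K := fun h => (hKsub h).2 (by simp)
  have c0 : IsColOn G (((S \ {p}) \ {q}) \ K) ∅ L (Function.update ψ z θ) := by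
    refine IsColOn.update (X := ∅) ⟨fun x hx y hy => hψ.proper x (.inr hx) y (.inr hy),
      fun x hx _ => ?_⟩ (fun _ _ hx _ => hx) (fun _ => hθ) ?_
    · by_cases hxu : x = u
      · rw [hxu, hψu]; exact ht
      by_cases hxy : x = y
      · rw [hxy, hψy]; exact hη
      refine hψ.mem x (.inr hx) ?_
      rintro (h | h | h)
      exacts [hx.1.1.1.2 h, hxu h, hxy h]
    · intro x hx e
      rcases hzl x hx e with rfl | rfl
      · rw [hψu]; exact hθt.symm
      · rw [hψy]; exact hηθ
  obtain ⟨φ, hφ, e0, e1⟩ := c0.glue hχ (S := (S \ {p}) \ {q}) (X := {r})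
    (fun x hx => by by_cases hk : x ∈ K; exacts [.inr (.inl hk), .inl ⟨hx, hk⟩])
    (fun v hv hv' => by
      rcases hv' with hv' | rfl | rfl
      · exact absurd hv' hv.2
      · rw [Function.update_self, hχz]
      · rw [Function.update_of_ne h.ezy.ne', hψy, hχy])
    (fun x hx y' hy exy => by
      rcases hy with hy | rfl | rfl
      · by_cases hxB : x ∈ ({z, y} : Set V)
        · exact .inl (.inr hxB)
        · exact absurd (hKstep _ hy x ⟨hx.1, hxB⟩ exy.symm) hx.2
      · exact .inr ⟨⟨⟨h.hz, h.hzp⟩, h.eqz.ne'⟩, hzK⟩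
      · exact .inr ⟨⟨⟨h.hy.1, h.hyp⟩, h.hyq⟩, hyK⟩)
    (fun _ _ _ => id)
    (fun x hx hx0 hxX hx' => by
      rcases hx' with rfl | rfl | h'
      · exact hx0 ⟨⟨⟨h.hy.1, h.hyp⟩, h.hyq⟩, hyK⟩
      · exact hx0 ⟨⟨⟨h.hz, h.hzp⟩, h.eqz.ne'⟩, hzK⟩
      · exact hxX h')
  have hur : φ u = t := by
    rw [e0 u ⟨⟨⟨h.hu, h.pu.symm⟩, h.equ.ne'⟩, huK⟩, Function.update_of_ne h.ezu.ne', hψu]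
  have hva : φ v ≠ a := by
    have hv : v ∈ ((S \ {p}) \ {q}) \ K := ⟨⟨⟨h.hv.1, h.epv.ne'⟩, h.hvq⟩, hvK⟩
    rw [e0 v hv, Function.update_of_ne h.hzv.symm, ← hψp]
    exact hψ.proper v (.inr ⟨hv, h.hzv.symm⟩) p (.inl rfl) h.epv.symm
  refine h.not_extend hbad hφ ((e1 r (.inl hrK)).trans hχr) (hur ▸ hta) (hur ▸ htc) hva ?_
  rw [e1 z (by simp), hχz]
  exact hθc

open Classical in
/-- A wheel has no bad colourings: the bad colourings after deleting `p` and `q` determine the lists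
of `u`, `z` and `y` so precisely that one of the remaining colourings of these three vertices extends
to both sides of the edge `zy`. -/
theorem Wheel.not_bad (h : Wheel G S O L p q r u v z y) (hbad : Bad G S L p q r a c b)
    {R : Finset ℕ} (hRL : R ⊆ (L v).erase a) (hR : R.card = 2) {e : ℕ} (he : e ∈ L u)
    (hea : e ≠ a) (hec : e ≠ c) (heR : e ∉ R) : False := by
  have hright := h.rainbow_right
  have hleft := h.rainbow_left
  -- The colour `σ₁` of `z` determines the list of `y`; all colours of `z` are then known.
  have hzX : z ∉ ({p, q, r} : Set V) := by
    rintro (h' | h' | h')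
    exacts [h.hzO (h' ▸ h.hp.2), h.hzO (h' ▸ h.hq.2), h.hzO (h' ▸ h.hr.2)]
  have h5 := (h.lists z h.hz hzX).2 h.hzO
  obtain ⟨σ₁, hσ₁⟩ : (L z \ {e, c, b}).Nonempty := by
    rw [← Finset.card_pos]
    have h1 := Finset.le_card_sdiff {e, c, b} (L z)
    have h2 := Finset.card_le_three (a := e) (b := c) (c := b)
    omega
  simp only [Finset.mem_sdiff, Finset.mem_insert, Finset.mem_singleton, not_or] at hσ₁
  obtain ⟨h1z, h1e, h1c, h1b⟩ := hσ₁
  have split := fun {σ} => h.split (σ := σ) hbad hRL hR he hea hec heR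
  obtain ⟨σ₂, h12, h2e, hLy, hB1⟩ := split h1z h1e h1c h1b
  have hLz : L z = {e, c, b, σ₁, σ₂} := by
    refine Finset.eq_of_subset_of_card_le (fun σ hσ => ?_) (Finset.card_le_five.trans h5)
    by_contra hcon
    simp only [Finset.mem_insert, Finset.mem_singleton, not_or] at hcon
    obtain ⟨f, -, -, hLy', -⟩ := split hσ hcon.1 hcon.2.1 hcon.2.2.1
    have : σ ∈ ({σ₁, e, σ₂} : Finset ℕ) := by rw [← hLy, hLy']; simp
    simp only [Finset.mem_insert, Finset.mem_singleton] at this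
    rcases this with h | h | h
    exacts [hcon.2.2.2.1 h, hcon.1 h, hcon.2.2.2.2 h]
  have hdup : ∀ w₁ w₂ w₃ w₄ : ℕ, L z ⊆ {w₁, w₂, w₃, w₄} → False := fun w₁ w₂ w₃ w₄ hs => by
    have h1 := Finset.card_le_card hs
    have h2 := Finset.card_le_four (a := w₁) (b := w₂) (c := w₃) (d := w₄)
    omega
  have heb : e ≠ b := by
    rintro rfl
    refine hdup e c σ₁ σ₂ (hLz ▸ ?_)
    intro x hx; simp at hx ⊢; clear * - hx; tauto
  have h2c : σ₂ ≠ c := by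
    rintro rfl
    refine hdup e σ₂ b σ₁ (hLz ▸ ?_)
    intro x hx; simp at hx ⊢; clear * - hx; tauto
  have h2b : σ₂ ≠ b := by
    rintro rfl
    refine hdup e c σ₂ σ₁ (hLz ▸ ?_)
    intro x hx; simp at hx ⊢; clear * - hx; tauto
  have hez : e ∈ L z := by simp [hLz]
  have h2z : σ₂ ∈ L z := by simp [hLz]
  have hB2 : Bad G (wheelRight G S p q r z y) L y z r σ₁ σ₂ b := by
    obtain ⟨f, h2f, hef, hLy', hB⟩ := split h2z h2e.symm h2c h2b
    have : f ∈ ({σ₁, e, σ₂} : Finset ℕ) := by rw [← hLy, hLy']; simp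
    simp only [Finset.mem_insert, Finset.mem_singleton] at this
    rcases this with rfl | h | h
    exacts [hB, absurd h hef.symm, absurd h h2f.symm]
  have hv : y = v → R = {σ₁, σ₂} := fun hyv => by
    rw [hyv, Function.update_self] at hLy
    have := congrArg (Finset.erase · e) hLy
    simp only [Finset.erase_insert heR] at this
    rw [this]
    ext x
    simp only [Finset.mem_erase, Finset.mem_insert, Finset.mem_singleton]
    constructor
    · rintro ⟨h1, h | h | h⟩
      exacts [.inl h, absurd h h1, .inr h]
    · rintro (h | h)
      exacts [⟨h ▸ h1e, .inl h⟩, ⟨h ▸ h2e.symm, .inr (.inr h)⟩]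
  have hyL : y ≠ v → L y = {σ₁, e, σ₂} := fun hyv => by
    rwa [Function.update_of_ne hyv] at hLy
  -- Any other admissible colour `e` of `u` lies in `R`: a colour outside would contradict the uniqueness of bad colours on the right.
  have hRu : ∀ t ∈ R, t ∈ L u ∧ t ≠ a ∧ t ≠ c := by
    have huX : u ∉ ({p, q, r} : Set V) := by
      simp [h.pu.symm, h.equ.ne', h.ru.symm]
    have hu5 := (h.lists u h.hu huX).2 h.huO
    have huniq : L u \ {a, c, e} ⊆ R := by
      intro e' he'
      by_contra heR'
      simp only [Finset.mem_sdiff, Finset.mem_insert, Finset.mem_singleton, not_or] at he'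
      obtain ⟨heu', hea', hec', hee'⟩ := he'
      have split' := fun {σ} => h.split (σ := σ) hbad hRL hR heu' hea' hec' heR'
      obtain ⟨f', -, -, hf', -⟩ := split' hez (Ne.symm hee') hec heb
      by_cases hyv : y = v
      · rw [hyv, Function.update_self] at hf'
        have : e ∈ insert e' R := by rw [hf']; simp
        rw [Finset.mem_insert] at this
        exact this.elim (fun h => hee' h.symm) heR
      · rw [Function.update_of_ne hyv, hyL hyv] at hf'
        have hmem : e' ∈ ({σ₁, e, σ₂} : Finset ℕ) := by rw [hf']; simp
        have main : ∀ {σ τ : ℕ}, L y = {σ, e, τ} → e' = σ → τ ∈ L z → τ ≠ σ → τ ≠ c → τ ≠ b →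
            e ≠ τ → e ≠ σ → Bad G (wheelRight G S p q r z y) L y z r σ τ b → False := by
          rintro σ τ hL rfl hτ hτσ hτc hτb heτ heσ hB
          obtain ⟨g, hg1, hg2, hg3, hB'⟩ := split' hτ hτσ hτc hτb
          rw [Function.update_of_ne hyv, hL] at hg3
          have : g ∈ ({e', e, τ} : Finset ℕ) := by rw [hg3]; simp
          simp only [Finset.mem_insert, Finset.mem_singleton] at this
          rcases this with h | h | h
          · exact hg2 h.symm
          · exact heσ (h ▸ hright.bad_left_unique hB' hB)
          · exact hg1 h.symm
        simp only [Finset.mem_insert, Finset.mem_singleton] at hmem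
        rcases hmem with h | h | h
        · exact main (hyL hyv) h h2z h12.symm h2c h2b h2e (Ne.symm h1e) hB2
        · exact hee' h
        · refine main (σ := σ₂) (τ := σ₁) ?_ h h1z h12 h1c h1b (Ne.symm h1e) h2e hB1
          rw [hyL hyv]; ext x; simp; clear * -; tauto
    have hcard : R.card ≤ (L u \ {a, c, e}).card := by
      have h1 := Finset.le_card_sdiff {a, c, e} (L u)
      have h2 := Finset.card_le_three (a := a) (b := c) (c := e)
      omega
    intro t ht
    rw [← Finset.eq_of_subset_of_card_le huniq hcard] at ht
    simp only [Finset.mem_sdiff, Finset.mem_insert, Finset.mem_singleton, not_or] at ht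
    exact ⟨ht.1, ht.2.1, ht.2.2.1⟩
  have hte : ∀ t ∈ R, t ≠ e := fun t ht h => heR (h ▸ ht)
  -- Either colour `u`, `y`, `z` with `t`, `e` and some `σᵢ ≠ t`, or with `t`, some `σᵢ ≠ t` and `e`.
  by_cases hcase : y ≠ v ∧ ∃ t ∈ R, ¬ Bad G (wheelLeft G S p q r z y) L p u y a t e
  · obtain ⟨hyv, t, htR, hgood⟩ := hcase
    obtain ⟨htu, hta, htc⟩ := hRu t htR
    have fin : ∀ {θ τ}, Bad G (wheelRight G S p q r z y) L y z r τ θ b → e ≠ τ → θ ≠ t → θ ∈ L z →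
        θ ≠ e → θ ≠ c → θ ≠ b → False := fun hB heτ hθt hθ hθe hθc hθb =>
      h.combine hbad htu htc hta hθ hθc hθb hθt (by simp [hyL hyv]) (hte t htR).symm hθe.symm hgood
        fun hB' => heτ (hright.bad_left_unique hB' hB)
    by_cases ht1 : t = σ₁
    · exact fin hB2 (Ne.symm h1e) (fun h => h12 (ht1.symm.trans h.symm)) h2z h2e.symm h2c h2b
    · exact fin hB1 h2e (Ne.symm ht1) h1z h1e h1c h1b
  · obtain ⟨s, hs, hse, hsy, hgood⟩ : ∃ s, (s = σ₁ ∨ s = σ₂) ∧ s ≠ e ∧ s ∈ L y ∧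
        ¬ Bad G (wheelRight G S p q r z y) L y z r s e b := by
      have hmem : ∀ s, (s = σ₁ ∨ s = σ₂) → s ∈ L y := by
        intro s hs
        by_cases hyv : y = v
        · have : s ∈ R := by rw [hv hyv]; simpa using hs
          rw [hyv]
          exact Finset.mem_of_mem_erase (hRL this)
        · rw [hyL hyv]
          rcases hs with rfl | rfl <;> simp
      by_cases hB : Bad G (wheelRight G S p q r z y) L y z r σ₁ e b
      · exact ⟨σ₂, .inr rfl, h2e.symm, hmem _ (.inr rfl), fun hB' =>
          h12 (hright.bad_left_unique hB hB')⟩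
      · exact ⟨σ₁, .inl rfl, h1e, hmem _ (.inl rfl), hB⟩
    obtain ⟨t, htR, hts⟩ := exists_mem_ne_of_two_le hR.ge s
    obtain ⟨htu, hta, htc⟩ := hRu t htR
    refine h.combine hbad htu htc hta hez hec heb (hte t htR).symm hsy hts.symm hse
      (fun hB => ?_) hgood
    by_cases hyv : y = v
    · have has := hleft.eq_of_bad_of_adj (hyv ▸ h.epv) hB
      have : s ∈ R := by rw [hv hyv]; simpa using hs
      exact Finset.ne_of_mem_erase (hRL this) has.symm
    · have hB' : Bad G (wheelLeft G S p q r z y) L p u y a t e := by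
        by_contra hn
        exact hcase ⟨hyv, t, htR, hn⟩
      exact hse (hleft.bad_right_unique hB hB')

end Wheel

section Hub

variable {V : Type*} {G : SimpleGraph V} {S O : Set V} {L : V → Finset ℕ}
  {p q r : V} {a b c : ℕ}

variable [Finite V]

/-- If a tight rainbow has a bad colouring, then the vertices of its path have a common neighbour,
provided that `Hub` and `Dichotomy` hold for the rainbows on smaller vertex sets. -/
theorem Tight.exists_hub (h : Tight G S O L p q r) (hbad : Bad G S L p q r a c b)
    (IH₁ : ∀ S' < S, ∀ (O' : Set V) (L' : V → Finset ℕ) (p' q' r' : V) (a' c' b' : ℕ),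
      Rainbow G S' O' L' p' q' r' → Bad G S' L' p' q' r' a' c' b' → Hub G S' O' p' q' r')
    (IH₂ : ∀ S' < S, ∀ (O' : Set V) (L' : V → Finset ℕ) (p' q' r' : V),
      Rainbow G S' O' L' p' q' r' → ¬ G.Adj p' r' → Dichotomy G S' O' L' p' q' r') :
    ∃ z ∈ S, z ∉ O ∧ G.Adj z p ∧ G.Adj z q ∧ G.Adj z r := by
  classical
  by_contra hno
  obtain ⟨v, hv, epv, hvq⟩ := h.exists_nbr hbad
  have hvr := h.ne_of_nbr epv
  have hvX : v ∉ ({p, q, r} : Set V) := by simp [epv.ne', hvq, hvr]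
  have h3 := (h.lists v hv.1 hvX).1 hv.2
  obtain ⟨R, hRL, hR⟩ := Finset.exists_subset_card_eq (s := (L v).erase a) (n := 2) (by
    have := Finset.pred_card_le_card_erase (s := L v) (a := a)
    omega)
  obtain ⟨hRb, hb⟩ := h.bad_delete_nbr hbad hv epv hvq hRL hR
  -- Deleting `v` yields a common neighbour `u` of `v` and `q`.
  obtain ⟨u, hu, huO, equ, evu⟩ : ∃ u ∈ S, u ∉ O ∧ G.Adj q u ∧ G.Adj v u := by
    rcases IH₁ _ (Set.sdiff_singleton_ssubset.2 hv.1) _ _ _ _ _ _ _ _ hRb hb with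
      e | ⟨u, hu, equ, hup, hur⟩ | ⟨z, hz, hzO, e⟩
    · exact absurd e h.npr
    · by_cases huO : u ∈ O
      · rcases h.nchord u ⟨hu.1.1, huO⟩ equ with h' | h'
        exacts [absurd h' hup, absurd h' hur]
      · exact ⟨u, hu.1.1, huO, equ, hu.2.resolve_left huO⟩
    · exact absurd ⟨z, hz.1, fun h => hzO (.inl h), e⟩ hno
  have hC : Corner G S O L p q r u v :=
    { h with
      hv := hv, epv := epv, hvq := hvq, hu := hu, huO := huO, equ := equ, evu := evu
      epu := h.adj_of_common_nbr hbad hv epv hvq hu huO equ evu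
      nbrs := h.nbrs_of_common_nbr hv epv hvq hu huO equ evu }
  have hur : ¬ G.Adj u r := fun e => hno ⟨u, hu, huO, hC.epu.symm, equ.symm, e⟩
  have huX : u ∉ ({p, q, r} : Set V) := by simp [hC.pu.symm, equ.ne', hC.ru.symm]
  have hu5 := (h.lists u hu huX).2 huO
  obtain ⟨e, he⟩ : (L u \ ({a, c} ∪ R)).Nonempty := by
    rw [← Finset.card_pos]
    have h1 := Finset.le_card_sdiff ({a, c} ∪ R) (L u)
    have h2 := Finset.card_union_le {a, c} R
    have h3 := Finset.card_le_two (a := a) (b := c)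
    omega
  simp only [Finset.mem_sdiff, Finset.mem_union, Finset.mem_insert, Finset.mem_singleton,
    not_or] at he
  obtain ⟨heu, ⟨hea, hec⟩, heR⟩ := he
  have hL : ListsOK S {p, q, r} O (Function.update L v (insert e R)) :=
    h.lists.update hv.2 (by rw [Finset.card_insert_of_notMem heR, hR])
  -- Deleting `p` yields a common neighbour `z` of `u`, `q` and `r`.
  obtain ⟨z, hz, hzO, ezu, ezq, ezr⟩ : ∃ z ∈ S, z ∉ O ∧ G.Adj z u ∧ G.Adj z q ∧ G.Adj z r := by
    rcases IH₁ _ (Set.sdiff_singleton_ssubset.2 h.hp.1) _ _ _ _ _ _ _ _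
      (hC.toRainbow_delete hL) (hC.bad_delete hbad hRL heu hea hec) with
      e | ⟨x, hx, eqx, hxu, hxr⟩ | ⟨z, hz, hzO, e⟩
    · exact absurd e hur
    · rcases h.nchord x ⟨hx.1.1, hx.2.resolve_left hxu⟩ eqx with h' | h'
      exacts [absurd h' hx.1.2, absurd h' hxr]
    · exact ⟨z, hz.1, fun h => hzO (.inr h), e⟩
  have hK : Kite G S O L p q r u v z :=
    { hC with hz := hz, hzO := hzO, ezu := ezu, eqz := ezq.symm, ezr := ezr, nur := hur }
  obtain ⟨y, hy, ezy, euy, hyr, hyq, hyp, huK, hyK⟩ :=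
    hK.exists_third hbad IH₂ hRL hR heu hea hec heR
  exact Wheel.not_bad (y := y) { hK with
    hy := hy, ezy := ezy, euy := euy, hyr := hyr, hyq := hyq, hyp := hyp, huK := huK, hyK := hyK }
    hbad hRL hR heu hea hec heR

/-- If the vertices of the path of a tight rainbow have a common neighbour `z`, then `q` has no
further neighbours. -/
theorem Tight.nbrs_mid (h : Tight G S O L p q r) {z : V} (hz : z ∈ S)
    (ezp : G.Adj z p) (ezq : G.Adj z q) (ezr : G.Adj z r) :
    ∀ m ∈ S, G.Adj q m → m = p ∨ m = z ∨ m = r := by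
  intro m hm eqm
  by_contra hcon
  push Not at hcon
  have hpq := h.epq.ne
  have hpr := h.hpr
  have hqr := h.eqr.ne
  have hzp := ezp.ne
  have hzq := ezq.ne
  have hzr := ezr.ne
  obtain ⟨T, hT⟩ : ∃ T : Set V, T = S \ {p, q, z, r} := ⟨_, rfl⟩
  have hmT : m ∈ T := by simp [hT, hm, hcon, eqm.ne']
  obtain ⟨M, hM⟩ : ∃ M : Set V, M = comp G T m := ⟨_, rfl⟩
  have hMT : M ⊆ T := hM ▸ comp_subset hmT
  have hMc : ConnSet G M := hM ▸ connSet_comp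
  have hmM : m ∈ M := hM ▸ mem_comp_self
  have hMS : M ⊆ S := hMT.trans (hT ▸ Set.sdiff_subset)
  have hstep : ∀ s ∈ M, ∀ t ∈ S, G.Adj s t → t ∈ M ∨ t = p ∨ t = q ∨ t = z ∨ t = r := by
    intro s hs t ht e
    by_cases htT : t ∈ T
    · exact .inl (by rw [hM] at hs ⊢; exact comp_step hs e htT)
    · right
      by_contra hn
      exact htT (by simpa [hT, ht] using hn)
  have hpM : p ∉ M := fun h => by have := hMT h; simp [hT] at this
  have hqM : q ∉ M := fun h => by have := hMT h; simp [hT] at this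
  have hzM : z ∉ M := fun h => by have := hMT h; simp [hT] at this
  have hrM : r ∉ M := fun h => by have := hMT h; simp [hT] at this
  have tqM : Touch G {q} M := ⟨q, rfl, m, hmM, eqm⟩
  by_cases hMO : ∀ x ∈ M, x ∉ O
  · refine h.no_attached_square h.irred hMS ⟨m, hmM⟩ hMO hpM hqM hrM (x := q) (y := p) (z := z)
      (w := r) ⟨h.hq.1, hqM⟩ ⟨h.hp.1, hpM⟩ ⟨hz, hzM⟩ ⟨h.hr.1, hrM⟩ h.epq.symm ezp.symm ezr
      h.eqr.symm hzq.symm hpr fun s hs t ht e => ?_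
    rcases hstep s hs t ht e with h' | h' | h' | h' | h' <;> simp [h']
  push Not at hMO
  obtain ⟨x, hxM, hxO⟩ := hMO
  have tzM : ¬ Touch G {z} M := fun t => by
    refine h.disc.not_rooted_K23 (X₁ := {q}) (X₂ := {z}) (Y₁ := M) (Y₂ := {p}) (Y₃ := {r})
      ⟨by simpa using h.hq.1, by simpa using hz, hMS, by simpa using h.hp.1,
        by simpa using h.hr.1⟩
      (connSet_singleton _) (connSet_singleton _) hMc (connSet_singleton _) (connSet_singleton _)
      ?_ ⟨tqM, ⟨q, rfl, p, rfl, h.epq.symm⟩, ⟨q, rfl, r, rfl, h.eqr⟩⟩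
      ⟨t, ⟨z, rfl, p, rfl, ezp⟩, ⟨z, rfl, r, rfl, ezr⟩⟩ ⟨x, hxM, hxO⟩
      ⟨p, rfl, h.hp.2⟩ ⟨r, rfl, h.hr.2⟩
    simp [hpM, hqM, hzM, hrM, hpq.symm, hpr, hqr, hzq.symm, hzp, hzr]
  by_cases tpM : Touch G {p} M
  · by_cases trM : Touch G {r} M
    · refine h.disc.not_rooted_K23 (X₁ := M) (X₂ := {z}) (Y₁ := {q}) (Y₂ := {p}) (Y₃ := {r})
        ⟨hMS, by simpa using hz, by simpa using h.hq.1, by simpa using h.hp.1,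
          by simpa using h.hr.1⟩
        hMc (connSet_singleton _) (connSet_singleton _) (connSet_singleton _) (connSet_singleton _)
        ?_ ⟨tqM.symm, tpM.symm, trM.symm⟩
        ⟨⟨z, rfl, q, rfl, ezq⟩, ⟨z, rfl, p, rfl, ezp⟩, ⟨z, rfl, r, rfl, ezr⟩⟩ ⟨q, rfl, h.hq.2⟩
        ⟨p, rfl, h.hp.2⟩ ⟨r, rfl, h.hr.2⟩
      simp [hpM, hqM, hzM, hrM, hpq.symm, hpr, hqr, hzq, hzp, hzr]
    · refine h.no_attached_edge h.irred hMS ⟨m, hmM⟩ hpM hqM hrM h.hp h.hq h.epq hpM hqM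
        fun s hs t ht e => ?_
      rcases hstep s hs t ht e with h' | h' | h' | h' | h'
      · exact .inl h'
      · exact .inr (.inl h')
      · exact .inr (.inr h')
      · exact absurd ⟨t, h', s, hs, e.symm⟩ tzM
      · exact absurd ⟨t, h', s, hs, e.symm⟩ trM
  · refine h.no_attached_edge h.irred hMS ⟨m, hmM⟩ hpM hqM hrM h.hq h.hr h.eqr hqM hrM
      fun s hs t ht e => ?_
    rcases hstep s hs t ht e with h' | h' | h' | h' | h'
    · exact .inl h'
    · exact absurd ⟨t, h', s, hs, e.symm⟩ tpM
    · exact .inr (.inl h')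
    · exact absurd ⟨t, h', s, hs, e.symm⟩ tzM
    · exact .inr (.inr h')

/-- A tight rainbow with a common neighbour `z` of its path has at most one bad colouring: after
the deletion of `q`, there are bad colourings `a`, `σ`, `b` of `p`, `z`, `r` for all colours `σ` of `z`
but three, too many for the types of bad colourings unless `L z` determines `a`, `b` and `c`. -/
theorem Tight.uniqueBad (h : Tight G S O L p q r) {z : V} (hz : z ∈ S) (hzO : z ∉ O)
    (ezp : G.Adj z p) (ezq : G.Adj z q) (ezr : G.Adj z r)
    (IH₂ : ∀ S' < S, ∀ (O' : Set V) (L' : V → Finset ℕ) (p' q' r' : V),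
      Rainbow G S' O' L' p' q' r' → ¬ G.Adj p' r' → Dichotomy G S' O' L' p' q' r') :
    UniqueBad G S L p q r := by
  classical
  have hRb : Rainbow G (S \ {q}) (O ∪ {x | G.Adj q x}) L p z r :=
    { disc := h.disc.delete h.hq.1 h.hq.2
      hp := ⟨⟨h.hp.1, h.epq.ne⟩, .inl h.hp.2⟩
      hq := ⟨⟨hz, ezq.ne⟩, .inr ezq.symm⟩
      hr := ⟨⟨h.hr.1, h.eqr.ne'⟩, .inl h.hr.2⟩
      epq := ezp.symm
      eqr := ezr
      hpr := h.hpr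
      lists := h.lists.mono Set.sdiff_subset (by
        rintro x hx hxX (h | h | h)
        exacts [hxX (.inl h), hx.2 h, hxX (.inr (.inr h))]) Set.subset_union_left }
  have hdel : ∀ {a c b σ}, Bad G S L p q r a c b → σ ∈ L z → σ ≠ a → σ ≠ c → σ ≠ b →
      Bad G (S \ {q}) L p z r a σ b := by
    intro a c b σ hbad hσ hσa hσc hσb
    refine ⟨hσa.symm, hσb, ?_⟩
    rintro ⟨φ, hφ, hp, hz', hr⟩
    refine hbad.2.2 ⟨Function.update φ q c, IsColOn.update (X := {p, r}) ⟨hφ.proper,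
      fun x hx hxX => ?_⟩ (fun s _ hs _ hs' => hs ?_) (fun h => absurd (by simp) h) ?_, ?_, by simp,
      ?_⟩
    · by_cases hxz : x = z
      · rw [hxz, hz']; exact hσ
      · exact hφ.mem x hx (by
          rintro (h | h | h)
          exacts [hxX (.inl h), hxz h, hxX (.inr h)])
    · rcases hs' with h | h
      exacts [.inl h, .inr (.inr h)]
    · intro s hs eqs
      rcases h.nbrs_mid hz ezp ezq ezr s hs eqs with rfl | rfl | rfl
      · rw [hp]; exact hbad.1
      · rw [hz']; exact hσc
      · rw [hr]; exact hbad.2.1.symm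
    · rw [Function.update_of_ne h.epq.ne, hp]
    · rw [Function.update_of_ne h.eqr.ne', hr]
  have hzX : z ∉ ({p, q, r} : Set V) := by simp [ezp.ne, ezq.ne, ezr.ne]
  have h5 := (h.lists z hz hzX).2 hzO
  by_cases hbad : ∃ a c b, Bad G S L p q r a c b
  swap
  · exact ⟨0, 0, 0, fun a c b hb => absurd ⟨a, c, b, hb⟩ hbad⟩
  obtain ⟨a, c, b, hbad⟩ := hbad
  obtain ⟨σ₁, hσ₁, σ₂, hσ₂, hσ⟩ := Finset.one_lt_card.1 (by
    have h1 := Finset.le_card_sdiff {a, c, b} (L z)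
    have h2 := Finset.card_le_three (a := a) (b := c) (c := b)
    omega : 1 < (L z \ {a, c, b}).card)
  simp only [Finset.mem_sdiff, Finset.mem_insert, Finset.mem_singleton, not_or] at hσ₁ hσ₂
  have b1 := hdel hbad hσ₁.1 hσ₁.2.1 hσ₁.2.2.1 hσ₁.2.2.2
  have b2 := hdel hbad hσ₂.1 hσ₂.2.1 hσ₂.2.2.1 hσ₂.2.2.2
  rcases IH₂ _ (Set.sdiff_singleton_ssubset.2 h.hq.1) _ _ _ _ _ hRb h.npr with
    ⟨a₀, c₀, b₀, hU⟩ | ⟨-, -, ⟨-, T, hT, hE⟩ | ⟨-, ⟨T, hT, hE⟩ | ⟨a₀, b₀, c₁, c₂, hab, hE⟩⟩⟩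
  · exact absurd ((hU _ _ _ b1).2.1.trans (hU _ _ _ b2).2.1.symm) hσ
  · exfalso
    have hsub : ({a, b, σ₁, σ₂} : Finset ℕ) ⊆ T := by
      intro x hx
      simp only [Finset.mem_insert, Finset.mem_singleton] at hx
      rcases hx with rfl | rfl | rfl | rfl
      exacts [(hE _ _ _ b1).1, (hE _ _ _ b1).2.2.1, (hE _ _ _ b1).2.1, (hE _ _ _ b2).2.1]
    have := Finset.card_le_card hsub
    rw [Finset.card_insert_of_notMem (by simp [(hE _ _ _ b1).2.2.2, Ne.symm hσ₁.2.1,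
        Ne.symm hσ₂.2.1]), Finset.card_insert_of_notMem (by simp [Ne.symm hσ₁.2.2.2,
        Ne.symm hσ₂.2.2.2]), Finset.card_pair hσ, hT] at this
    omega
  · exfalso
    have hab := (hE _ _ _ b1).1
    subst hab
    have hsub : insert a (L z \ {a, c}) ⊆ T := by
      intro x hx
      simp only [Finset.mem_insert, Finset.mem_sdiff, Finset.mem_singleton, not_or] at hx
      rcases hx with rfl | ⟨hx, hxa, hxc⟩
      · exact (hE _ _ _ b1).2.1
      · exact (hE _ _ _ (hdel hbad hx hxa hxc hxa)).2.2
    have := Finset.card_le_card hsub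
    rw [Finset.card_insert_of_notMem (by simp), hT] at this
    have h1 := Finset.le_card_sdiff {a, c} (L z)
    have h2 := Finset.card_le_two (a := a) (b := c)
    omega
  · have key : ∀ {a c b}, Bad G S L p q r a c b → a = a₀ ∧ b = b₀ ∧
        L z = {c, a₀, b₀, c₁, c₂} := by
      intro a c b hbad
      obtain ⟨σ, hσ⟩ : (L z \ {a, c, b}).Nonempty := by
        rw [← Finset.card_pos]
        have h1 := Finset.le_card_sdiff {a, c, b} (L z)
        have h2 := Finset.card_le_three (a := a) (b := c) (c := b)
        omega
      simp only [Finset.mem_sdiff, Finset.mem_insert, Finset.mem_singleton, not_or] at hσ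
      obtain ⟨rfl, rfl, -⟩ := hE _ _ _ (hdel hbad hσ.1 hσ.2.1 hσ.2.2.1 hσ.2.2.2)
      refine ⟨rfl, rfl, Finset.eq_of_subset_of_card_le (fun x hx => ?_)
        (Finset.card_le_five.trans h5)⟩
      by_cases hx' : x = a ∨ x = c ∨ x = b
      · simp only [Finset.mem_insert]; clear * - hx'; tauto
      · simp only [not_or] at hx'
        rcases (hE _ _ _ (hdel hbad hx hx'.1 hx'.2.1 hx'.2.2)).2.2 with h | h <;> simp [h]
    refine ⟨a₀, c, b₀, fun a' c' b' hb' => ?_⟩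
    obtain ⟨-, -, h1⟩ := key hbad
    obtain ⟨ha', hb'', h2⟩ := key hb'
    refine ⟨ha', ?_, hb''⟩
    by_contra hcc
    have hc : c' ∈ ({a₀, b₀, c₁, c₂} : Finset ℕ) := by
      have : c' ∈ L z := by rw [h2]; simp
      rw [h1, Finset.mem_insert] at this
      exact this.resolve_left hcc
    rw [h2, Finset.insert_eq_of_mem hc] at h5
    have := Finset.card_le_four (a := a₀) (b := b₀) (c := c₁) (d := c₂)
    omega

end Hub

/-! ### The induction -/

section Induction

variable {V : Type*} {G : SimpleGraph V} {S O : Set V} {L : V → Finset ℕ}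
  {p q r : V} {a b c : ℕ}

theorem Hub.mono {S' : Set V} (hS : S' ⊆ S) (h : Hub G S' O p q r) : Hub G S O p q r := by
  rcases h with h | ⟨u, hu, h⟩ | ⟨z, hz, h⟩
  exacts [.inl h, .inr (.inl ⟨u, ⟨hS hu.1, hu.2⟩, h⟩), .inr (.inr ⟨z, hS hz, h⟩)]

theorem Dichotomy.mono {S' : Set V} (hS : S' ⊆ S)
    (hb : ∀ a c b, Bad G S L p q r a c b → Bad G S' L p q r a c b)
    (h : Dichotomy G S' O L p q r) : Dichotomy G S O L p q r := by
  rcases h with ⟨a₀, c₀, b₀, h⟩ | ⟨Q, ⟨hQ, hQ'⟩, h⟩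
  · exact .inl ⟨a₀, c₀, b₀, fun a c b h' => h a c b (hb a c b h')⟩
  refine .inr ⟨Q, ⟨hQ, fun x hx => ⟨⟨hS (hQ' x hx).1.1, (hQ' x hx).1.2⟩, (hQ' x hx).2⟩⟩, ?_⟩
  rcases h with ⟨h1, T, hT, h⟩ | ⟨h1, ⟨T, hT, h⟩ | ⟨a₀, b₀, c₁, c₂, hab, h⟩⟩
  · exact .inl ⟨h1, T, hT, fun a c b h' => h a c b (hb a c b h')⟩
  · exact .inr ⟨h1, .inl ⟨T, hT, fun a c b h' => h a c b (hb a c b h')⟩⟩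
  · exact .inr ⟨h1, .inr ⟨a₀, b₀, c₁, c₂, hab, fun a c b h' => h a c b (hb a c b h')⟩⟩

/-- A rainbow that is not irreducible has the same bad colourings as a smaller one. -/
theorem Rainbow.exists_reduction (h : Rainbow G S O L p q r) (hI : ¬ Irred G S L p q r) :
    ∃ S' < S, Rainbow G S' O L p q r ∧ ∀ a c b, Bad G S L p q r a c b → Bad G S' L p q r a c b := by
  unfold Irred at hI
  push Not at hI
  obtain ⟨K, hKS, ⟨k, hk⟩, hp, hq, hr, hext⟩ := hI
  refine ⟨S \ K, ⟨Set.sdiff_subset, fun hS => (hS (hKS hk)).2 hk⟩,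
    h.mono Set.sdiff_subset ⟨h.hp.1, hp⟩ ⟨h.hq.1, hq⟩ ⟨h.hr.1, hr⟩,
    fun a c b hb => ⟨hb.1, hb.2.1, ?_⟩⟩
  rintro ⟨φ, hφ, h1, h2, h3⟩
  obtain ⟨φ', hφ', he⟩ := hext φ hφ
  exact hb.2.2 ⟨φ', hφ', (he p ⟨h.hp.1, hp⟩).trans h1, (he q ⟨h.hq.1, hq⟩).trans h2,
    (he r ⟨h.hr.1, hr⟩).trans h3⟩

theorem IsFan.concat {S' : Set V} (hS : S' ⊆ S) {w : V} {Q : G.Walk p w} (hQ : IsFan S' O q Q)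
    (e : G.Adj w r) (hr : r ∈ S ∩ O) (hrS' : r ∉ S') (eqr : G.Adj q r) :
    IsFan S O q (Q.concat e) := by
  refine ⟨hQ.1.concat (fun h => hrS' (hQ.2 r h).1.1) e, fun x hx => ?_⟩
  rw [SimpleGraph.Walk.support_concat, List.mem_append, List.mem_singleton] at hx
  rcases hx with hx | rfl
  · exact ⟨⟨hS (hQ.2 x hx).1.1, (hQ.2 x hx).1.2⟩, (hQ.2 x hx).2⟩
  · exact ⟨hr, eqr⟩

theorem IsFan.reverse {Q : G.Walk p r} (hQ : IsFan S O q Q) : IsFan S O q Q.reverse :=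
  ⟨hQ.1.reverse, fun x hx => hQ.2 x (by simpa using hx)⟩

/-- The bad colourings of a fan with an even number of triangles followed by one more triangle. -/
theorem oddType_of_evenType {B₀ : ℕ → ℕ → ℕ → Prop} {W T : Finset ℕ} (hT : T.card = 3)
    (hB₀ : ∀ a c d, B₀ a c d → a ∈ T ∧ c ∈ T ∧ d ∈ T ∧ a ≠ d ∧ a ≠ c)
    (h : ∀ a c b, Bad G S L p q r a c b →
      ∃ d, c ≠ d ∧ c ≠ b ∧ d ≠ b ∧ W = {c, d, b} ∧ B₀ a c d)
    (hbad : Bad G S L p q r a c b) : OddType G S L p q r := by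
  have hTe : ∀ {a c d}, c ≠ d → B₀ a c d → T = {a, c, d} := by
    intro a c d hcd hB
    obtain ⟨ha, hc, hd, had, hac⟩ := hB₀ _ _ _ hB
    refine (Finset.eq_of_subset_of_card_le ?_ ?_).symm
    · intro x hx
      simp only [Finset.mem_insert, Finset.mem_singleton] at hx
      rcases hx with rfl | rfl | rfl <;> assumption
    · rw [hT, Finset.card_eq_three.2 ⟨a, c, d, hac, had, hcd, rfl⟩]
  obtain ⟨d, hcd, hcb, hdb, hW, hB⟩ := h _ _ _ hbad
  have hT1 := hTe hcd hB
  obtain ⟨-, -, -, had, hac⟩ := hB₀ _ _ _ hB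
  by_cases hTW : T = W
  · refine .inl ⟨T, hT, fun a' c' b' hb => ?_⟩
    obtain ⟨d', hcd', hcb', hdb', hW', hB'⟩ := h _ _ _ hb
    obtain ⟨ha, hc, -, had', hac'⟩ := hB₀ _ _ _ hB'
    refine ⟨?_, ha, hc⟩
    rw [hTW, hW'] at ha
    simp only [Finset.mem_insert, Finset.mem_singleton] at ha
    rcases ha with h | h | h
    exacts [absurd h hac', absurd h had', h]
  · have haW : a ∉ W := fun ha => by
      rw [hW] at ha
      simp only [Finset.mem_insert, Finset.mem_singleton] at ha
      rcases ha with h | h | h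
      · exact hac h
      · exact had h
      · refine hTW ?_
        rw [hT1, hW, h]
        ext x; simp; clear * -; tauto
    refine .inr ⟨a, b, c, d, fun hab => haW (by rw [hW, hab]; simp), fun a' c' b' hb => ?_⟩
    obtain ⟨d', hcd', hcb', hdb', hW', hB'⟩ := h _ _ _ hb
    have hT2 := hTe hcd' hB'
    have ha'W : a ∈ ({a', c', d'} : Finset ℕ) := by rw [← hT2, hT1]; simp
    have hcT : c' ∈ ({a, c, d} : Finset ℕ) := by rw [← hT1, hT2]; simp
    have hbW : b' ∈ ({c, d, b} : Finset ℕ) := by rw [← hW, hW']; simp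
    have hbT : b' ∉ T := fun hb' => by
      have hbT' := hb'
      rw [hT1] at hb'
      simp only [Finset.mem_insert, Finset.mem_singleton] at hb'
      have : b' ∈ W := by rw [hW']; simp
      rw [hT2] at hbT'
      simp only [Finset.mem_insert, Finset.mem_singleton] at hbT' ha'W
      rcases ha'W with h | h | h
      · rcases hbT' with h' | h' | h'
        exacts [haW (by rw [h, ← h']; exact this), hcb' h'.symm, hdb' h'.symm]
      · exact haW (by rw [h, hW']; simp)
      · exact haW (by rw [h, hW']; simp)
    simp only [Finset.mem_insert, Finset.mem_singleton] at ha'W hcT hbW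
    refine ⟨?_, ?_, ?_⟩
    · rcases ha'W with h | h | h
      · exact h.symm
      · exact absurd (by rw [h, hW']; simp) haW
      · exact absurd (by rw [h, hW']; simp) haW
    · rcases hbW with h | h | h
      · exact absurd (by rw [h, hT1]; simp) hbT
      · exact absurd (by rw [h, hT1]; simp) hbT
      · exact h
    · rcases hcT with h | h | h
      · exact absurd (by rw [← h, hW']; simp) haW
      · exact .inl h
      · exact .inr h

/-- One more triangle after an odd fan whose bad colourings agree in the colours of the ends. -/
theorem evenType_of_oddType {B₀ : ℕ → ℕ → ℕ → Prop} {W : Finset ℕ} {a₀ d₀ : ℕ}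
    (hB₀ : ∀ a c d, B₀ a c d → a = a₀ ∧ d = d₀)
    (h : ∀ a c b, Bad G S L p q r a c b →
      ∃ d, c ≠ d ∧ c ≠ b ∧ d ≠ b ∧ W = {c, d, b} ∧ B₀ a c d)
    (hr : ∀ a c b b', Bad G S L p q r a c b → Bad G S L p q r a c b' → b = b') :
    UniqueBad G S L p q r ∨ EvenType G S L p q r := by
  by_cases hu : ∃ a c b a' c' b', Bad G S L p q r a c b ∧ Bad G S L p q r a' c' b' ∧ c ≠ c'
  swap
  · push Not at hu
    by_cases hbad : ∃ a c b, Bad G S L p q r a c b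
    swap
    · exact .inl ⟨0, 0, 0, fun a c b hb => absurd ⟨a, c, b, hb⟩ hbad⟩
    obtain ⟨a, c, b, hbad⟩ := hbad
    refine .inl ⟨a, c, b, fun a' c' b' hb => ?_⟩
    obtain rfl := hu _ _ _ _ _ _ hbad hb
    obtain ⟨d, -, -, -, -, hd⟩ := h _ _ _ hbad
    obtain ⟨d', -, -, -, -, hd'⟩ := h _ _ _ hb
    have : a' = a := (hB₀ _ _ _ hd').1.trans (hB₀ _ _ _ hd).1.symm
    subst this
    exact ⟨rfl, rfl, hr _ _ _ _ hb hbad⟩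
  · right
    obtain ⟨a, c, b, a', c', b', hb, hb', hcc⟩ := hu
    obtain ⟨d, hcd, hcb, hdb, hW, hB⟩ := h _ _ _ hb
    obtain ⟨d', hcd', hcb', hdb', hW', hB'⟩ := h _ _ _ hb'
    obtain ⟨rfl, rfl⟩ := hB₀ _ _ _ hB
    obtain ⟨rfl, rfl⟩ := hB₀ _ _ _ hB'
    have hcb2 : b = c' := by
      have : c' ∈ ({c, d', b} : Finset ℕ) := by rw [← hW, hW']; simp
      simp only [Finset.mem_insert, Finset.mem_singleton] at this
      rcases this with h | h | h
      exacts [absurd h.symm hcc, absurd h hcd', h.symm]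
    subst hcb2
    refine ⟨{a', c, b}, Finset.card_eq_three.2 ⟨a', c, b, hb.1, hb'.1, hcb, rfl⟩,
      fun a₂ c₂ b₂ hb₂ => ?_⟩
    obtain ⟨d₂, hcd₂, hcb₂, hdb₂, hW₂, hB₂⟩ := h _ _ _ hb₂
    obtain ⟨rfl, rfl⟩ := hB₀ _ _ _ hB₂
    have m1 : c₂ ∈ ({c, d₂, b} : Finset ℕ) := by rw [← hW, hW₂]; simp
    have m2 : b₂ ∈ ({c, d₂, b} : Finset ℕ) := by rw [← hW, hW₂]; simp
    simp only [Finset.mem_insert, Finset.mem_singleton] at m1 m2 ⊢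
    have m1' : c₂ = c ∨ c₂ = b := m1.imp_right fun h => h.resolve_left hcd₂
    have m2' : b₂ = c ∨ b₂ = b := m2.imp_right fun h => h.resolve_left hdb₂.symm
    refine ⟨by simp, .inr m1', .inr m2', ?_⟩
    rcases m2' with rfl | rfl
    exacts [hb.1, hb'.1]

variable [Finite V]

/-- A boundary chord `qw` separates `p` from `r`. -/
theorem Rainbow.chord_separates (h : Rainbow G S O L p q r) (hI : Irred G S L p q r) {w : V}
    (hw : w ∈ S ∩ O) (e : G.Adj q w) (hwp : w ≠ p) (hwr : w ≠ r) :
    p ∉ comp G (S \ {q, w}) r := by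
  have key : ∀ x ∈ S ∩ O, G.Adj q x → w ≠ x → (x = p ∨ x = r) → (p ∉ comp G (S \ {q, x}) w) →
      r ∉ comp G (S \ {q, x}) w → False := by
    intro x hx eqx hwx hxpr hp hr
    have hk : w ∈ S \ {q, x} := ⟨hw.1, by simp [e.ne', hwx]⟩
    exact h.comp_meets_path hI h.hq hx eqx hk hp (fun h => (comp_subset hk h).2 (by simp)) hr
  rcases h.disc.exists_separator h.hq h.hp hw h.hr h.epq.symm e h.eqr hwp.symm hwr
    h.hpr.symm with h1 | h1 | h1
  · have hk : w ∈ S \ {q, r} := ⟨hw.1, by simp [e.ne', hwr]⟩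
    exact absurd (key r h.hr h.eqr hwr (.inr rfl) (fun hp => h1 (comp_symm hk hp))
      fun hr => (comp_subset hk hr).2 (by simp)) id
  · have hk : w ∈ S \ {q, p} := ⟨hw.1, by simp [e.ne', hwp]⟩
    exact absurd (key p h.hp h.epq.symm hwp (.inl rfl)
      (fun hr => (comp_subset hk hr).2 (by simp)) h1) id
  · exact h1

/-- The dichotomy in the presence of a chord `qw` such that `w` is adjacent to `r`. -/
theorem Rainbow.dichotomy_of_adj (h : Rainbow G S O L p q r) (hI : Irred G S L p q r)
    (IH : ∀ S' < S, ∀ (O' : Set V) (L' : V → Finset ℕ) (p' q' r' : V),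
      Rainbow G S' O' L' p' q' r' → ¬ G.Adj p' r' → Dichotomy G S' O' L' p' q' r') {w : V}
    (hw : w ∈ S ∩ O) (e : G.Adj q w) (hwp : w ≠ p) (ewr : G.Adj w r) :
    Dichotomy G S O L p q r := by
  have hwr := ewr.ne
  have hpK := h.chord_separates hI hw e hwp hwr
  have h0 := h.chord_left hw e hwp.symm hpK hwr
  have h1 := h.chord_right hw e hpK hwp.symm hwr
  have hsplit : ∀ a c b, Bad G S L p q r a c b → ∃ d, c ≠ d ∧ c ≠ b ∧ d ≠ b ∧ L w = {c, d, b} ∧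
      Bad G (S \ comp G (S \ {q, w}) r) L p q w a c d := by
    intro a c b hb
    obtain ⟨d, f, hcd, hcf, hdf, hLw, hb0, hb1⟩ := h.bad_split hw e hwp.symm hpK hwr hb
    obtain rfl := h1.eq_of_bad_of_adj ewr hb1
    exact ⟨d, hcd, hcf, hdf, hLw, hb0⟩
  by_cases hbad : ∃ a c b, Bad G S L p q r a c b
  swap
  · exact .inl ⟨0, 0, 0, fun a c b hb => absurd ⟨a, c, b, hb⟩ hbad⟩
  obtain ⟨a, c, b, hbad⟩ := hbad
  have hcard : (L w).card = 3 := by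
    obtain ⟨d, hcd, hcb, hdb, hW, -⟩ := hsplit _ _ _ hbad
    exact Finset.card_eq_three.2 ⟨c, d, b, hcd, hcb, hdb, hW⟩
  have even : (∀ a c d, Bad G (S \ comp G (S \ {q, w}) r) L p q w a c d → a = d) →
      EvenType G S L p q r := by
    refine fun hid => ⟨L w, hcard, fun a c b hb => ?_⟩
    obtain ⟨d, hcd, hcb, hdb, hW, hb0⟩ := hsplit _ _ _ hb
    obtain rfl := hid _ _ _ hb0
    rw [hW]
    simp [hdb]
  have fan : ∀ {Q : G.Walk p w}, IsFan (S \ comp G (S \ {q, w}) r) O q Q →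
      IsFan S O q (Q.concat ewr) := fun hQ =>
    hQ.concat Set.sdiff_subset ewr h.hr (fun hr => hr.2 mem_comp_self) h.eqr
  by_cases epw : G.Adj p w
  · refine .inr ⟨(SimpleGraph.Walk.cons epw .nil).concat ewr, fan ⟨by simp [hwp.symm], ?_⟩,
      .inl ⟨by simp [SimpleGraph.Walk.length_concat], even fun a c d hb => h0.eq_of_bad_of_adj epw hb⟩⟩
    intro x hx
    simp only [SimpleGraph.Walk.support_cons, SimpleGraph.Walk.support_nil, List.mem_cons,
      List.not_mem_nil, or_false] at hx
    rcases hx with rfl | rfl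
    exacts [⟨h0.hp, h.epq.symm⟩, ⟨h0.hr, e⟩]
  · have hlt : S \ comp G (S \ {q, w}) r < S :=
      ⟨Set.sdiff_subset, fun hS => (hS h.hr.1).2 mem_comp_self⟩
    rcases IH _ hlt _ _ _ _ _ h0 epw with ⟨a₀, c₀, b₀, hU⟩ |
      ⟨Q, hQ, ⟨hev, T, hT, hE⟩ | ⟨hodd, ⟨T, hT, hE⟩ | ⟨a₀, b₀, c₁, c₂, hab, hE⟩⟩⟩
    · refine .inl ⟨a, c, b, fun a' c' b' hb' => ?_⟩
      obtain ⟨d, -, -, -, -, hd⟩ := hsplit _ _ _ hbad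
      obtain ⟨d', -, -, -, -, hd'⟩ := hsplit _ _ _ hb'
      obtain ⟨rfl, rfl, -⟩ := hU _ _ _ hd
      obtain ⟨rfl, rfl, -⟩ := hU _ _ _ hd'
      exact ⟨rfl, rfl, h.bad_right_unique hb' hbad⟩
    · refine .inr ⟨Q.concat ewr, fan hQ, .inr ⟨by
        rw [SimpleGraph.Walk.length_concat]; exact hev.add_one, ?_⟩⟩
      exact oddType_of_evenType hT (fun a c d hb =>
        ⟨(hE _ _ _ hb).1, (hE _ _ _ hb).2.1, (hE _ _ _ hb).2.2.1, (hE _ _ _ hb).2.2.2, hb.1⟩)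
        hsplit hbad
    · exact .inr ⟨Q.concat ewr, fan hQ, .inl ⟨by
        rw [SimpleGraph.Walk.length_concat]; exact hodd.add_one,
        even fun a c d hb => (hE _ _ _ hb).1⟩⟩
    · rcases evenType_of_oddType (fun a c d hb => ⟨(hE _ _ _ hb).1, (hE _ _ _ hb).2.1⟩) hsplit
        (fun a c b b' => h.bad_right_unique) with hU | hU
      · exact .inl hU
      · exact .inr ⟨Q.concat ewr, fan hQ, .inl ⟨by
          rw [SimpleGraph.Walk.length_concat]; exact hodd.add_one, hU⟩⟩

/-- The dichotomy in the presence of any chord `qw`. -/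
theorem Rainbow.dichotomy_of_chord (h : Rainbow G S O L p q r) (hI : Irred G S L p q r)
    (IH : ∀ S' < S, ∀ (O' : Set V) (L' : V → Finset ℕ) (p' q' r' : V),
      Rainbow G S' O' L' p' q' r' → ¬ G.Adj p' r' → Dichotomy G S' O' L' p' q' r') {w : V}
    (hw : w ∈ S ∩ O) (e : G.Adj q w) (hwp : w ≠ p) (hwr : w ≠ r) :
    Dichotomy G S O L p q r := by
  by_cases ewr : G.Adj w r
  · exact h.dichotomy_of_adj hI IH hw e hwp ewr
  have hpK := h.chord_separates hI hw e hwp hwr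
  have h1 := h.chord_right hw e hpK hwp.symm hwr
  have hpS1 : p ∉ comp G (S \ {q, w}) r ∪ {q, w} := by
    rintro (h' | h' | h')
    exacts [hpK h', h.epq.ne h', hwp h'.symm]
  have hsub : comp G (S \ {q, w}) r ∪ {q, w} ⊆ S := by
    have hKS := comp_subset (H := G) (x := r) (T := S \ {q, w})
      ⟨h.hr.1, by simp [h.eqr.ne', hwr.symm]⟩
    rintro s (hs | rfl | rfl)
    exacts [(hKS hs).1, h.hq.1, hw.1]
  have hlt : comp G (S \ {q, w}) r ∪ {q, w} < S := ⟨hsub, fun hS => hpS1 (hS h.hp.1)⟩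
  rcases IH _ hlt _ _ _ _ _ h1 ewr with ⟨f₀, c₀, b₀, hU⟩ | ⟨Q, hQ, -⟩
  · left
    by_cases hbad : ∃ a c b, Bad G S L p q r a c b
    swap
    · exact ⟨0, 0, 0, fun a c b hb => absurd ⟨a, c, b, hb⟩ hbad⟩
    obtain ⟨a, c, b, hbad⟩ := hbad
    refine ⟨a, c, b, fun a' c' b' hb' => ?_⟩
    obtain ⟨d, f, -, -, -, -, -, hb1⟩ := h.bad_split hw e hwp.symm hpK hwr hbad
    obtain ⟨d', f', -, -, -, -, -, hb1'⟩ := h.bad_split hw e hwp.symm hpK hwr hb'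
    obtain ⟨rfl, rfl, rfl⟩ := hU _ _ _ hb1
    obtain ⟨rfl, rfl, rfl⟩ := hU _ _ _ hb1'
    exact ⟨h.bad_left_unique hb' hbad, rfl, rfl⟩
  · -- The penultimate vertex of the fan gives another chord.
    obtain ⟨y, hy, eqy, ery, -⟩ := h1.symm.fan_split (fun e => ewr e.symm) hQ.reverse
    exact h.dichotomy_of_adj hI IH ⟨hsub hy.1, hy.2⟩ eqy
      (by rintro rfl; exact hpS1 hy.1) ery.symm

/-- Induction on the vertex set. The existence of a hub for one rainbow relies on both statements for
smaller ones, since the dichotomy describes what remains of a kite without `p` and `q`. -/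
theorem hub_and_dichotomy (S : Set V) : ∀ (O : Set V) (L : V → Finset ℕ) (p q r : V),
    Rainbow G S O L p q r → (∀ a c b, Bad G S L p q r a c b → Hub G S O p q r) ∧
      (¬ G.Adj p r → Dichotomy G S O L p q r) := by
  induction S using WellFoundedLT.induction with
  | ind S IH =>
  intro O L p q r h
  have IH₁ : ∀ S' < S, ∀ (O' : Set V) (L' : V → Finset ℕ) (p' q' r' : V) (a' c' b' : ℕ),
      Rainbow G S' O' L' p' q' r' → Bad G S' L' p' q' r' a' c' b' → Hub G S' O' p' q' r' :=
    fun S' hS' O' L' p' q' r' a' c' b' h' => (IH S' hS' O' L' p' q' r' h').1 a' c' b'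
  have IH₂ : ∀ S' < S, ∀ (O' : Set V) (L' : V → Finset ℕ) (p' q' r' : V),
      Rainbow G S' O' L' p' q' r' → ¬ G.Adj p' r' → Dichotomy G S' O' L' p' q' r' :=
    fun S' hS' O' L' p' q' r' h' => (IH S' hS' O' L' p' q' r' h').2
  by_cases hI : Irred G S L p q r
  swap
  · obtain ⟨S', hS', h', hb⟩ := h.exists_reduction hI
    exact ⟨fun a c b hbad => (IH₁ S' hS' O L p q r a c b h' (hb a c b hbad)).mono hS'.le,
      fun npr => (IH₂ S' hS' O L p q r h' npr).mono hS'.le hb⟩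
  have str : ∀ a c b, Bad G S L p q r a c b → Hub G S O p q r := by
    intro a c b hbad
    by_contra hno
    have hT : Tight G S O L p q r :=
      { h with
        irred := hI
        npr := fun e => hno (.inl e)
        nchord := fun u hu e => by
          by_contra hcon
          push Not at hcon
          exact hno (.inr (.inl ⟨u, hu, e, hcon⟩)) }
    exact hno (.inr (.inr (hT.exists_hub hbad IH₁ IH₂)))
  refine ⟨str, fun npr => ?_⟩
  by_cases hch : ∃ w ∈ S ∩ O, G.Adj q w ∧ w ≠ p ∧ w ≠ r
  · obtain ⟨w, hw, e, hwp, hwr⟩ := hch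
    exact h.dichotomy_of_chord hI IH₂ hw e hwp hwr
  by_cases hbad : ∃ a c b, Bad G S L p q r a c b
  swap
  · exact .inl ⟨0, 0, 0, fun a c b hb => absurd ⟨a, c, b, hb⟩ hbad⟩
  obtain ⟨a, c, b, hbad⟩ := hbad
  have hT : Tight G S O L p q r :=
    { h with
      irred := hI
      npr := npr
      nchord := fun u hu e => by
        by_contra hcon
        push Not at hcon
        exact hch ⟨u, hu, e, hcon⟩ }
  rcases str a c b hbad with e | ⟨u, hu, e⟩ | ⟨z, hz, hzO, ezp, ezq, ezr⟩
  · exact absurd e npr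
  · exact absurd ⟨u, hu, e⟩ hch
  · exact .inl (hT.uniqueBad hz hzO ezp ezq ezr IH₂)

end Induction

/-! ### The cycle space over the field with two elements -/

section CycleSpace

variable {V : Type*}

theorem zmod_two_add_self (a : ZMod 2) : a + a = 0 := CharTwo.add_self_eq_zero a

/-- In a sum of a symmetric function over all pairs from a set, off-diagonal terms cancel. -/
theorem sum_sum_eq_zero_of_symm (S : Finset V) (z : V → V → ZMod 2) (h : ∀ x y, z x y = z y x)
    (h0 : ∀ x, z x x = 0) : ∑ x ∈ S, ∑ y ∈ S, z x y = 0 := by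
  classical
  rw [← Finset.sum_product']
  refine Finset.sum_involution (fun p _ => (p.2, p.1)) ?_ ?_ ?_ ?_
  · rintro ⟨x, y⟩ -
    simp only [h y x, zmod_two_add_self]
  · rintro ⟨x, y⟩ - hne heq
    simp only [Prod.mk.injEq] at heq
    exact hne (by rw [heq.1]; exact h0 _)
  · rintro ⟨x, y⟩ hxy
    simpa [and_comm] using hxy
  · rintro ⟨x, y⟩ -
    rfl

variable (G : SimpleGraph V)

open Classical in
/-- Functions on the edges as symmetric functions on the pairs of vertices. -/
noncomputable def edgeMap : (G.edgeSet → ZMod 2) →ₗ[ZMod 2] (V → V → ZMod 2) where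
  toFun w x y := if h : G.Adj x y then w ⟨s(x, y), h⟩ else 0
  map_add' w w' := by
    ext x y
    by_cases h : G.Adj x y <;> simp [h]
  map_smul' c w := by
    ext x y
    by_cases h : G.Adj x y <;> simp [h]

variable {G}

theorem edgeMap_of_adj (w : G.edgeSet → ZMod 2) {x y : V} (h : G.Adj x y) :
    edgeMap G w x y = w ⟨s(x, y), h⟩ := dif_pos h

theorem edgeMap_of_not_adj (w : G.edgeSet → ZMod 2) {x y : V} (h : ¬ G.Adj x y) :
    edgeMap G w x y = 0 := dif_neg h

theorem edgeMap_symm (w : G.edgeSet → ZMod 2) (x y : V) : edgeMap G w x y = edgeMap G w y x := by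
  by_cases h : G.Adj x y
  · rw [edgeMap_of_adj w h, edgeMap_of_adj w h.symm]
    congr 2
    exact Sym2.eq_swap
  · rw [edgeMap_of_not_adj w h, edgeMap_of_not_adj w fun e => h e.symm]

theorem edgeMap_injective : Function.Injective (edgeMap G) := by
  intro w w' h
  ext ⟨e, he⟩
  induction e with
  | h x y =>
    have := congrFun (congrFun h x) y
    rwa [edgeMap_of_adj w he, edgeMap_of_adj w' he] at this

variable [Fintype V]

open Classical in
/-- If a subspace contains all sums of the unit vectors of `x` and its representative, it contains
all functions whose sum over each class is zero. -/
theorem mem_of_single_add_single {M : Submodule (ZMod 2) (V → ZMod 2)} (rep : V → V)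
    {h : V → ZMod 2} (hM : ∀ x, h x ≠ 0 → Pi.single x 1 + Pi.single (rep x) 1 ∈ M)
    (hs : ∀ r, ∑ x with rep x = r, h x = 0) : h ∈ M := by
  have key : h = ∑ x, h x • (Pi.single x 1 + Pi.single (rep x) 1 : V → ZMod 2) := by
    ext r
    simp only [smul_add, Finset.sum_add_distrib, Pi.add_apply, Finset.sum_apply, Pi.smul_apply,
      Pi.single_apply, smul_eq_mul, mul_ite, mul_one, mul_zero]
    rw [Finset.sum_ite_eq Finset.univ r, if_pos (Finset.mem_univ r)]
    have : ∑ x, (if r = rep x then h x else 0) = 0 := by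
      refine (Finset.sum_congr rfl fun x _ => ?_).trans ((Finset.sum_filter _ _).symm.trans (hs r))
      exact if_congr eq_comm rfl rfl
    rw [this, add_zero]
  rw [key]
  refine Submodule.sum_mem _ fun x _ => ?_
  by_cases hx : h x = 0
  · rw [hx, zero_smul]; exact M.zero_mem
  · exact M.smul_mem _ (hM x hx)

/-- The cycle space of `G` over the field with two elements; its elements are given as symmetric
functions on the pairs of vertices. -/
def cycleSpace (G : SimpleGraph V) : Submodule (ZMod 2) (V → V → ZMod 2) where
  carrier := {z | (∀ x y, z x y = z y x) ∧ (∀ x y, ¬ G.Adj x y → z x y = 0) ∧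
    ∀ x, ∑ y, z x y = 0}
  zero_mem' := by simp
  add_mem' := by
    rintro z z' ⟨h1, h2, h3⟩ ⟨h1', h2', h3'⟩
    refine ⟨fun x y => ?_, fun x y h => ?_, fun x => ?_⟩
    · simp only [Pi.add_apply, h1 x y, h1' x y]
    · simp only [Pi.add_apply, h2 x y h, h2' x y h, add_zero]
    · simp only [Pi.add_apply, Finset.sum_add_distrib, h3, h3', add_zero]
  smul_mem' := by
    rintro c z ⟨h1, h2, h3⟩
    refine ⟨fun x y => ?_, fun x y h => ?_, fun x => ?_⟩
    · simp only [Pi.smul_apply, h1 x y]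
    · simp only [Pi.smul_apply, h2 x y h, smul_zero]
    · simp only [Pi.smul_apply, ← Finset.smul_sum, h3, smul_zero]

variable (G)

/-- The boundary of a function on the edges. -/
noncomputable def boundaryMap : (G.edgeSet → ZMod 2) →ₗ[ZMod 2] (V → ZMod 2) where
  toFun w x := ∑ y, edgeMap G w x y
  map_add' w w' := by
    ext x
    simp only [map_add, Pi.add_apply, Finset.sum_add_distrib]
  map_smul' c w := by
    ext x
    simp only [map_smul, Pi.smul_apply, Finset.smul_sum, RingHom.id_apply]

open Classical in
/-- The sums of a function over the components of `G`. -/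
noncomputable def componentSum : (V → ZMod 2) →ₗ[ZMod 2] (G.ConnectedComponent → ZMod 2) where
  toFun h c := ∑ x with G.connectedComponentMk x = c, h x
  map_add' w w' := by
    ext c
    simp only [Pi.add_apply, Finset.sum_add_distrib]
  map_smul' c w := by
    ext x
    simp only [Pi.smul_apply, Finset.smul_sum, RingHom.id_apply]

variable {G}

theorem map_edgeMap_ker : (LinearMap.ker (boundaryMap G)).map (edgeMap G) = cycleSpace G := by
  ext z
  constructor
  · rintro ⟨w, hw, rfl⟩
    exact ⟨edgeMap_symm w, fun x y => edgeMap_of_not_adj w, fun x => congrFun hw x⟩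
  · rintro ⟨h1, h2, h3⟩
    have he : edgeMap G (fun e => Sym2.lift ⟨z, h1⟩ e) = z := by
      ext x y
      by_cases h : G.Adj x y
      · rw [edgeMap_of_adj _ h]; rfl
      · rw [edgeMap_of_not_adj _ h, h2 x y h]
    refine ⟨_, ?_, he⟩
    change boundaryMap G _ = 0
    ext x
    change ∑ y, edgeMap G _ x y = 0
    rw [he]
    exact h3 x

open Classical in
theorem single_add_single_mem_range_of_adj {x y : V} (h : G.Adj x y) :
    (Pi.single x 1 + Pi.single y 1 : V → ZMod 2) ∈ LinearMap.range (boundaryMap G) := by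
  refine ⟨Pi.single ⟨s(x, y), h⟩ 1, ?_⟩
  have hval : ∀ a b, edgeMap G (Pi.single ⟨s(x, y), h⟩ 1) a b =
      if s(a, b) = s(x, y) then 1 else 0 := by
    intro a b
    by_cases hab : G.Adj a b
    · rw [edgeMap_of_adj _ hab, Pi.single_apply]
      exact if_congr Subtype.ext_iff rfl rfl
    · rw [edgeMap_of_not_adj _ hab, if_neg]
      intro he
      refine hab ?_
      rw [← SimpleGraph.mem_edgeSet, he]
      exact h
  ext a
  change ∑ b, edgeMap G _ a b = _
  simp only [hval, Pi.add_apply, Pi.single_apply]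
  by_cases hax : a = x
  · subst hax
    simp [h.ne]
  by_cases hay : a = y
  · subst hay
    have : ∀ b, s(a, b) = s(x, a) ↔ b = x := fun b => by
      simp [hax]
    simp [this, hax]
  · simp [hax, hay]

open Classical in
theorem single_add_single_mem_range {x y : V} (h : G.Reachable x y) :
    (Pi.single x 1 + Pi.single y 1 : V → ZMod 2) ∈ LinearMap.range (boundaryMap G) := by
  obtain ⟨Q⟩ := h
  induction Q with
  | nil =>
    convert (LinearMap.range (boundaryMap G)).zero_mem
    ext; exact zmod_two_add_self _
  | @cons a b c e Q ih =>
    have := (LinearMap.range (boundaryMap G)).add_mem (single_add_single_mem_range_of_adj e) ih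
    convert this using 1
    have h2 : (Pi.single b 1 + Pi.single b 1 : V → ZMod 2) = 0 := by
      ext; exact zmod_two_add_self _
    rw [add_assoc, ← add_assoc (Pi.single b 1), h2, zero_add]

theorem range_boundaryMap : LinearMap.range (boundaryMap G) = LinearMap.ker (componentSum G) := by
  classical
  apply le_antisymm
  · rintro _ ⟨w, rfl⟩
    change componentSum G _ = 0
    ext c
    change ∑ x with G.connectedComponentMk x = c, ∑ y, edgeMap G w x y = 0
    rw [← sum_sum_eq_zero_of_symm (Finset.univ.filter fun x => G.connectedComponentMk x = c)
      (edgeMap G w) (edgeMap_symm w) fun x => edgeMap_of_not_adj w G.irrefl]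
    refine Finset.sum_congr rfl fun x hx => ?_
    rw [Finset.sum_filter]
    refine Finset.sum_congr rfl fun y _ => ?_
    split_ifs with hy
    · rfl
    · refine edgeMap_of_not_adj w fun e => hy ?_
      rw [← (Finset.mem_filter.1 hx).2]
      exact SimpleGraph.ConnectedComponent.sound e.symm.reachable
  · intro h hh
    refine mem_of_single_add_single (fun x => (G.connectedComponentMk x).out) (fun x _ =>
      single_add_single_mem_range (SimpleGraph.ConnectedComponent.exact (Quot.out_eq _).symm))
      fun r => ?_
    by_cases hr : (G.connectedComponentMk r).out = r
    · rw [← show componentSum G h (G.connectedComponentMk r) = 0 by rw [hh]; rfl]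
      refine Finset.sum_congr (Finset.filter_congr fun x _ => ?_) fun _ _ => rfl
      constructor
      · intro h
        rw [← h]
        exact (Quot.out_eq _).symm
      · intro h
        rw [h, hr]
    · rw [Finset.filter_false_of_mem fun x _ hx => hr ?_, Finset.sum_empty]
      rw [← hx]
      congr 1
      exact Quot.out_eq _

theorem componentSum_surjective : Function.Surjective (componentSum G) := by
  classical
  intro g
  refine ⟨fun x => if x = (G.connectedComponentMk x).out then g (G.connectedComponentMk x) else 0,
    ?_⟩
  ext c
  change ∑ x with G.connectedComponentMk x = c, _ = g c
  have hc : G.connectedComponentMk c.out = c := Quot.out_eq _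
  rw [Finset.sum_eq_single c.out]
  · rw [hc, if_pos rfl]
  · intro x hx hne
    rw [(Finset.mem_filter.1 hx).2, if_neg hne]
  · intro hn
    refine absurd ?_ hn
    rw [Finset.mem_filter]
    exact ⟨Finset.mem_univ _, hc⟩

/-- The dimension of the cycle space. -/
theorem finrank_cycleSpace :
    Module.finrank (ZMod 2) (cycleSpace G) + Nat.card V =
      Nat.card G.edgeSet + Nat.card G.ConnectedComponent := by
  classical
  have h1 := LinearMap.finrank_range_add_finrank_ker (boundaryMap G)
  have h2 := LinearMap.finrank_range_add_finrank_ker (componentSum G)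
  rw [LinearMap.range_eq_top.2 componentSum_surjective, finrank_top, ← range_boundaryMap] at h2
  rw [← map_edgeMap_ker,
    ← (Submodule.equivMapOfInjective _ edgeMap_injective (LinearMap.ker (boundaryMap G))).finrank_eq]
  rw [Module.finrank_fintype_fun_eq_card, ← Nat.card_eq_fintype_card] at h1 h2
  rw [Module.finrank_fintype_fun_eq_card, ← Nat.card_eq_fintype_card] at h2
  omega

end CycleSpace

/-! ### The faces of a planar rotation system span the cycle space -/

section Faces

variable {V : Type*} {G : SimpleGraph V}

/-- The face to the side of a dart. -/
def RotationSystem.face (R : RotationSystem G) (d : G.Dart) : R.Face :=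
  Quotient.mk (Equiv.Perm.SameCycle.setoid R.facePerm) d

theorem RotationSystem.face_facePerm (R : RotationSystem G) (d : G.Dart) :
    R.face (R.facePerm d) = R.face d :=
  Quotient.sound (s := Equiv.Perm.SameCycle.setoid R.facePerm)
    (Equiv.Perm.sameCycle_apply_left.2 (Equiv.Perm.SameCycle.refl _ _))

theorem RotationSystem.facePerm_symm (R : RotationSystem G) (d : G.Dart) :
    R.facePerm d.symm = R.next d := by
  simp [RotationSystem.facePerm]

theorem RotationSystem.fst_next (R : RotationSystem G) (d : G.Dart) : (R.next d).fst = d.fst :=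
  (R.sameCycle_iff _ _).1 (Equiv.Perm.sameCycle_apply_left.2 (Equiv.Perm.SameCycle.refl _ _))

theorem Equiv.Perm.SameCycle.apply_eq {α β : Type*} [Finite α] {σ : Equiv.Perm α} {F : α → β}
    (hF : ∀ d, F (σ d) = F d) {d e : α} (h : σ.SameCycle d e) : F d = F e := by
  obtain ⟨n, rfl⟩ := h.exists_nat_pow_eq
  induction n with
  | zero => rfl
  | succ n ih => rw [pow_succ', Equiv.Perm.mul_apply, hF, ih ⟨n, by simp⟩]

open Classical in
/-- The coboundary of a function on the faces. -/
noncomputable def RotationSystem.faceMap (R : RotationSystem G) :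
    (R.Face → ZMod 2) →ₗ[ZMod 2] (V → V → ZMod 2) where
  toFun f x y := if h : G.Adj x y then f (R.face ⟨(x, y), h⟩) + f (R.face ⟨(y, x), h.symm⟩) else 0
  map_add' f f' := by
    ext x y
    by_cases h : G.Adj x y
    · simp only [h, dite_true, Pi.add_apply]; abel
    · simp [h]
  map_smul' c f := by
    ext x y
    by_cases h : G.Adj x y
    · simp only [h, dite_true, Pi.smul_apply, smul_add, RingHom.id_apply]
    · simp [h]

theorem RotationSystem.faceMap_of_adj (R : RotationSystem G) (f : R.Face → ZMod 2) {x y : V}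
    (h : G.Adj x y) : R.faceMap f x y = f (R.face ⟨(x, y), h⟩) + f (R.face ⟨(y, x), h.symm⟩) :=
  dif_pos h

theorem RotationSystem.faceMap_of_not_adj (R : RotationSystem G) (f : R.Face → ZMod 2) {x y : V}
    (h : ¬ G.Adj x y) : R.faceMap f x y = 0 := dif_neg h

open Classical in
theorem RotationSystem.sum_next [Fintype G.Dart] (R : RotationSystem G) (x : V)
    (F : G.Dart → ZMod 2) :
    ∑ d with d.fst = x, F (R.next d) = ∑ d : G.Dart with d.fst = x, F d :=
  Finset.sum_equiv R.next (by simp [R.fst_next]) fun _ _ => rfl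

variable [Fintype V]

open Classical in
/-- A sum over the neighbours of a vertex, as a sum over darts. -/
theorem sum_dart [Fintype G.Dart] {x : V} {z : V → ZMod 2} {F : G.Dart → ZMod 2}
    (h : ∀ y (e : G.Adj x y), z y = F ⟨(x, y), e⟩) (h0 : ∀ y, ¬ G.Adj x y → z y = 0) :
    ∑ y, z y = ∑ d with d.fst = x, F d := by
  rw [← Finset.sum_fiberwise _ fun d : G.Dart => d.snd]
  refine Finset.sum_congr rfl fun y _ => ?_
  rw [Finset.filter_filter]
  by_cases e : G.Adj x y
  · rw [h y e, Finset.sum_eq_single_of_mem ⟨(x, y), e⟩ (by simp)]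
    rintro ⟨⟨a, b⟩, e'⟩ hd hne
    obtain ⟨rfl, rfl⟩ : a = x ∧ b = y := by simpa using hd
    exact absurd rfl hne
  · rw [h0 y e, Finset.filter_false_of_mem, Finset.sum_empty]
    rintro ⟨⟨a, b⟩, e'⟩ - ⟨ha, hb⟩
    obtain rfl : a = x := ha
    obtain rfl : b = y := hb
    exact e e'

theorem RotationSystem.range_faceMap_le (R : RotationSystem G) :
    LinearMap.range R.faceMap ≤ cycleSpace G := by
  classical
  have := Fintype.ofFinite G.Dart
  rintro _ ⟨f, rfl⟩
  refine ⟨fun x y => ?_, fun x y => R.faceMap_of_not_adj f, fun x => ?_⟩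
  · by_cases h : G.Adj x y
    · rw [R.faceMap_of_adj f h, R.faceMap_of_adj f h.symm, add_comm]
    · rw [R.faceMap_of_not_adj f h, R.faceMap_of_not_adj f fun e => h e.symm]
  · rw [sum_dart (F := fun d => f (R.face d) + f (R.face d.symm))
      (fun y e => R.faceMap_of_adj f e) fun y => R.faceMap_of_not_adj f, Finset.sum_add_distrib]
    have : ∀ d, f (R.face d.symm) = f (R.face (R.next d)) := fun d => by
      rw [← R.facePerm_symm, R.face_facePerm]
    simp only [this]
    rw [R.sum_next x fun d => f (R.face d)]
    exact zmod_two_add_self _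

/-- By Euler's formula, the boundaries of the faces span the cycle space: functions on the faces
(and isolated vertices) with zero coboundary are constant on components. -/
theorem RotationSystem.IsPlanar.range_faceMap {R : RotationSystem G} (h : R.IsPlanar) :
    LinearMap.range R.faceMap = cycleSpace G := by
  classical
  have := Fintype.ofFinite G.Dart
  have : Finite R.Face := Quotient.finite _
  have := Fintype.ofFinite R.Face
  have := Fintype.ofFinite G.ConnectedComponent
  let I := {v : V // ∀ w, ¬ G.Adj v w}
  have := Fintype.ofFinite I
  let m : R.Face ⊕ I → G.ConnectedComponent :=
    Sum.elim (fun F => G.connectedComponentMk (Quotient.out F).fst)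
      fun v => G.connectedComponentMk v
  let A : (R.Face ⊕ I → ZMod 2) →ₗ[ZMod 2] (V → V → ZMod 2) :=
    R.faceMap ∘ₗ LinearMap.funLeft (ZMod 2) (ZMod 2) Sum.inl
  have hA : LinearMap.range A = LinearMap.range R.faceMap := by
    refine LinearMap.range_comp_of_range_eq_top _ (LinearMap.range_eq_top.2
      (LinearMap.funLeft_surjective_of_injective _ _ _ Sum.inl_injective))
  have hker : LinearMap.ker A ≤ LinearMap.range (LinearMap.funLeft (ZMod 2) (ZMod 2) m) := by
    intro f hf
    have hf' : ∀ x y (e : G.Adj x y),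
        f (.inl (R.face ⟨(x, y), e⟩)) = f (.inl (R.face ⟨(y, x), e.symm⟩)) := by
      intro x y e
      have := congrFun (congrFun (show R.faceMap (fun F => f (.inl F)) = 0 from hf) x) y
      rw [R.faceMap_of_adj _ e] at this
      exact (CharTwo.add_eq_zero).1 this
    have hnext : ∀ d, f (.inl (R.face (R.next d))) = f (.inl (R.face d)) := fun d => by
      rw [← R.facePerm_symm, R.face_facePerm]
      exact (hf' _ _ d.adj).symm
    have hfst : ∀ d e : G.Dart, d.fst = e.fst → f (.inl (R.face d)) = f (.inl (R.face e)) :=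
      fun d e hde => Equiv.Perm.SameCycle.apply_eq (F := fun d => f (.inl (R.face d))) hnext
        ((R.sameCycle_iff d e).2 hde)
    -- The value of `f` around a vertex is the same for adjacent vertices.
    let P : V → ZMod 2 → Prop := fun x s => (∀ d : G.Dart, d.fst = x → f (.inl (R.face d)) = s) ∧
      ∀ v : I, (v : V) = x → f (.inr v) = s
    have hex : ∀ x, ∃ s, P x s := by
      intro x
      by_cases hx : ∃ d : G.Dart, d.fst = x
      · obtain ⟨d, hd⟩ := hx
        refine ⟨f (.inl (R.face d)), fun d' hd' => hfst _ _ (hd'.trans hd.symm), ?_⟩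
        rintro ⟨v, hv⟩ rfl
        exact absurd (hd ▸ d.adj) (hv _)
      · have hx' : ∀ w, ¬ G.Adj x w := fun w e => hx ⟨⟨(x, w), e⟩, rfl⟩
        refine ⟨f (.inr ⟨x, hx'⟩), fun d hd => absurd ⟨d, hd⟩ hx, ?_⟩
        rintro ⟨v, hv⟩ rfl
        rfl
    have hadj : ∀ x y s, G.Adj x y → P x s → P y s := by
      intro x y s e hx
      refine ⟨fun d hd => ?_, ?_⟩
      · exact (hfst d ⟨(y, x), e.symm⟩ hd).trans ((hf' x y e).symm.trans (hx.1 ⟨(x, y), e⟩ rfl))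
      · rintro ⟨v, hv⟩ rfl
        exact absurd e.symm (hv _)
    have hreach : ∀ x y s, G.Reachable x y → P x s → P y s := by
      rintro x y s ⟨Q⟩ hx
      induction Q with
      | nil => exact hx
      | cons e Q ih => exact ih (hadj _ _ _ e hx)
    have hval : ∀ i : R.Face ⊕ I, ∃ x, m i = G.connectedComponentMk x ∧ ∀ s, P x s → f i = s := by
      rintro (F | v)
      · refine ⟨_, rfl, fun s hs => ?_⟩
        rw [← hs.1 _ rfl]
        exact congrArg (fun F => f (.inl F)) (Quotient.out_eq F).symm
      · exact ⟨v, rfl, fun s hs => hs.2 v rfl⟩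
    have hfac : Function.FactorsThrough f m := by
      intro i j hij
      obtain ⟨x, hx, hxs⟩ := hval i
      obtain ⟨y, hy, hys⟩ := hval j
      obtain ⟨s, hs⟩ := hex x
      rw [hxs s hs, hys s (hreach x y s (SimpleGraph.ConnectedComponent.exact
        (hx.symm.trans (hij.trans hy))) hs)]
    obtain ⟨g, hg⟩ := (Function.factorsThrough_iff _).1 hfac
    exact ⟨g, hg.symm⟩
  have h1 := LinearMap.finrank_range_add_finrank_ker A
  have h2 := (Submodule.finrank_mono hker).trans (LinearMap.finrank_range_le _)
  have h3 := finrank_cycleSpace (G := G)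
  rw [hA, Module.finrank_fintype_fun_eq_card, Fintype.card_sum] at h1
  rw [Module.finrank_fintype_fun_eq_card] at h2
  simp only [← Nat.card_eq_fintype_card] at h1 h2
  have h4 : Nat.card V + (Nat.card R.Face + Nat.card I) =
    Nat.card G.edgeSet + 2 * Nat.card G.ConnectedComponent := h
  exact Submodule.eq_of_le_of_finrank_le R.range_faceMap_le (by omega)

end Faces

/-! ### Duals and minors -/

section Dual

variable {V ι : Type*}

open Classical in
/-- The coboundary of a function `f` on `ι`, where `ℓ x y` is the side of the edge `xy` seen in the
direction from `x` to `y`. -/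
noncomputable def labelMap (G : SimpleGraph V) (ℓ : V → V → ι) :
    (ι → ZMod 2) →ₗ[ZMod 2] (V → V → ZMod 2) where
  toFun f x y := if G.Adj x y then f (ℓ x y) + f (ℓ y x) else 0
  map_add' f f' := by
    ext x y
    by_cases h : G.Adj x y
    · simp only [h, if_true, Pi.add_apply]; abel
    · simp [h]
  map_smul' c f := by
    ext x y
    by_cases h : G.Adj x y
    · simp only [h, if_true, Pi.smul_apply, smul_add, RingHom.id_apply]
    · simp [h]

/-- An algebraic dual of `G`, in the sense of MacLane: the sides `ℓ x y` of the edges are such that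
the coboundaries of the functions on `ι` are precisely the elements of the cycle space. -/
def IsDual [Fintype V] (G : SimpleGraph V) (ℓ : V → V → ι) : Prop :=
  LinearMap.range (labelMap G ℓ) = cycleSpace G

variable {G : SimpleGraph V} {ℓ : V → V → ι}

theorem labelMap_of_adj (f : ι → ZMod 2) {x y : V} (h : G.Adj x y) :
    labelMap G ℓ f x y = f (ℓ x y) + f (ℓ y x) := if_pos h

theorem labelMap_of_not_adj (f : ι → ZMod 2) {x y : V} (h : ¬ G.Adj x y) :
    labelMap G ℓ f x y = 0 := if_neg h

theorem labelMap_symm (f : ι → ZMod 2) (x y : V) : labelMap G ℓ f x y = labelMap G ℓ f y x := by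
  by_cases h : G.Adj x y
  · rw [labelMap_of_adj f h, labelMap_of_adj f h.symm, add_comm]
  · rw [labelMap_of_not_adj f h, labelMap_of_not_adj f fun e => h e.symm]

theorem isDual_of [Fintype V] (h1 : ∀ f x, ∑ y, labelMap G ℓ f x y = 0)
    (h2 : ∀ z ∈ cycleSpace G, ∃ f : ι → ZMod 2, ∀ x y, G.Adj x y → z x y = f (ℓ x y) + f (ℓ y x)) :
    IsDual G ℓ := by
  apply le_antisymm
  · rintro _ ⟨f, rfl⟩
    exact ⟨labelMap_symm f, fun x y => labelMap_of_not_adj f, h1 f⟩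
  · intro z hz
    obtain ⟨f, hf⟩ := h2 z hz
    refine ⟨f, ?_⟩
    ext x y
    by_cases h : G.Adj x y
    · rw [labelMap_of_adj f h, hf x y h]
    · rw [labelMap_of_not_adj f h, hz.2.1 x y h]

/-- A function on a connected set whose sum vanishes is the boundary of a function on the edges
inside the set. -/
theorem ConnSet.exists_boundary [Fintype V] {A : Set V} (hA : ConnSet G A) {h : V → ZMod 2}
    (h0 : ∀ x ∉ A, h x = 0) (hs : ∑ x, h x = 0) :
    ∃ z : V → V → ZMod 2, (∀ x y, z x y = z y x) ∧
      (∀ x y, ¬ (G.Adj x y ∧ x ∈ A ∧ y ∈ A) → z x y = 0) ∧ ∀ x, ∑ y, z x y = h x := by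
  classical
  let H : SimpleGraph V :=
    { Adj := fun x y => G.Adj x y ∧ x ∈ A ∧ y ∈ A
      symm := ⟨fun x y e => ⟨e.1.symm, e.2.2, e.2.1⟩⟩
      loopless := ⟨fun x e => G.irrefl e.1⟩ }
  obtain ⟨⟨a, ha⟩, hconn⟩ := hA
  have hreach : ∀ x ∈ A, H.Reachable x a := by
    intro x hx
    have key : ∀ y, Relation.ReflTransGen (fun a b => G.Adj a b ∧ b ∈ A) x y →
        H.Reachable x y ∧ y ∈ A := by
      intro y hy
      induction hy with
      | refl => exact ⟨.refl _, hx⟩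
      | tail _ hbc ih =>
        exact ⟨ih.1.trans (SimpleGraph.Adj.reachable (G := H) ⟨hbc.1, ih.2, hbc.2⟩), hbc.2⟩
    exact (key a (hconn x hx a ha)).1
  obtain ⟨w, hw⟩ : h ∈ LinearMap.range (boundaryMap H) := by
    refine mem_of_single_add_single (fun _ => a) (fun x hx => single_add_single_mem_range
      (hreach x (by_contra fun hxA => hx (h0 x hxA)))) fun r => ?_
    by_cases hr : a = r
    · rw [Finset.filter_true_of_mem fun _ _ => hr, hs]
    · rw [Finset.filter_false_of_mem fun _ _ => hr, Finset.sum_empty]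
  exact ⟨edgeMap H w, edgeMap_symm w, fun x y e => edgeMap_of_not_adj w e, congrFun hw⟩

end Dual

section Minor

variable {W κ ι : Type*} [Fintype W] [Fintype κ] {H : SimpleGraph W} {Γ : SimpleGraph κ}
  {ℓ : W → W → ι} {T : Set W}

/-- A minor of a graph with an algebraic dual has one: deleting an edge identifies its two sides,
and contracting an edge deletes it from the dual. -/
theorem IsDual.of_hasModel (hℓ : IsDual H ℓ) (hM : HasModel Γ H T) :
    ∃ (s : Setoid ι) (ℓ' : κ → κ → Quotient s), IsDual Γ ℓ' := by
  classical
  obtain ⟨A, hA, hdisj, htouch⟩ := hM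
  have huniq : ∀ {k l x}, x ∈ A k → x ∈ A l → k = l := by
    intro k l x hk hl
    by_contra hne
    exact Set.disjoint_left.1 (hdisj k l hne) hk hl
  -- For each edge `kl` of `Γ` choose one edge joining `v k l` in `A k` to `v l k` in `A l`.
  obtain ⟨v, hv, hvadj⟩ : ∃ v : κ → κ → W, (∀ k l, Γ.Adj k l → v k l ∈ A k) ∧
      ∀ k l, Γ.Adj k l → H.Adj (v k l) (v l k) := by
    have hpair : ∀ k l, ∃ x ∈ A k, ∃ y ∈ A l, Γ.Adj k l → H.Adj x y := by
      intro k l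
      by_cases h : Γ.Adj k l
      · obtain ⟨x, hx, y, hy, e⟩ := htouch k l h
        exact ⟨x, hx, y, hy, fun _ => e⟩
      · obtain ⟨x, hx⟩ := (hA k).2.1
        obtain ⟨y, hy⟩ := (hA l).2.1
        exact ⟨x, hx, y, hy, fun h' => absurd h' h⟩
    choose x hx y hy e using hpair
    let n := Fintype.equivFin κ
    refine ⟨fun k l => if n k < n l then x k l else y l k, fun k l h => ?_, fun k l h => ?_⟩
    · dsimp only
      split_ifs
      exacts [hx k l, hy l k]
    · have hne : n k ≠ n l := fun he => h.ne (n.injective he)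
      dsimp only
      rcases lt_or_gt_of_ne hne with hlt | hlt
      · rw [if_pos hlt, if_neg hlt.not_gt]
        exact e k l h
      · rw [if_neg hlt.not_gt, if_pos hlt]
        exact (e l k h.symm).symm
  let internal : W → W → Prop := fun x y => ∃ k, x ∈ A k ∧ y ∈ A k
  let cross : W → W → Prop := fun x y => ∃ k l, Γ.Adj k l ∧ x = v k l ∧ y = v l k
  have hcross : ∀ {x y}, cross x y → cross y x := fun ⟨k, l, e, hx, hy⟩ => ⟨l, k, e.symm, hy, hx⟩
  let s : Setoid ι := Relation.EqvGen.setoid fun i j =>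
    ∃ x y, H.Adj x y ∧ ¬ internal x y ∧ ¬ cross x y ∧ i = ℓ x y ∧ j = ℓ y x
  let π : ι → Quotient s := Quotient.mk s
  have hπ : ∀ {x y}, H.Adj x y → ¬ internal x y → ¬ cross x y → π (ℓ x y) = π (ℓ y x) :=
    fun h h1 h2 => Quotient.sound (Relation.EqvGen.rel _ _ ⟨_, _, h, h1, h2, rfl, rfl⟩)
  -- A function on the pairs which lives on the edges of the model has the same boundary
  -- as its projection to `Γ`.
  have hsum : ∀ z : W → W → ZMod 2, (∀ x y, z x y = z y x) → (∀ x, z x x = 0) →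
      (∀ x y, ¬ internal x y → ¬ cross x y → z x y = 0) → ∀ k,
      ∑ x with x ∈ A k, ∑ y, z x y = ∑ l, if Γ.Adj k l then z (v k l) (v l k) else 0 := by
    intro z hz1 hz0 hz2 k
    have e1 : ∀ x, ∑ y, z x y =
        ∑ y with y ∈ A k, z x y + ∑ y with y ∉ A k, z x y := fun x =>
      (Finset.sum_filter_add_sum_filter_not _ _ _).symm
    simp only [e1, Finset.sum_add_distrib]
    rw [sum_sum_eq_zero_of_symm _ z hz1 hz0, zero_add, ← Finset.sum_filter, ← Finset.sum_product']
    symm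
    refine Finset.sum_of_injOn (fun l => (v k l, v l k)) ?_ ?_ ?_ fun _ _ => rfl
    · intro l hl l' hl' heq
      simp only [Finset.coe_filter, Finset.mem_univ, true_and, Set.mem_ofPred_eq] at hl hl'
      simp only [Prod.mk.injEq] at heq
      exact huniq (hv l k hl.symm) (heq.2 ▸ hv l' k hl'.symm)
    · intro l hl
      simp only [Finset.coe_filter, Finset.mem_univ, true_and, Set.mem_ofPred_eq] at hl
      simp only [Finset.coe_product, Finset.coe_filter, Finset.mem_univ, true_and, Set.mem_prod,
        Set.mem_ofPred_eq]
      exact ⟨hv k l hl, fun h => hl.ne (huniq h (hv l k hl.symm))⟩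
    · rintro ⟨x, y⟩ hxy hno
      simp only [Finset.mem_product, Finset.mem_filter, Finset.mem_univ, true_and] at hxy
      refine hz2 x y ?_ ?_
      · rintro ⟨k', hx, hy⟩
        exact hxy.2 (huniq hxy.1 hx ▸ hy)
      · rintro ⟨k', l, e, rfl, rfl⟩
        obtain rfl := huniq hxy.1 (hv _ _ e)
        exact hno ⟨l, by simpa using e, rfl⟩
  refine ⟨s, fun k l => π (ℓ (v k l) (v l k)), isDual_of (fun f k => ?_) fun ζ hζ => ?_⟩
  · have hz := hsum (labelMap H ℓ (f ∘ π)) (labelMap_symm _)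
      (fun x => labelMap_of_not_adj _ H.irrefl) (fun x y h1 h2 => by
        by_cases h : H.Adj x y
        · rw [labelMap_of_adj _ h]
          simp only [Function.comp_apply, hπ h h1 h2, zmod_two_add_self]
        · exact labelMap_of_not_adj _ h) k
    have hc : labelMap H ℓ (f ∘ π) ∈ cycleSpace H := hℓ ▸ ⟨_, rfl⟩
    simp only [hc.2.2, Finset.sum_const_zero] at hz
    rw [hz]
    refine Finset.sum_congr rfl fun l _ => ?_
    by_cases h : Γ.Adj k l
    · rw [labelMap_of_adj _ h, if_pos h, labelMap_of_adj _ (hvadj k l h)]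
      rfl
    · rw [labelMap_of_not_adj _ h, if_neg h]
  · obtain ⟨hζ1, hζ2, hζ3⟩ := hζ
    -- Lift `ζ` to the edges joining the branch sets, and correct the boundary inside of them.
    obtain ⟨zc, hzc, hzc0⟩ : ∃ zc : W → W → ZMod 2,
        (∀ k l, Γ.Adj k l → zc (v k l) (v l k) = ζ k l) ∧ ∀ x y, ¬ cross x y → zc x y = 0 := by
      refine ⟨fun x y => if h : cross x y then ζ h.choose h.choose_spec.choose else 0,
        fun k l e => ?_, fun x y h => dif_neg h⟩
      have hmem : ∀ {x y : W} {m}, x = y → y ∈ A m → x ∈ A m := fun h hy => h ▸ hy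
      have h : cross (v k l) (v l k) := ⟨k, l, e, rfl, rfl⟩
      obtain ⟨e', h1, h2⟩ := h.choose_spec.choose_spec
      refine (dif_pos h).trans (congrArg₂ ζ (huniq ?_ (hv k l e)) (huniq ?_ (hv l k e.symm)))
      · exact hmem h1 (hv _ _ e')
      · exact hmem h2 (hv _ _ e'.symm)
    have hzcs : ∀ x y, zc x y = zc y x := by
      intro x y
      by_cases h : cross x y
      · obtain ⟨k, l, e, rfl, rfl⟩ := h
        rw [hzc k l e, hzc l k e.symm, hζ1]
      · rw [hzc0 x y h, hzc0 y x fun h' => h (hcross h')]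
    have hzcx : ∀ x, zc x x = 0 := by
      refine fun x => hzc0 x x ?_
      rintro ⟨k, l, e, h1, h2⟩
      exact H.irrefl (h2.symm.trans h1 ▸ hvadj k l e)
    have hcorr : ∀ k, ∃ z : W → W → ZMod 2, (∀ x y, z x y = z y x) ∧
        (∀ x y, ¬ (H.Adj x y ∧ x ∈ A k ∧ y ∈ A k) → z x y = 0) ∧
        ∀ x, ∑ y, z x y = if x ∈ A k then ∑ y, zc x y else 0 := by
      intro k
      refine (hA k).2.exists_boundary (fun x hx => if_neg hx) ?_
      rw [← Finset.sum_filter, hsum zc hzcs hzcx (fun x y _ h => hzc0 x y h) k]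
      refine (Finset.sum_congr rfl fun l _ => ?_).trans (hζ3 k)
      split_ifs with h
      exacts [hzc k l h, (hζ2 k l h).symm]
    choose zi hzi1 hzi2 hzi3 using hcorr
    have hz : (fun x y => zc x y + ∑ k, zi k x y) ∈ cycleSpace H := by
      refine ⟨fun x y => ?_, fun x y h => ?_, fun x => ?_⟩
      · simp only [hzcs x y, fun k => hzi1 k x y]
      · dsimp only
        rw [hzc0 x y, Finset.sum_eq_zero, add_zero]
        · exact fun k _ => hzi2 k x y fun h' => h h'.1
        · rintro ⟨k, l, e, rfl, rfl⟩
          exact h (hvadj k l e)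
      · rw [Finset.sum_add_distrib, Finset.sum_comm]
        simp only [hzi3]
        by_cases hx : ∃ k, x ∈ A k
        · obtain ⟨k, hk⟩ := hx
          rw [Finset.sum_eq_single_of_mem k (Finset.mem_univ k), if_pos hk, zmod_two_add_self]
          exact fun l _ hne => if_neg fun hl => hne (huniq hl hk)
        · push Not at hx
          rw [Finset.sum_eq_zero fun k _ => if_neg (hx k), add_zero]
          refine Finset.sum_eq_zero fun y _ => hzc0 x y ?_
          rintro ⟨k, l, e, rfl, rfl⟩
          exact hx k (hv k l e)
    rw [← hℓ] at hz
    obtain ⟨f, hf⟩ := hz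
    have hf' : ∀ x y, H.Adj x y → f (ℓ x y) + f (ℓ y x) = zc x y + ∑ k, zi k x y := fun x y h => by
      rw [← labelMap_of_adj f h, hf]
    have hlift : ∀ i j, s i j → f i = f j := by
      intro i j hij
      induction hij with
      | rel i j h =>
        obtain ⟨x, y, h, h1, h2, rfl, rfl⟩ := h
        refine CharTwo.add_eq_zero.1 ?_
        rw [hf' x y h, hzc0 x y h2, Finset.sum_eq_zero, add_zero]
        exact fun k _ => hzi2 k x y fun h' => h1 ⟨k, h'.2⟩
      | refl => rfl
      | symm _ _ _ ih => exact ih.symm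
      | trans _ _ _ _ _ ih₁ ih₂ => exact ih₁.trans ih₂
    refine ⟨Quotient.lift f hlift, fun k l h => ?_⟩
    change ζ k l = f (ℓ (v k l) (v l k)) + f (ℓ (v l k) (v k l))
    rw [hf' _ _ (hvadj k l h), hzc k l h, Finset.sum_eq_zero, add_zero]
    exact fun m _ => hzi2 m _ _ fun h' =>
      h.ne ((huniq (hv k l h) h'.2.1).trans (huniq h'.2.2 (hv l k h.symm)))

end Minor

/-! ### The two Kuratowski graphs have no algebraic dual -/

section Count

variable {V ι : Type*} [Fintype V] [Finite ι] {G : SimpleGraph V} {ℓ : V → V → ι}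

open Classical in
/-- Every edge lies in at most two of the generators of the cycle space given by a dual, and the sum
of these generators is zero. Hence there are at least `dim + 1` nonzero generators; if all cycles
are long, this gives a lower bound for the number of edges. -/
theorem IsDual.card_le (h : IsDual G ℓ) {m : ℕ} (hpos : 0 < Module.finrank (ZMod 2) (cycleSpace G))
    (hm : ∀ z ∈ cycleSpace G, z ≠ 0 →
      m ≤ (Finset.univ.filter fun p : V × V => z p.1 p.2 ≠ 0).card) :
    (Module.finrank (ZMod 2) (cycleSpace G) + 1) * m ≤
      2 * (Finset.univ.filter fun p : V × V => G.Adj p.1 p.2).card := by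
  have := Fintype.ofFinite ι
  let b : ι → V → V → ZMod 2 := fun i => labelMap G ℓ (Pi.single i 1)
  let J : Finset ι := Finset.univ.filter fun i => b i ≠ 0
  have hrepr : ∀ f, labelMap G ℓ f = ∑ i, f i • b i := fun f => by
    conv_lhs => rw [LinearMap.pi_apply_eq_sum_univ (labelMap G ℓ) f]
    refine Finset.sum_congr rfl fun i _ => ?_
    congr 2
    ext j
    simp [Pi.single_apply, eq_comm]
  have hspan : cycleSpace G = Submodule.span (ZMod 2) (J.image b : Set (V → V → ZMod 2)) := by
    apply le_antisymm
    · intro z hz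
      rw [← h] at hz
      obtain ⟨f, rfl⟩ := hz
      rw [hrepr]
      refine Submodule.sum_mem _ fun i _ => Submodule.smul_mem _ _ ?_
      by_cases hi : b i = 0
      · rw [hi]; exact Submodule.zero_mem _
      · exact Submodule.subset_span (Finset.mem_coe.2 (Finset.mem_image_of_mem _ (by simp [J, hi])))
    · rw [Submodule.span_le]
      intro z hz
      obtain ⟨i, -, rfl⟩ := Finset.mem_image.1 (Finset.mem_coe.1 hz)
      rw [← h]
      exact ⟨_, rfl⟩
  -- The generators in `J` have sum zero, so one of them can be omitted.
  have hsum : ∑ i ∈ J, b i = 0 := by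
    have h1 : ∑ i, b i = 0 := by
      have := hrepr fun _ => 1
      simp only [one_smul] at this
      rw [← this]
      ext x y
      by_cases hxy : G.Adj x y
      · rw [labelMap_of_adj _ hxy]; exact zmod_two_add_self _
      · rw [labelMap_of_not_adj _ hxy]; rfl
    rw [← h1]
    refine Finset.sum_subset (Finset.subset_univ _) fun i _ hi => ?_
    by_contra hne
    exact hi (by simp [J, hne])
  have hJ : Module.finrank (ZMod 2) (cycleSpace G) + 1 ≤ J.card := by
    have hne : J.Nonempty := by
      by_contra hne
      rw [Finset.not_nonempty_iff_eq_empty] at hne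
      rw [hspan, hne, Finset.image_empty, Finset.coe_empty, Submodule.span_empty,
        finrank_bot] at hpos
      exact lt_irrefl _ hpos
    obtain ⟨i₀, hi₀⟩ := hne
    have hle : cycleSpace G ≤
        Submodule.span (ZMod 2) ((J.erase i₀).image b : Set (V → V → ZMod 2)) := by
      rw [hspan, Submodule.span_le]
      intro z hz
      obtain ⟨i, hi, rfl⟩ := Finset.mem_image.1 (Finset.mem_coe.1 hz)
      by_cases hii : i = i₀
      · subst hii
        have : b i = ∑ j ∈ J.erase i, b j := by
          rw [← Finset.add_sum_erase _ _ hi] at hsum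
          ext x y
          have := congrFun (congrFun hsum x) y
          exact CharTwo.add_eq_zero.1 this
        rw [this]
        exact Submodule.sum_mem _ fun j hj => Submodule.subset_span
          (Finset.mem_coe.2 (Finset.mem_image_of_mem _ hj))
      · exact Submodule.subset_span (Finset.mem_coe.2 (Finset.mem_image_of_mem _
          (Finset.mem_erase.2 ⟨hii, hi⟩)))
    have h1 := Submodule.finrank_mono hle
    have h2 := finrank_span_finset_le_card (R := ZMod 2) ((J.erase i₀).image b)
    have h3 := Finset.card_image_le (s := J.erase i₀) (f := b)
    have h4 := Finset.card_erase_add_one hi₀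
    unfold Set.finrank at h2
    omega
  calc (Module.finrank (ZMod 2) (cycleSpace G) + 1) * m ≤ J.card * m := Nat.mul_le_mul_right _ hJ
    _ ≤ ∑ i ∈ J, (Finset.univ.filter fun p : V × V => b i p.1 p.2 ≠ 0).card := by
      rw [← smul_eq_mul]
      refine Finset.card_nsmul_le_sum _ _ _ fun i hi => hm _ ?_ (Finset.mem_filter.1 hi).2
      rw [← h]
      exact ⟨_, rfl⟩
    _ = ∑ p : V × V, (J.filter fun i => b i p.1 p.2 ≠ 0).card := by
      simp only [Finset.card_filter]
      exact Finset.sum_comm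
    _ ≤ ∑ p : V × V, if G.Adj p.1 p.2 then 2 else 0 := by
      refine Finset.sum_le_sum fun p _ => ?_
      split_ifs with hp
      · refine (Finset.card_le_card (t := {ℓ p.1 p.2, ℓ p.2 p.1}) fun i hi => ?_).trans
          Finset.card_le_two
        have hi := (Finset.mem_filter.1 hi).2
        rw [show b i p.1 p.2 = _ from labelMap_of_adj _ hp] at hi
        by_contra hcon
        simp only [Finset.mem_insert, Finset.mem_singleton, not_or] at hcon
        refine hi ?_
        rw [Pi.single_eq_of_ne (Ne.symm hcon.1), Pi.single_eq_of_ne (Ne.symm hcon.2), add_zero]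
      · rw [Finset.filter_false_of_mem fun i _ => ?_, Finset.card_empty]
        rw [show b i p.1 p.2 = _ from labelMap_of_not_adj _ hp]
        exact not_not.2 rfl
    _ = 2 * (Finset.univ.filter fun p : V × V => G.Adj p.1 p.2).card := by
      rw [← Finset.sum_filter, Finset.sum_const, smul_eq_mul, mul_comm]

end Count

section Cycles

variable {V : Type*} [Fintype V] {G : SimpleGraph V}

/-- In an element of the cycle space no vertex has degree one. -/
theorem exists_ne_of_mem_cycleSpace {z : V → V → ZMod 2} (hz : z ∈ cycleSpace G) {x y : V}
    (h : z x y ≠ 0) : ∃ y', y' ≠ y ∧ z x y' ≠ 0 := by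
  classical
  by_contra hcon
  push Not at hcon
  exact h (by rw [← hz.2.2 x, Finset.sum_eq_single_of_mem y (Finset.mem_univ y) fun y' _ => hcon y'])

theorem adj_of_mem_cycleSpace {z : V → V → ZMod 2} (hz : z ∈ cycleSpace G) {x y : V}
    (h : z x y ≠ 0) : G.Adj x y := by
  by_contra hn
  exact h (hz.2.1 x y hn)

open Classical in
/-- The number of vertices with positive degree bounds the size of an element of the cycle space. -/
theorem two_mul_card_le {z : V → V → ZMod 2} (hz : z ∈ cycleSpace G) (S : Finset V)
    (hS : ∀ x ∈ S, ∃ y, z x y ≠ 0) :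
    2 * S.card ≤ (Finset.univ.filter fun p : V × V => z p.1 p.2 ≠ 0).card := by
  have h2 : ∀ x ∈ S, 2 ≤ (Finset.univ.filter fun y => z x y ≠ 0).card := by
    intro x hx
    obtain ⟨y, hy⟩ := hS x hx
    obtain ⟨y', hne, hy'⟩ := exists_ne_of_mem_cycleSpace hz hy
    exact Finset.one_lt_card.2 ⟨y', by simpa using hy', y, by simpa using hy, hne⟩
  calc 2 * S.card = S.card • 2 := by rw [smul_eq_mul, mul_comm]
    _ ≤ ∑ x ∈ S, (Finset.univ.filter fun y => z x y ≠ 0).card := Finset.card_nsmul_le_sum _ _ _ h2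
    _ ≤ ∑ x, (Finset.univ.filter fun y => z x y ≠ 0).card :=
      Finset.sum_le_sum_of_subset (Finset.subset_univ _)
    _ = _ := by
      simp only [Finset.card_filter]
      rw [← Finset.univ_product_univ, Finset.sum_product]

open Classical in
/-- Cycles have at least three edges. -/
theorem six_le_card {z : V → V → ZMod 2} (hz : z ∈ cycleSpace G) (h0 : z ≠ 0) :
    6 ≤ (Finset.univ.filter fun p : V × V => z p.1 p.2 ≠ 0).card := by
  obtain ⟨x, y, hxy⟩ : ∃ x y, z x y ≠ 0 := by
    by_contra hcon
    push Not at hcon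
    exact h0 (by ext x y; exact hcon x y)
  obtain ⟨y', hne, hxy'⟩ := exists_ne_of_mem_cycleSpace hz hxy
  have h1 := (adj_of_mem_cycleSpace hz hxy).ne
  have h2 := (adj_of_mem_cycleSpace hz hxy').ne
  have := two_mul_card_le hz {x, y, y'} (by
    intro v hv
    simp only [Finset.mem_insert, Finset.mem_singleton] at hv
    rcases hv with rfl | rfl | rfl
    exacts [⟨y, hxy⟩, ⟨x, hz.1 _ _ ▸ hxy⟩, ⟨x, hz.1 _ _ ▸ hxy'⟩])
  rwa [Finset.card_eq_three.2 ⟨x, y, y', h1, h2, hne.symm, rfl⟩] at this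

open Classical in
/-- In a triangle-free graph, cycles have at least four edges. -/
theorem eight_le_card (ht : ∀ x y v, G.Adj x y → G.Adj y v → ¬ G.Adj v x)
    {z : V → V → ZMod 2} (hz : z ∈ cycleSpace G) (h0 : z ≠ 0) :
    8 ≤ (Finset.univ.filter fun p : V × V => z p.1 p.2 ≠ 0).card := by
  obtain ⟨x, y, hxy⟩ : ∃ x y, z x y ≠ 0 := by
    by_contra hcon
    push Not at hcon
    exact h0 (by ext x y; exact hcon x y)
  obtain ⟨y', hne, hxy'⟩ := exists_ne_of_mem_cycleSpace hz hxy
  have hyx : z y x ≠ 0 := hz.1 _ _ ▸ hxy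
  obtain ⟨x', hne', hyx'⟩ := exists_ne_of_mem_cycleSpace hz hyx
  have a1 := adj_of_mem_cycleSpace hz hxy
  have a2 := adj_of_mem_cycleSpace hz hxy'
  have a3 := adj_of_mem_cycleSpace hz hyx'
  have hxy2 : x' ≠ y' := by
    rintro rfl
    exact ht x y x' a1 a3 a2.symm
  have := two_mul_card_le hz {x, y, y', x'} (by
    intro v hv
    simp only [Finset.mem_insert, Finset.mem_singleton] at hv
    rcases hv with rfl | rfl | rfl | rfl
    exacts [⟨y, hxy⟩, ⟨x, hyx⟩, ⟨x, hz.1 _ _ ▸ hxy'⟩, ⟨y, hz.1 _ _ ▸ hyx'⟩])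
  rwa [Finset.card_insert_of_notMem (by simp [a1.ne, a2.ne, hne'.symm]),
    Finset.card_eq_three.2 ⟨y, y', x', hne.symm, a3.ne, hxy2.symm, rfl⟩] at this

end Cycles

/-- The cycle space has dimension 6, but seven cycles of length at least three would need more than
20 sides of edges. -/
theorem not_isDual_top {ι : Type*} [Finite ι] {ℓ : Fin 5 → Fin 5 → ι} :
    ¬ IsDual (⊤ : SimpleGraph (Fin 5)) ℓ := by
  classical
  intro h
  have h1 := finrank_cycleSpace (G := (⊤ : SimpleGraph (Fin 5)))
  have hE : Nat.card (⊤ : SimpleGraph (Fin 5)).edgeSet = 10 := by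
    rw [Nat.card_eq_fintype_card, ← SimpleGraph.edgeFinset_card,
      SimpleGraph.card_edgeFinset_top_eq_card_choose_two]
    rfl
  have hC : 0 < Nat.card (⊤ : SimpleGraph (Fin 5)).ConnectedComponent := Nat.card_pos
  rw [hE, Nat.card_eq_fintype_card, Fintype.card_fin] at h1
  have h2 := h.card_le (m := 6) (by omega) fun z hz h0 => six_le_card hz h0
  have h3 : (Finset.univ.filter fun p : Fin 5 × Fin 5 => p.1 ≠ p.2).card = 20 := by decide
  have h4 := h2.trans_eq (c := 2 * (Finset.univ.filter fun p : Fin 5 × Fin 5 => p.1 ≠ p.2).card)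
    (by congr!)
  omega

/-- The cycle space has dimension 4, but five cycles of length at least four would need more than
18 sides of edges. -/
theorem not_isDual_completeBipartiteGraph {ι : Type*} [Finite ι]
    {ℓ : Fin 3 ⊕ Fin 3 → Fin 3 ⊕ Fin 3 → ι} :
    ¬ IsDual (completeBipartiteGraph (Fin 3) (Fin 3)) ℓ := by
  classical
  intro h
  have h1 := finrank_cycleSpace (G := completeBipartiteGraph (Fin 3) (Fin 3))
  have hE : Nat.card (completeBipartiteGraph (Fin 3) (Fin 3)).edgeSet = 9 := by
    rw [Nat.card_coe_set_eq, Set.ncard, SimpleGraph.encard_edgeSet_completeBipartiteGraph]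
    simp
  have hC : 0 < Nat.card (completeBipartiteGraph (Fin 3) (Fin 3)).ConnectedComponent := Nat.card_pos
  rw [hE, Nat.card_eq_fintype_card, Fintype.card_sum, Fintype.card_fin] at h1
  have h2 := h.card_le (m := 8) (by omega) fun z hz h0 => eight_le_card (by
    rintro (x | x) (y | y) (v | v) <;> simp) hz h0
  have h3 : (Finset.univ.filter fun p : (Fin 3 ⊕ Fin 3) × (Fin 3 ⊕ Fin 3) =>
      p.1.isLeft ∧ p.2.isRight ∨ p.1.isRight ∧ p.2.isLeft).card = 18 := by decide
  have h4 := h2.trans_eq (c := 2 * (Finset.univ.filter fun p : (Fin 3 ⊕ Fin 3) × (Fin 3 ⊕ Fin 3) =>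
      p.1.isLeft ∧ p.2.isRight ∨ p.1.isRight ∧ p.2.isLeft).card) (by congr!)
  omega

/-! ### Coning off a facial cycle -/

section Cone

variable {V : Type*} {G : SimpleGraph V}

theorem SimpleGraph.Walk.IsCycle.exists_dart_snd {u : V} {C : G.Walk u u} (hC : C.IsCycle) {x : V}
    (hx : x ∈ C.support) : ∃ d ∈ C.darts, d.snd = x := by
  have : x ∈ C.support.tail := by
    cases C with
    | nil => exact absurd hC.not_nil (by simp)
    | cons e Q =>
      rw [SimpleGraph.Walk.support_cons, List.mem_cons] at hx
      rw [SimpleGraph.Walk.support_cons, List.tail_cons]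
      rcases hx with rfl | hx
      exacts [Q.end_mem_support, hx]
  rw [← SimpleGraph.Walk.map_snd_darts, List.mem_map] at this
  exact this

theorem SimpleGraph.Walk.IsCycle.dart_eq_of_snd {u : V} {C : G.Walk u u} (hC : C.IsCycle)
    {d e : G.Dart} (hd : d ∈ C.darts) (he : e ∈ C.darts) (h : d.snd = e.snd) : d = e :=
  List.inj_on_of_nodup_map (by rw [SimpleGraph.Walk.map_snd_darts]; exact hC.support_nodup) hd he h

open Classical in
/-- The sides of the edges in the cone over a facial cycle: the face of the cycle is replaced by
triangles at the apex, one for each dart of the cycle. At the boundary vertex `x`, where `i x` is the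
dart of the cycle ending in `x`, the triangles to both sides of the new edge are those of `i x` and
of its successor. -/
noncomputable def coneLabel (R : RotationSystem G) {u : V} (C : G.Walk u u) (i : V → G.Dart)
    (j : G.Dart) : Option V → Option V → R.Face ⊕ G.Dart
  | some x, some y => if h : G.Adj x y then
      (if (⟨(x, y), h⟩ : G.Dart) ∈ C.darts then .inr ⟨(x, y), h⟩ else .inl (R.face ⟨(x, y), h⟩))
      else .inr j
  | some x, none => .inr (i x)
  | none, some x => .inr (R.facePerm (i x))
  | none, none => .inr j

variable [Fintype V]

open Classical in
/-- On an orbit `D` of a permutation, a function with sum zero is a difference `g d + g (σ d)`. -/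
theorem exists_of_single_cycle {α : Type*} [Fintype α] {σ : Equiv.Perm α} {D : Finset α}
    (hD : ∀ d ∈ D, ∀ e, σ.SameCycle d e ↔ e ∈ D) {h : α → ZMod 2} (hs : ∑ d ∈ D, h d = 0) :
    ∃ g : α → ZMod 2, ∀ d ∈ D, g d + g (σ d) = h d := by
  rcases D.eq_empty_or_nonempty with rfl | ⟨d₀, hd₀⟩
  · exact ⟨0, by simp⟩
  let T : (α → ZMod 2) →ₗ[ZMod 2] (α → ZMod 2) :=
    { toFun := fun g d => if d ∈ D then g d + g (σ d) else 0
      map_add' := fun g g' => by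
        ext d
        by_cases hd : d ∈ D
        · simp only [hd, if_true, Pi.add_apply]; abel
        · simp [hd]
      map_smul' := fun c g => by
        ext d
        by_cases hd : d ∈ D
        · simp only [hd, if_true, Pi.smul_apply, smul_add, RingHom.id_apply]
        · simp [hd] }
  have hσ : ∀ d, σ d ∈ D ↔ d ∈ D := by
    intro d
    constructor
    · intro hd
      exact (hD _ hd d).1 (Equiv.Perm.sameCycle_apply_left.2 (Equiv.Perm.SameCycle.refl _ _))
    · intro hd
      exact (hD _ hd _).1 (Equiv.Perm.sameCycle_apply_right.2 (Equiv.Perm.SameCycle.refl _ _))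
  have step : ∀ d ∈ D, (Pi.single d 1 + Pi.single (σ d) 1 : α → ZMod 2) ∈ LinearMap.range T := by
    intro d hd
    refine ⟨Pi.single (σ d) 1, ?_⟩
    ext e
    change (if e ∈ D then _ else _) = _
    simp only [Pi.add_apply, Pi.single_apply, EmbeddingLike.apply_eq_iff_eq]
    by_cases he : e ∈ D
    · rw [if_pos he, add_comm]
    · rw [if_neg he, if_neg (by rintro rfl; exact he hd),
        if_neg (by rintro rfl; exact he ((hσ d).2 hd)), add_zero]
  have two : ∀ s : α → ZMod 2, s + s = 0 := fun s => by ext; exact zmod_two_add_self _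
  have pair : ∀ d ∈ D, (Pi.single d 1 + Pi.single d₀ 1 : α → ZMod 2) ∈ LinearMap.range T := by
    intro d hd
    obtain ⟨n, rfl⟩ := ((hD _ hd₀ d).2 hd).exists_nat_pow_eq
    clear hd
    induction n with
    | zero => rw [pow_zero, Equiv.Perm.one_apply, two]; exact Submodule.zero_mem _
    | succ n ih =>
      have hn : (σ ^ n) d₀ ∈ D := (hD _ hd₀ _).1 ⟨n, by simp⟩
      have := Submodule.add_mem _ (step _ hn) ih
      rw [pow_succ', Equiv.Perm.mul_apply]
      convert this using 1
      rw [add_comm (Pi.single ((σ ^ n) d₀) 1) (Pi.single (σ _) 1), add_assoc,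
        ← add_assoc (Pi.single ((σ ^ n) d₀) 1), two, zero_add]
  obtain ⟨g, hg⟩ : (fun d => if d ∈ D then h d else 0) ∈ LinearMap.range T := by
    refine mem_of_single_add_single (fun _ => d₀) (fun d hd => pair d ?_) fun r => ?_
    · by_contra hn
      exact hd (if_neg hn)
    · by_cases hr : d₀ = r
      · rw [Finset.filter_true_of_mem fun _ _ => hr, ← Finset.sum_filter,
          Finset.filter_mem_eq_inter, Finset.univ_inter, hs]
      · rw [Finset.filter_false_of_mem fun _ _ => hr, Finset.sum_empty]
  refine ⟨g, fun d hd => ?_⟩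
  have := congrFun hg d
  simp only [hd, if_true] at this
  rw [← this]
  exact (if_pos hd).symm

/-- If `C` bounds a face of a planar rotation system, then the cone over `C` has a dual. -/
theorem RotationSystem.IsPlanar.isDual_cone {R : RotationSystem G} (hR : R.IsPlanar) {u : V}
    {C : G.Walk u u} (hC : C.IsCycle) (hF : R.IsFacial C) :
    ∃ ℓ : Option V → Option V → R.Face ⊕ G.Dart, IsDual (cone G {x | x ∈ C.support}) ℓ := by
  classical
  have := Fintype.ofFinite G.Dart
  obtain ⟨j, hj, -⟩ := hC.exists_dart_snd C.start_mem_support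
  have hi : ∀ x, ∃ d : G.Dart, x ∈ C.support → d ∈ C.darts ∧ d.snd = x := by
    intro x
    by_cases hx : x ∈ C.support
    · obtain ⟨d, hd⟩ := hC.exists_dart_snd hx
      exact ⟨d, fun _ => hd⟩
    · exact ⟨j, fun h => absurd h hx⟩
  choose i hi using hi
  have hsupp : ∀ d ∈ C.darts, d.snd ∈ C.support := fun d hd => C.dart_snd_mem_support_of_mem_darts hd
  have hieq : ∀ d ∈ C.darts, i d.snd = d := fun d hd =>
    hC.dart_eq_of_snd (hi _ (hsupp d hd)).1 hd (hi _ (hsupp d hd)).2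
  have hσ : ∀ d, R.facePerm d ∈ C.darts ↔ d ∈ C.darts := by
    intro d
    constructor
    · intro hd
      exact (hF _ hd d).1 (Equiv.Perm.sameCycle_apply_left.2 (Equiv.Perm.SameCycle.refl _ _))
    · intro hd
      exact (hF _ hd _).1 (Equiv.Perm.sameCycle_apply_right.2 (Equiv.Perm.SameCycle.refl _ _))
  let D : Finset G.Dart := Finset.univ.filter fun d => d ∈ C.darts
  have hDsum : ∀ F : V → ZMod 2, ∑ x with x ∈ C.support, F x = ∑ d ∈ D, F d.snd := by
    intro F
    refine Finset.sum_bij' (fun x _ => i x) (fun d _ => d.snd) ?_ ?_ ?_ ?_ ?_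
    · intro x hx
      simpa [D] using (hi x (by simpa using hx)).1
    · intro d hd
      simpa using hsupp d (by simpa [D] using hd)
    · intro x hx
      exact (hi x (by simpa using hx)).2
    · intro d hd
      exact hieq d (by simpa [D] using hd)
    · intro x hx
      rw [(hi x (by simpa using hx)).2]
  set H := cone G {x | x ∈ C.support} with hH
  let ℓ := coneLabel R C i j
  -- The side of a dart of `G`.
  let lab : G.Dart → R.Face ⊕ G.Dart := fun d => if d ∈ C.darts then .inr d else .inl (R.face d)
  have hlab : ∀ x y (h : G.Adj x y), ℓ (some x) (some y) = lab ⟨(x, y), h⟩ := fun x y h => dif_pos h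
  have hadj : ∀ x y, H.Adj (some x) (some y) ↔ G.Adj x y := fun _ _ => Iff.rfl
  have hadj0 : ∀ x, H.Adj (some x) none ↔ x ∈ C.support := fun _ => Iff.rfl
  have hadj1 : ∀ x, H.Adj none (some x) ↔ x ∈ C.support := fun _ => Iff.rfl
  have heven : ∀ (f : R.Face ⊕ G.Dart → ZMod 2) x, ∑ y, labelMap H ℓ f x y = 0 := by
    rintro f (_ | x)
    · rw [Fintype.sum_option, labelMap_of_not_adj _ H.irrefl, zero_add]
      have : ∀ x, labelMap H ℓ f none (some x) =
          if x ∈ C.support then f (.inr (R.facePerm (i x))) + f (.inr (i x)) else 0 := by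
        intro x
        split_ifs with hx
        · exact labelMap_of_adj f ((hadj1 x).2 hx)
        · exact labelMap_of_not_adj f fun h => hx ((hadj1 x).1 h)
      simp only [this]
      rw [← Finset.sum_filter, hDsum, Finset.sum_congr rfl (g := fun d =>
        f (.inr (R.facePerm d)) + f (.inr d)) fun d hd => by
          rw [hieq d (by simpa [D] using hd)], Finset.sum_add_distrib,
        Finset.sum_equiv (t := D) R.facePerm (g := fun d => f (.inr d)) (by simp [D, hσ])
          fun _ _ => rfl]
      exact zmod_two_add_self _
    · rw [Fintype.sum_option, sum_dart (G := G) (x := x) (z := fun y => labelMap H ℓ f (some x) (some y))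
        (F := fun d => f (lab d) + f (lab d.symm))
        (fun y h => by
          rw [labelMap_of_adj f ((hadj x y).2 h), hlab x y h, hlab y x h.symm]
          rfl)
        fun y h => labelMap_of_not_adj f h]
      rw [Finset.sum_add_distrib, ← R.sum_next x fun d => f (lab d), ← Finset.sum_add_distrib]
      simp only [← R.facePerm_symm]
      have hzero : ∀ e, e ∉ C.darts → f (lab (R.facePerm e)) + f (lab e) = 0 := by
        intro e he
        simp only [lab, he, (hσ e).not.2 he, if_false, R.face_facePerm, zmod_two_add_self]
      by_cases hx : x ∈ C.support
      · obtain ⟨h1, h2⟩ := hi x hx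
        rw [labelMap_of_adj f ((hadj0 x).2 hx), Finset.sum_eq_single_of_mem (i x).symm (by
          simpa using h2) fun d hd hne => hzero _ fun hd' => hne ?_]
        · simp only [SimpleGraph.Dart.symm_symm, lab, h1, (hσ _).2 h1, if_true]
          change f (.inr (i x)) + f (.inr (R.facePerm (i x))) + _ = 0
          rw [add_comm (f (.inr (i x)))]
          exact zmod_two_add_self _
        · have hdx : d.symm.snd = x := by simpa using hd
          rw [show i x = d.symm from by rw [← hdx]; exact hieq _ hd', SimpleGraph.Dart.symm_symm]
      · rw [labelMap_of_not_adj f fun h => hx ((hadj0 x).1 h), zero_add]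
        refine Finset.sum_eq_zero fun d hd => hzero _ fun hd' => hx ?_
        have hdx : d.symm.snd = x := by simpa using hd
        exact hdx ▸ hsupp _ hd'
  refine ⟨ℓ, isDual_of heven fun z hz => ?_⟩
  -- Find a function `g` on the triangles whose coboundary agrees with `z` at the apex.
  obtain ⟨g, hg⟩ := exists_of_single_cycle (σ := R.facePerm) (D := D)
    (h := fun d => z none (some d.snd))
    (fun d hd e => by simpa [D] using hF d (by simpa [D] using hd) e) (by
      rw [← hDsum fun x => z none (some x), Finset.sum_filter]
      have h0 := hz.2.2 none
      rw [Fintype.sum_option, hz.2.1 none none H.irrefl, zero_add] at h0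
      refine Eq.trans ?_ h0
      refine Finset.sum_congr rfl fun x _ => ?_
      split_ifs with hx
      · rfl
      · exact (hz.2.1 _ _ fun h => hx ((hadj1 x).1 h)).symm)
  have hg' : ∀ x ∈ C.support, g (i x) + g (R.facePerm (i x)) = z none (some x) := by
    intro x hx
    obtain ⟨h1, h2⟩ := hi x hx
    have := hg (i x) (by simpa [D] using h1)
    rwa [h2] at this
  -- Subtracting the coboundary of `g`, we obtain a cycle which avoids the apex.
  let k : R.Face ⊕ G.Dart → ZMod 2 := Sum.elim 0 g
  have hz0 : ∀ x, z (some x) none + labelMap H ℓ k (some x) none = 0 := by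
    intro x
    by_cases hx : x ∈ C.support
    · rw [labelMap_of_adj k ((hadj0 x).2 hx), hz.1, ← hg' x hx]
      exact zmod_two_add_self _
    · rw [labelMap_of_not_adj k fun h => hx ((hadj0 x).1 h),
        hz.2.1 _ _ fun h => hx ((hadj0 x).1 h), add_zero]
  have hcyc : (fun x y => z (some x) (some y) + labelMap H ℓ k (some x) (some y)) ∈ cycleSpace G := by
    refine ⟨fun x y => ?_, fun x y h => ?_, fun x => ?_⟩
    · simp only [hz.1 (some x), labelMap_symm k (some x)]
    · dsimp only
      rw [hz.2.1 _ _ (by exact h), labelMap_of_not_adj k (by exact h), add_zero]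
    · have h1 := hz.2.2 (some x)
      have h2 := heven k (some x)
      rw [Fintype.sum_option] at h1 h2
      rw [Finset.sum_add_distrib]
      linear_combination h1 + h2 - hz0 x
  rw [← hR.range_faceMap] at hcyc
  obtain ⟨f, hf⟩ := hcyc
  let F : R.Face ⊕ G.Dart → ZMod 2 := Sum.elim f fun d => f (R.face d) + g d
  have hFlab : ∀ d, F (lab d) = f (R.face d) + k (lab d) := by
    intro d
    by_cases hd : d ∈ C.darts
    · simp only [lab, hd, if_true]; rfl
    · simp only [lab, hd, if_false]; exact (add_zero _).symm
  have hF0 : ∀ x ∈ C.support, z none (some x) =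
      F (.inr (R.facePerm (i x))) + F (.inr (i x)) := by
    intro x hx
    rw [← hg' x hx]
    change _ = f (R.face (R.facePerm (i x))) + g _ + (f (R.face (i x)) + g (i x))
    rw [R.face_facePerm]
    linear_combination -zmod_two_add_self (f (R.face (i x)))
  refine ⟨F, ?_⟩
  rintro (_ | x) (_ | y) h
  · exact absurd h H.irrefl
  · exact hF0 y h
  · rw [hz.1, hF0 x h, add_comm]
    rfl
  · have h' : G.Adj x y := h
    have h1 := congrFun (congrFun hf x) y
    rw [R.faceMap_of_adj f h', labelMap_of_adj k h] at h1
    rw [hlab x y h', hlab y x h'.symm] at h1 ⊢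
    rw [hFlab, hFlab]
    linear_combination -h1 - zmod_two_add_self (k (lab ⟨(x, y), h'⟩)) -
      zmod_two_add_self (k (lab ⟨(y, x), h'.symm⟩))

end Cone

/-! ### Sufficient colourings of the ends -/

section Ends

variable {V : Type*} {G : SimpleGraph V} {L : V → Finset ℕ} {p q r : V} {a b c : ℕ}

theorem exists_two_pairs_ne {A B : Finset ℕ} (hA : A.Nonempty) (hB : B.Nonempty)
    (h : 4 ≤ A.card + B.card) : ∃ a ∈ A, ∃ b ∈ B, ∃ a' ∈ A, ∃ b' ∈ B, a ≠ b ∧ a' ≠ b' ∧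
      (a ≠ a' ∨ b ≠ b') := by
  have key : ∀ {A B : Finset ℕ}, A.Nonempty → 3 ≤ B.card → ∃ a ∈ A, ∃ b ∈ B, ∃ b' ∈ B,
      a ≠ b ∧ a ≠ b' ∧ b ≠ b' := by
    rintro A B ⟨a, ha⟩ hB
    obtain ⟨b, hb, b', hb', hbb⟩ := Finset.one_lt_card.1 (by
      have := Finset.pred_card_le_card_erase (s := B) (a := a)
      omega : 1 < (B.erase a).card)
    rw [Finset.mem_erase] at hb hb'
    exact ⟨a, ha, b, hb.2, b', hb'.2, hb.1.symm, hb'.1.symm, hbb⟩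
  by_cases hB3 : 3 ≤ B.card
  · obtain ⟨a, ha, b, hb, b', hb', h1, h2, h3⟩ := key hA hB3
    exact ⟨a, ha, b, hb, a, ha, b', hb', h1, h2, .inr h3⟩
  by_cases hA3 : 3 ≤ A.card
  · obtain ⟨b, hb, a, ha, a', ha', h1, h2, h3⟩ := key hB hA3
    exact ⟨a, ha, b, hb, a', ha', b, hb, h1.symm, h2.symm, .inl h3⟩
  obtain ⟨a, ha, a', ha', haa⟩ := Finset.one_lt_card.1 (by omega : 1 < A.card)
  obtain ⟨b, hb, hba⟩ := exists_mem_ne_of_two_le (by omega : 2 ≤ B.card) a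
  obtain ⟨b', hb', hba'⟩ := exists_mem_ne_of_two_le (by omega : 2 ≤ B.card) a'
  exact ⟨a, ha, b, hb, a', ha', b', hb', hba.symm, hba'.symm, .inl haa⟩

theorem exists_two_pairs {A B : Finset ℕ} (hA : A.Nonempty) (hB : B.Nonempty)
    (h : 4 ≤ A.card + B.card) (x : ℕ × ℕ) : ∃ a ∈ A, ∃ b ∈ B, ∃ a' ∈ A, ∃ b' ∈ B,
      (a, b) ≠ x ∧ (a', b') ≠ x ∧ (a ≠ a' ∨ b ≠ b') := by
  have h1 := hA.card_pos
  have h2 := hB.card_pos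
  obtain ⟨⟨a, b⟩, hab, ⟨a', b'⟩, hab', hne⟩ := Finset.one_lt_card.1 (by
    have := Finset.pred_card_le_card_erase (s := A ×ˢ B) (a := x)
    rw [Finset.card_product] at this
    nlinarith [Nat.sub_add_cancel (Nat.mul_pos h1 h2)] : 1 < ((A ×ˢ B).erase x).card)
  rw [Finset.mem_erase, Finset.mem_product] at hab hab'
  refine ⟨a, hab.2.1, b, hab.2.2, a', hab'.2.1, b', hab'.2.2, hab.1, hab'.1, ?_⟩
  by_contra hcon
  push Not at hcon
  exact hne (by rw [hcon.1, hcon.2])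

open Classical in
/-- The colouring of the ends of the path with colours `a` and `b`. -/
noncomputable def endColoring (p r : V) (a b : ℕ) : ({p, r} : Set V) → ℕ :=
  fun x => if (x : V) = p then a else b

theorem endColoring_left : endColoring p r a b ⟨p, by simp⟩ = a := if_pos rfl

theorem endColoring_right (hpr : p ≠ r) : endColoring p r a b ⟨r, by simp⟩ = b := if_neg hpr.symm

theorem endColoring_mem {O : Set V} (h : Rainbow G Set.univ O L p q r) (ha : a ∈ L p) (hb : b ∈ L r)
    (hab : G.Adj p r → a ≠ b) (hgood : ∀ c, ¬ Bad G Set.univ L p q r a c b) :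
    endColoring p r a b ∈ EndColorings G L
      (SimpleGraph.Walk.cons h.epq (SimpleGraph.Walk.cons h.eqr SimpleGraph.Walk.nil)) := by
  have hl : endColoring p r a b ⟨p, by simp⟩ = a := endColoring_left
  have hr : endColoring p r a b ⟨r, by simp⟩ = b := endColoring_right h.hpr
  refine ⟨⟨?_, ?_⟩, ?_⟩
  · rintro ⟨v, rfl | rfl⟩
    · rw [hl]; exact ha
    · rw [hr]; exact hb
  · rintro ⟨v, rfl | rfl⟩ ⟨w, rfl | rfl⟩ e
    · exact absurd e (by simp)
    · rw [hl, hr]; exact hab e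
    · rw [hl, hr]; exact (hab e.symm).symm
    · exact absurd e (by simp)
  · intro ψ hψ hext
    have hX' : ∀ x, x ∈ ({p, r} ∪ (SimpleGraph.Walk.cons h.epq
        (SimpleGraph.Walk.cons h.eqr SimpleGraph.Walk.nil)).toSubgraph.verts : Set V) ↔
        x = p ∨ x = q ∨ x = r := by
      intro x
      simp
      grind
    have mp := (hX' p).2 (by simp)
    have mq := (hX' q).2 (by simp)
    have mr := (hX' r).2 (by simp)
    have ep : ψ ⟨p, mp⟩ = a := (hext p (by simp)).trans hl
    have er : ψ ⟨r, mr⟩ = b := (hext r (by simp)).trans hr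
    have hb := hgood (ψ ⟨q, mq⟩)
    simp only [Bad, not_and, not_not] at hb
    obtain ⟨φ, hφ, h1, h2, h3⟩ := hb (ep ▸ hψ.2 ⟨p, mp⟩ ⟨q, mq⟩ h.epq)
      (er ▸ hψ.2 ⟨q, mq⟩ ⟨r, mr⟩ h.eqr)
    have key : ∀ v hv, φ v = ψ ⟨v, hv⟩ := by
      intro v hv
      rcases (hX' v).1 hv with rfl | rfl | rfl
      exacts [h1.trans ep.symm, h2, h3.trans er.symm]
    refine ⟨φ, ⟨fun v => ?_, fun v w e => hφ.proper v trivial w trivial e⟩, fun v => key v v.2⟩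
    by_cases hv : v = p ∨ v = q ∨ v = r
    · rw [key v ((hX' v).2 hv)]; exact hψ.1 ⟨v, (hX' v).2 hv⟩
    · exact hφ.mem v trivial fun h => hv h

theorem two_le_encard_endColorings {O : Set V} (h : Rainbow G Set.univ O L p q r)
    (hab : ∃ a ∈ L p, ∃ b ∈ L r, ∃ a' ∈ L p, ∃ b' ∈ L r,
      ((G.Adj p r → a ≠ b) ∧ ∀ c, ¬ Bad G Set.univ L p q r a c b) ∧
      ((G.Adj p r → a' ≠ b') ∧ ∀ c, ¬ Bad G Set.univ L p q r a' c b') ∧ (a ≠ a' ∨ b ≠ b')) :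
    2 ≤ (EndColorings G L
      (SimpleGraph.Walk.cons h.epq (SimpleGraph.Walk.cons h.eqr SimpleGraph.Walk.nil))).encard := by
  obtain ⟨a, ha, b, hb, a', ha', b', hb', h1, h2, hne⟩ := hab
  have hne' : endColoring p r a b ≠ endColoring p r a' b' := by
    intro heq
    rcases hne with hne | hne
    · exact hne (by
        rw [← endColoring_left (p := p) (r := r) (a := a) (b := b), heq, endColoring_left])
    · exact hne (by rw [← endColoring_right h.hpr (a := a) (b := b), heq, endColoring_right h.hpr])
  rw [← Set.encard_pair hne']
  refine Set.encard_le_encard ?_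
  rintro x (rfl | rfl)
  exacts [endColoring_mem h ha hb h1.1 h1.2, endColoring_mem h ha' hb' h2.1 h2.2]

theorem Rainbow.endColorings [Finite V] {O : Set V} (h : Rainbow G Set.univ O L p q r)
    (hA : (L p).Nonempty) (hB : (L r).Nonempty) (h4 : 4 ≤ (L p).card + (L r).card) :
    (EndColorings G L
      (SimpleGraph.Walk.cons h.epq (SimpleGraph.Walk.cons h.eqr SimpleGraph.Walk.nil))).Nonempty ∧
    (2 ≤ (EndColorings G L
      (SimpleGraph.Walk.cons h.epq (SimpleGraph.Walk.cons h.eqr SimpleGraph.Walk.nil))).encard ∨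
      ∃ Q : G.Walk p r, Q.IsPath ∧ Even Q.length ∧ ∀ x ∈ Q.support, x ∈ O ∧ G.Adj q x) := by
  have fin : ∀ {α : Type _} {E : Set α} {P : Prop}, 2 ≤ E.encard → E.Nonempty ∧ (2 ≤ E.encard ∨ P) :=
    fun h2 => ⟨Set.encard_pos.1 (lt_of_lt_of_le (by norm_num) h2), .inl h2⟩
  have diag : (∀ a c b, Bad G Set.univ L p q r a c b → a = b) → 2 ≤ (EndColorings G L
      (SimpleGraph.Walk.cons h.epq (SimpleGraph.Walk.cons h.eqr SimpleGraph.Walk.nil))).encard := by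
    intro hd
    obtain ⟨a, ha, b, hb, a', ha', b', hb', h1, h2, hne⟩ := exists_two_pairs_ne hA hB h4
    exact two_le_encard_endColorings h ⟨a, ha, b, hb, a', ha', b', hb',
      ⟨fun _ => h1, fun c hc => h1 (hd _ _ _ hc)⟩, ⟨fun _ => h2, fun c hc => h2 (hd _ _ _ hc)⟩, hne⟩
  by_cases epr : G.Adj p r
  · exact fin (diag fun a c b hb => h.eq_of_bad_of_adj epr hb)
  have single : ∀ a₀ b₀, (∀ a c b, Bad G Set.univ L p q r a c b → a = a₀ ∧ b = b₀) →
      2 ≤ (EndColorings G L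
        (SimpleGraph.Walk.cons h.epq (SimpleGraph.Walk.cons h.eqr SimpleGraph.Walk.nil))).encard := by
    intro a₀ b₀ hd
    obtain ⟨a, ha, b, hb, a', ha', b', hb', h1, h2, hne⟩ := exists_two_pairs hA hB h4 (a₀, b₀)
    exact two_le_encard_endColorings h ⟨a, ha, b, hb, a', ha', b', hb',
      ⟨fun e => absurd e epr, fun c hc => h1 (Prod.ext (hd _ _ _ hc).1 (hd _ _ _ hc).2)⟩,
      ⟨fun e => absurd e epr, fun c hc => h2 (Prod.ext (hd _ _ _ hc).1 (hd _ _ _ hc).2)⟩, hne⟩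
  rcases (hub_and_dichotomy _ _ _ _ _ _ h).2 epr with ⟨a₀, c₀, b₀, hU⟩ |
    ⟨Q, hQ, ⟨hev, T, hT, hE⟩ | ⟨-, ⟨T, hT, hE⟩ | ⟨a₀, b₀, c₁, c₂, hab, hE⟩⟩⟩
  · exact fin (single a₀ b₀ fun a c b hb => ⟨(hU _ _ _ hb).1, (hU _ _ _ hb).2.2⟩)
  · refine ⟨?_, .inr ⟨Q, hQ.1, hev, fun x hx => ⟨(hQ.2 x hx).1.2, (hQ.2 x hx).2⟩⟩⟩
    obtain ⟨a, ha, b, hb, hgood⟩ : ∃ a ∈ L p, ∃ b ∈ L r, ∀ c, ¬ Bad G Set.univ L p q r a c b := by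
      -- A common colour of the ends, or else a colour of one end outside the three colours of `T`.
      by_cases hd : Disjoint (L p) (L r)
      · obtain ⟨x, hx, hxT⟩ : ∃ x ∈ L p ∪ L r, x ∉ T := by
          refine Finset.exists_mem_notMem_of_card_lt_card ?_
          rw [Finset.card_union_of_disjoint hd]
          omega
        rcases Finset.mem_union.1 hx with hx | hx
        · obtain ⟨b, hb⟩ := hB
          exact ⟨x, hx, b, hb, fun c hc => hxT (hE _ _ _ hc).1⟩
        · obtain ⟨a, ha⟩ := hA
          exact ⟨a, ha, x, hx, fun c hc => hxT (hE _ _ _ hc).2.2.1⟩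
      · obtain ⟨x, hx, hx'⟩ := Finset.not_disjoint_iff.1 hd
        exact ⟨x, hx, x, hx', fun c hc => (hE _ _ _ hc).2.2.2 rfl⟩
    exact ⟨_, endColoring_mem h ha hb (fun e => absurd e epr) hgood⟩
  · exact fin (diag fun a c b hb => (hE _ _ _ hb).1)
  · exact fin (single a₀ b₀ fun a c b hb => ⟨(hE _ _ _ hb).1, (hE _ _ _ hb).2.1⟩)

end Ends

/-- The only consequence of planarity that the colouring arguments need. -/
theorem IsPlanarWithOuterCycle.disc {V : Type*} [Finite V] {G : SimpleGraph V} {u : V}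
    {C : G.Walk u u} (h : IsPlanarWithOuterCycle G C) : Disc G Set.univ {x | x ∈ C.support} := by
  classical
  obtain ⟨hC, R, hR, hF⟩ := h
  have := Fintype.ofFinite V
  have : Finite R.Face := Quotient.finite _
  obtain ⟨ℓ, hℓ⟩ := hR.isDual_cone hC hF
  refine ⟨fun hm => ?_, fun hm => ?_⟩
  · obtain ⟨s, ℓ', h'⟩ := hℓ.of_hasModel hm
    exact not_isDual_top h'
  · obtain ⟨s, ℓ', h'⟩ := hℓ.of_hasModel hm
    exact not_isDual_completeBipartiteGraph h'

theorem theorem3p2 {V : Type*} [Finite V] (G : SimpleGraph V) {u : V} (C : G.Walk u u)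
    {p₀ q p₁ : V} (h₀ : G.Adj p₀ q) (h₁ : G.Adj q p₁) (L : V → Finset ℕ)
    (hR : IsEndLinkedRainbow G C
      (SimpleGraph.Walk.cons h₀ (SimpleGraph.Walk.cons h₁ SimpleGraph.Walk.nil)) L) :
    (EndColorings G L
      (SimpleGraph.Walk.cons h₀ (SimpleGraph.Walk.cons h₁ SimpleGraph.Walk.nil))).Nonempty ∧
    (2 ≤ (EndColorings G L
        (SimpleGraph.Walk.cons h₀ (SimpleGraph.Walk.cons h₁ SimpleGraph.Walk.nil))).encard ∨
      ∃ Q : G.Walk p₀ p₁, Q.IsPath ∧ Even Q.length ∧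
        ∀ x ∈ Q.support, x ∈ C.support ∧ G.Adj q x) := by
  obtain ⟨hR, h4⟩ := hR
  have e₀ : s(p₀, q) ∈ C.edges := hR.edges_subset _ (by simp)
  have e₁ : s(q, p₁) ∈ C.edges := hR.edges_subset _ (by simp)
  have h : Rainbow G Set.univ {x | x ∈ C.support} L p₀ q p₁ :=
    { disc := hR.planar.disc
      hp := ⟨trivial, C.fst_mem_support_of_mem_edges e₀⟩
      hq := ⟨trivial, C.snd_mem_support_of_mem_edges e₀⟩
      hr := ⟨trivial, C.snd_mem_support_of_mem_edges e₁⟩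
      epq := h₀
      eqr := h₁
      hpr := by
        rintro rfl
        simpa using hR.isPath
      lists := fun v _ hv => ⟨fun hvC => hR.three_le v hvC (by simpa using hv),
        fun hvC => hR.five_le v hvC⟩ }
  exact h.endColorings hR.nonempty_left hR.nonempty_right h4
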